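/- **Conventions.** $\mathbb{Z}\times\mathbb{R}$ acts continuously on spaces; $x+n$ denotes the action of $n\in\mathbb{Z}$, $t\cdot x$ that of $t\in\mathbb{R}$, $L^{\mathbb{R}}$ the set of $\mathbb{R}$-fixed points and $L^\circ=L\setminus L^{\mathbb{R}}$. In $[-\infty,\infty]$ the expressions $\pm\infty+(\mp\infty)$ and $\pm\infty-(\pm\infty)$ are undefined. A *broken paracycle* is a space $L\cong\mathbb{R}$ with a continuous $\mathbb{Z}\times\mathbb{R}$-action such that $\mathbb{Z}$ acts freely, some homeomorphism $L\cong\mathbb{R}$ satisfies $t\cdot x\ge x$ for all $t\ge0$ (inducing an order $\le_L$ on $L$), $x\le_L x+1$ for all $x$, and $L^{\mathbb{R}}$ is discrete and non-empty. Its translation distance $d_L(x,y)$, defined unless $x=y\in L^{\mathbb R}$, is $t$ if $t\cdot x=y$, $-\infty$ if $t\cdot x\ge y$ for all $t$, and $\infty$ if $t\cdot x\le y$ for all $t$. A *family of broken paracycles* over a space $S$ is a continuous map $\pi:L_S\to S$ with a continuous fibre-preserving $\mathbb{Z}\times\mathbb{R}$-action such that: each fibre $L_s$ is a broken paracycle;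 each $s\in S$ has an open neighbourhood $U$ over which $(L_U/\mathbb{Z})^{\mathbb{R}}$ is a finite disjoint union of closed subsets of $L_U/\mathbb{Z}$, each mapped by a closed embedding to $U$; $L_S/\mathbb{Z}\to S$ is a closed map; $\{(x,y):x\le y\}$ is closed in $L_S\times_S L_S$; and every $x\in L_S^\circ$ is the value at $\pi(x)$ of a continuous section of $L_S^\circ\to S$ over an open neighbourhood of $\pi(x)$. A map of families is an equivariant pullback square; these form the category $\mathrm{Pt}(\mathrm{Broken}_{para})$, which has a forgetful functor to $\mathrm{Top}$. A *paracyclic preorder* is a countable linear preorder $I$ with a free, order-preserving $\mathbb{Z}$-action such that $i\le i+1$ and $i+1\not\le i$ for all $i$, and such that $I/{\sim}$ is a parasimplex (where $i\sim j$ iff $i\le j\le i$), i.e. $I\ne\emptyset$ and only finitely many $\sim$-classes lie between any two elements. Morphisms are $\mathbb{Z}$-equivariant, weakly order-preserving maps that are surjective on $\sim$-classes. An *$I$-section* of a family $L_S\to S$ is a map $\sigma:S\times I\to L_S^\circ$ such that each $\sigma(-,i)$ is a continuous section, $I\to L_s^\circ/\mathbb{R}$ is surjective for each $s$, $d(\sigma(s,i),\sigma(s,j))>-\infty$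 whenever $i\le j$, and $\sigma(s,i+1)=\sigma(s,i)+1$. Let $\mathrm{Pt}(\mathrm{Broken}_{para}^I)$ be the category of families with an $I$-section and compatible maps of families; a morphism $I\to J$ induces $\mathrm{Broken}_{para}^J\to\mathrm{Broken}_{para}^I$ by precomposition. Let $F^{(I)}\subset(-\infty,\infty]^{\mathrm{Arr}\,I}$, $\mathrm{Arr}\,I=\{(i,j):i\le j\}$, be the subspace of those $\alpha$ with $\alpha(i,i)=0$, $\alpha(i,j)+\alpha(j,k)=\alpha(i,k)$, $\alpha(i,j)=\alpha(i+1,j+1)$ and $\alpha(i,i+1)=\infty$. Let $\tilde F^{(I)}\subset F^{(I)}\times[-\infty,\infty]^I$ be the set of $(\alpha,\beta)$ such that for all $i\le j$ at least one of $\beta_i=\alpha(i,j)+\beta_j$, $\alpha(i,j)=\beta_i-\beta_j$, $\beta_j=\beta_i-\alpha(i,j)$ holds, and $\beta$ attains both values $\pm\infty$; $(n,t)$ acts by $((n,t)\beta)_i=\beta_{i-n}+t$. A morphism $r:I\to J$ induces $F^{(J)}\to F^{(I)}$ and $\tilde F^{(J)}\to\tilde F^{(I)}$ by precomposition. For a space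 $X$, $\mathrm{Pt}(X)$ is the category of spaces over $X$. **Theorem.** Pullbacks of families of broken paracycles are families of broken paracycles, and for every paracyclic preorder $I$ the map $\tilde F^{(I)}\to F^{(I)}$ is a family of broken paracycles, with an $I$-section sending $(\alpha,i)$ to $(\alpha,\beta)$, where $\beta_j=\alpha(j,i)$ for $j\le i$ and $\beta_j=-\alpha(i,j)$ for $i\le j$; every morphism $r:I\to J$ induces a map of families $\tilde F^{(J)}\to\tilde F^{(I)}$. Thus $f\mapsto f^*\tilde F^{(I)}$ makes $I\mapsto F^{(I)}$, like $I\mapsto\mathrm{Broken}_{para}^I$, a functor from the opposite category of paracyclic preorders to the $(2,1)$-category of stacks over $\mathrm{Broken}_{para}$. Moreover $\mathrm{Pt}(\mathrm{Broken}_{para})$, $\mathrm{Pt}(\mathrm{Broken}_{para}^I)$ and $\mathrm{Pt}(F^{(I)})$ are fibered in groupoids over $\mathrm{Top}$, and: 1. For every $I$, $\mathrm{Broken}_{para}^I$ is represented by $F^{(I)}$: there is an equivalence of categories $\mathrm{Pt}(\mathrm{Broken}_{para}^I)\simeq\mathrm{Pt}(F^{(I)})$, commuting up to natural isomorphism with the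 functors to $\mathrm{Pt}(\mathrm{Broken}_{para})$ and respecting Cartesian edges over $\mathrm{Top}$. It sends $(L_S\to S,\sigma)$ to the map $s\mapsto\big((i,j)\mapsto d(\sigma(s,i),\sigma(s,j))\big)$, and $\tilde F^{(I)}\to F^{(I)}$ with its $I$-section is the universal (terminal) family with an $I$-section. 2. These equivalences can be chosen functorially in $I$: they are the components of an equivalence $\mathrm{Broken}_{para}^\bullet\simeq F^{(\bullet)}$ of functors to stacks over $\mathrm{Broken}_{para}$. -/

import Mathlib

open CategoryTheory

universe w v u

namespace BrokenPara

noncomputable section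

/-! ### Spaces with an action of `ℤ × ℝ` and broken paracycles -/

section Paracycle

variable (L : Type u) [TopologicalSpace L] [AddAction (ℤ × ℝ) L]

/-- The set `L^ℝ` of points fixed by the subgroup `ℝ = {0} × ℝ`. -/
def fixedPts : Set L := {x | ∀ t : ℝ, ((0 : ℤ), t) +ᵥ x = x}

variable {L}

/-- A homeomorphism `φ : L ≃ₜ ℝ` is directed if `t ≥ 0` moves every point weakly upwards. -/
def IsDirectedHomeo (φ : L ≃ₜ ℝ) : Prop :=
  ∀ t : ℝ, 0 ≤ t → ∀ x : L, φ x ≤ φ (((0 : ℤ), t) +ᵥ x)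

/-- The order `≤_L`, transported from `ℝ` along a directed homeomorphism.  For a broken paracycle
directed homeomorphisms exist and (since some point is not fixed) all induce the same order. -/
def leL (x y : L) : Prop := ∀ φ : L ≃ₜ ℝ, IsDirectedHomeo φ → φ x ≤ φ y

variable (L)

/-- Broken paracycles. -/
structure IsBrokenParacycle : Prop where
  continuous_action : ContinuousVAdd (ℤ × ℝ) L
  homeo : Nonempty (L ≃ₜ ℝ)
  free : ∀ (n : ℤ) (x : L), (n, (0 : ℝ)) +ᵥ x = x → n = 0
  directed : ∃ φ : L ≃ₜ ℝ, IsDirectedHomeo φ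
  compatibly_directed : ∀ x : L, leL x (((1 : ℤ), (0 : ℝ)) +ᵥ x)
  discrete : DiscreteTopology (fixedPts L)
  nonempty : (fixedPts L).Nonempty

variable {L}

open Classical in
/-- The translation distance `d_L(x,y)`: the real `t` with `t • x = y` if there is one, `∞` if
`t • x ≤ y` for all `t`, and `-∞` if `t • x ≥ y` for all `t`.  Off the diagonal of the fixed point
set of a broken paracycle these cases exclude each other and exhaust all pairs. -/
def transDist (x y : L) : EReal :=
  if h : ∃ t : ℝ, ((0 : ℤ), t) +ᵥ x = y then ((h.choose : ℝ) : EReal)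
  else if ∀ t : ℝ, leL (((0 : ℤ), t) +ᵥ x) y then ⊤
  else ⊥

variable (L)

/-- The equivalence relation whose quotient is `L/ℤ`. -/
def zSetoid : Setoid L where
  r x y := ∃ n : ℤ, (n, (0 : ℝ)) +ᵥ x = y
  iseqv :=
    { refl := fun x => ⟨0, zero_vadd (ℤ × ℝ) x⟩
      symm := by
        rintro x y ⟨n, rfl⟩
        refine ⟨-n, ?_⟩
        rw [vadd_vadd]
        have e : ((-n, (0 : ℝ)) + (n, (0 : ℝ)) : ℤ × ℝ) = 0 := by ext <;> simp
        rw [e, zero_vadd]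
      trans := by
        rintro x y z ⟨n, rfl⟩ ⟨m, rfl⟩
        refine ⟨m + n, ?_⟩
        rw [vadd_vadd]
        simp }

/-- The quotient space `L/ℤ`. -/
abbrev ZQuot : Type u := Quotient (zSetoid L)

/-- The `ℝ`-fixed points of the induced action on `L/ℤ`. -/
def zQuotFixedPts : Set (ZQuot L) :=
  {q | ∀ x : L, (Quotient.mk (zSetoid L) x) = q →
    ∀ t : ℝ, Quotient.mk (zSetoid L) (((0 : ℤ), t) +ᵥ x) = q}

end Paracycle

/-! ### Families -/

/-- A continuous map `π : L_S → S` with a fibre-preserving action of `ℤ × ℝ` on `L_S`. -/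
structure ZRSpaceOver where
  base : TopCat.{u}
  total : TopCat.{u}
  proj : total ⟶ base
  action : AddAction (ℤ × ℝ) total
  proj_vadd : ∀ (g : ℤ × ℝ) (x : total), proj (g +ᵥ x) = proj x

attribute [instance] ZRSpaceOver.action

namespace ZRSpaceOver

variable (P : ZRSpaceOver.{u})

/-- The fibre `L_s`, with its action of `ℤ × ℝ`. -/
def fiberSub (s : P.base) : SubAddAction (ℤ × ℝ) P.total where
  carrier := {x | P.proj x = s}
  vadd_mem' g x hx := (P.proj_vadd g x).trans hx

/-- The fibre `L_s` as a space. -/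
abbrev Fiber (s : P.base) : Type u := P.fiberSub s

/-- A point of the total space as a point of its fibre. -/
def toFiber {s : P.base} (x : P.total) (h : P.proj x = s) : P.Fiber s := ⟨x, h⟩

/-- The projection `L_S/ℤ → S`. -/
def quotProj : ZQuot P.total → P.base :=
  Quotient.lift (fun x => P.proj x) (by
    rintro x y ⟨n, rfl⟩
    exact (P.proj_vadd _ _).symm)

/-- `L_S^ℝ → S` is unramified modulo `ℤ`: locally on `S`, the locus `(L_U/ℤ)^ℝ` is a finite
disjoint union of closed subsets of `L_U/ℤ`, each of which is a closed subspace of `U` via the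
projection. -/
def UnramifiedModZ : Prop :=
  ∀ s : P.base, ∃ U : Set P.base, IsOpen U ∧ s ∈ U ∧
    ∃ (n : ℕ) (K : Fin n → Set (ZQuot P.total)) (hK : ∀ a, Set.MapsTo P.quotProj (K a) U),
      Pairwise (Function.onFun Disjoint K) ∧
      (⋃ a, K a) = zQuotFixedPts P.total ∩ P.quotProj ⁻¹' U ∧
      (∀ a, IsClosed ((↑) ⁻¹' K a : Set (P.quotProj ⁻¹' U))) ∧
      ∀ a, Topology.IsClosedEmbedding ((hK a).restrict P.quotProj (K a) U)

/-- Families of broken paracycles over the space `P.base`. -/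
structure IsFamily : Prop where
  continuous_action : ContinuousVAdd (ℤ × ℝ) P.total
  fibers : ∀ s : P.base, IsBrokenParacycle (P.Fiber s)
  unramified : P.UnramifiedModZ
  quotient_closed : IsClosedMap P.quotProj
  separated : IsClosed {p : {p : P.total × P.total // P.proj p.1 = P.proj p.2} |
    leL (P.toFiber p.1.1 p.2) (P.toFiber p.1.2 rfl)}
  local_lifting : ∀ x : P.total, x ∉ fixedPts P.total →
    ∃ (U : Set P.base) (hx : P.proj x ∈ U) (σ : U → P.total), IsOpen U ∧ Continuous σ ∧
      (∀ s : U, P.proj (σ s) = s ∧ σ s ∉ fixedPts P.total) ∧ σ ⟨P.proj x, hx⟩ = x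

/-- An equivariant map exhibiting the source as a pullback of the target. -/
@[ext]
structure Hom (P Q : ZRSpaceOver.{u}) where
  base : P.base ⟶ Q.base
  total : P.total ⟶ Q.total
  isPullback : IsPullback total P.proj Q.proj base
  equivariant : ∀ (g : ℤ × ℝ) (x : P.total), total (g +ᵥ x) = g +ᵥ total x

instance : Category ZRSpaceOver.{u} where
  Hom := Hom
  id P :=
    { base := 𝟙 _
      total := 𝟙 _
      isPullback := IsPullback.id_horiz _
      equivariant := fun _ _ => rfl }
  comp f g :=
    { base := f.base ≫ g.base
      total := f.total ≫ g.total
      isPullback := f.isPullback.paste_horiz g.isPullback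
      equivariant := fun a x => by
        simp [f.equivariant, g.equivariant] }
  id_comp _ := rfl
  comp_id _ := rfl
  assoc _ _ _ := rfl

variable {P}

@[ext]
theorem hom_ext {Q : ZRSpaceOver.{u}} {f g : P ⟶ Q} (h₁ : f.base = g.base)
    (h₂ : f.total = g.total) : f = g := Hom.ext h₁ h₂

@[simp] theorem id_base : (𝟙 P : P ⟶ P).base = 𝟙 _ := rfl
@[simp] theorem id_total : (𝟙 P : P ⟶ P).total = 𝟙 _ := rfl
@[simp] theorem comp_base {Q R : ZRSpaceOver.{u}} (f : P ⟶ Q) (g : Q ⟶ R) :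
    (f ≫ g).base = f.base ≫ g.base := rfl
@[simp] theorem comp_total {Q R : ZRSpaceOver.{u}} (f : P ⟶ Q) (g : Q ⟶ R) :
    (f ≫ g).total = f.total ≫ g.total := rfl

/-- A map over an isomorphism of bases is an isomorphism. -/
theorem isIso_of_base {Q : ZRSpaceOver.{u}} (f : P ⟶ Q) [IsIso f.base] : IsIso f := by
  have : IsIso f.total := f.isPullback.isIso_fst_of_isIso
  refine ⟨⟨inv f.base, inv f.total, IsPullback.of_horiz_isIso ⟨?_⟩, ?_⟩, ?_, ?_⟩
  · rw [IsIso.inv_comp_eq, ← Category.assoc, IsIso.eq_comp_inv]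
    exact f.isPullback.w.symm
  · intro g x
    have h : Function.Injective f.total := (TopCat.mono_iff_injective f.total).1 inferInstance
    apply h
    rw [f.equivariant]
    simp [← ConcreteCategory.comp_apply]
  · ext1 <;> simp
  · ext1 <;> simp

/-- The pullback `f^* L = T ×_S L` along `f : T → S`. -/
def pullback (P : ZRSpaceOver.{u}) {T : TopCat.{u}} (f : T ⟶ P.base) : ZRSpaceOver.{u} where
  base := T
  total := TopCat.of {p : T × P.total // f p.1 = P.proj p.2}
  proj := TopCat.ofHom ⟨fun p => p.1.1, by fun_prop⟩
  action :=
    { vadd := fun g p => ⟨(p.1.1, g +ᵥ p.1.2), p.2.trans (P.proj_vadd g _).symm⟩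
      zero_vadd := fun p => Subtype.ext (Prod.ext rfl (zero_vadd _ _))
      add_vadd := fun g h p => Subtype.ext (Prod.ext rfl (add_vadd g h _)) }
  proj_vadd _ _ := rfl

/-- The canonical map `f^* L → L`. -/
def pullbackHom (P : ZRSpaceOver.{u}) {T : TopCat.{u}} (f : T ⟶ P.base) : P.pullback f ⟶ P where
  base := f
  total := TopCat.ofHom ⟨fun p => p.1.2, by fun_prop⟩
  isPullback := by
    refine ⟨⟨?_⟩, ⟨Limits.PullbackCone.IsLimit.mk _ (fun c => TopCat.ofHom
      ⟨fun z => ⟨(c.snd z, c.fst z), ?_⟩, ?_⟩) ?_ ?_ ?_⟩⟩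
    · ext p
      exact p.2.symm
    · exact (ConcreteCategory.congr_hom c.condition z).symm
    · fun_prop
    · intro c; rfl
    · intro c; rfl
    · intro c m h₁ h₂
      ext z
      refine Subtype.ext (Prod.ext ?_ ?_)
      · exact ConcreteCategory.congr_hom h₂ z
      · exact ConcreteCategory.congr_hom h₁ z
  equivariant _ _ := rfl

/-- The map `f^* P → g^* Q` induced by `m : P ⟶ Q` and `b` with `f ≫ m.base = b ≫ g`. -/
def pullbackMap {P Q : ZRSpaceOver.{u}} (m : P ⟶ Q) {T T' : TopCat.{u}} (f : T ⟶ P.base)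
    (g : T' ⟶ Q.base) (b : T ⟶ T') (h : b ≫ g = f ≫ m.base) : P.pullback f ⟶ Q.pullback g where
  base := b
  total := TopCat.ofHom ⟨fun p => ⟨(b p.1.1, m.total p.1.2), by
      have h₁ := ConcreteCategory.congr_hom h p.1.1
      have h₂ := ConcreteCategory.congr_hom m.isPullback.w p.1.2
      have h₃ := p.2
      simp only [ConcreteCategory.comp_apply] at h₁ h₂
      rw [h₁, h₃, h₂]⟩, by fun_prop⟩
  isPullback := by
    refine IsPullback.of_right ?_ rfl (Q.pullbackHom g).isPullback
    exact (congrArg (fun c : T ⟶ Q.base => IsPullback (P.pullbackHom f ≫ m).total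
      (P.pullback f).proj Q.proj c) h).mpr (P.pullbackHom f ≫ m).isPullback
  equivariant a x := Subtype.ext (Prod.ext rfl (m.equivariant a x.1.2))

end ZRSpaceOver

/-! ### The category `Pt(Broken)` -/

/-- Objects of `Pt(Broken)`: families of broken paracycles over arbitrary spaces. -/
structure Family where
  space : ZRSpaceOver.{u}
  isFamily : space.IsFamily

namespace Family

/-- Morphisms of `Pt(Broken)`: equivariant pullback squares. -/
instance : Category Family.{u} where
  Hom L M := L.space ⟶ M.space
  id L := 𝟙 L.space
  comp {L M N} (f : L.space ⟶ M.space) (g : M.space ⟶ N.space) := f ≫ g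
  id_comp _ := rfl
  comp_id _ := rfl
  assoc _ _ _ := rfl

/-- The underlying equivariant pullback square. -/
def Hom.sq {L M : Family.{u}} (f : L ⟶ M) : L.space ⟶ M.space := f

@[ext]
theorem hom_ext {L M : Family.{u}} {f g : L ⟶ M} (h : Hom.sq f = Hom.sq g) : f = g := h

@[simp] theorem sq_id (L : Family.{u}) : Hom.sq (𝟙 L) = 𝟙 L.space := rfl
@[simp] theorem sq_comp {L M N : Family.{u}} (f : L ⟶ M) (g : M ⟶ N) :
    Hom.sq (f ≫ g) = Hom.sq f ≫ Hom.sq g := rfl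

theorem isIso_of_base {L M : Family.{u}} (f : L ⟶ M) (h : IsIso (Hom.sq f).base) : IsIso f := by
  have := ZRSpaceOver.isIso_of_base (Hom.sq f)
  exact ⟨(inv (Hom.sq f) : M.space ⟶ L.space), IsIso.hom_inv_id (Hom.sq f),
    IsIso.inv_hom_id (Hom.sq f)⟩

/-- The forgetful functor `Pt(Broken) → Top`. -/
def toTop : Family.{u} ⥤ TopCat.{u} where
  obj L := L.space.base
  map f := (Hom.sq f).base

/-- Pullbacks of families of broken paracycles are families of broken paracycles. -/
def PullbackStable : Prop :=
  ∀ (P : ZRSpaceOver.{u}), P.IsFamily → ∀ (T : TopCat.{u}) (f : T ⟶ P.base),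
    (P.pullback f).IsFamily

/-- The functor `Pt(S) → Pt(Broken)`, `f ↦ f^* L`, classified by a family `L` over `S`. -/
def classify (hpb : PullbackStable.{u}) (L : Family.{u}) : Over L.space.base ⥤ Family.{u} where
  obj f := ⟨L.space.pullback f.hom, hpb _ L.isFamily _ _⟩
  map {f f'} g := ZRSpaceOver.pullbackMap (𝟙 L.space) f.hom f'.hom g.left (by simp)
  map_id _ := rfl
  map_comp _ _ := rfl

/-- A map of families `L ⟶ M` over `b : S → T` identifies `f^* L` with `(b ∘ f)^* M`. -/
def classifyMap (hpb : PullbackStable.{u}) {L M : Family.{u}} (m : L ⟶ M) :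
    classify hpb L ≅ Over.map (Hom.sq m).base ⋙ classify hpb M :=
  NatIso.ofComponents
    (fun f =>
      let φ : (classify hpb L).obj f ⟶ (Over.map (Hom.sq m).base ⋙ classify hpb M).obj f :=
        ZRSpaceOver.pullbackMap (Hom.sq m) f.hom (f.hom ≫ (Hom.sq m).base) (𝟙 f.left) (by simp)
      have : IsIso φ := isIso_of_base φ (inferInstanceAs (IsIso (𝟙 f.left)))
      asIso φ)
    (fun _ => rfl)

end Family

/-! ### Paracyclic preorders -/

/-- Paracyclic preorders: countable linear preorders with a free, relation-preserving action of
`ℤ` such that `i < i + 1`, and such that `I/∼` is a parasimplex, that is, `I` is nonempty and only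
finitely many `∼`-classes lie between two given elements. -/
structure PreordPara where
  carrier : Type u
  [preorder : Preorder carrier]
  [action : AddAction ℤ carrier]
  nonempty : Nonempty carrier
  countable : Countable carrier
  total : ∀ i j : carrier, i ≤ j ∨ j ≤ i
  free : ∀ (n : ℤ) (i : carrier), n +ᵥ i = i → n = 0
  vadd_le : ∀ (n : ℤ) {i j : carrier}, i ≤ j → n +ᵥ i ≤ n +ᵥ j
  lt_succ : ∀ i : carrier, i < (1 : ℤ) +ᵥ i
  finite_Icc : ∀ i j : carrier,
    (Set.Icc (toAntisymmetrization (· ≤ ·) i) (toAntisymmetrization (· ≤ ·) j)).Finite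

attribute [instance] PreordPara.preorder PreordPara.action

namespace PreordPara

instance : CoeSort PreordPara.{u} (Type u) := ⟨carrier⟩

/-- `ℤ`-equivariant, weakly order-preserving, essentially surjective maps. -/
@[ext]
structure Hom (I J : PreordPara.{u}) where
  toFun : I → J
  mono : ∀ {i j : I}, i ≤ j → toFun i ≤ toFun j
  equivariant : ∀ (n : ℤ) (i : I), toFun (n +ᵥ i) = n +ᵥ toFun i
  essSurj : ∀ j : J, ∃ i : I, toFun i ≤ j ∧ j ≤ toFun i

instance : Category PreordPara.{u} where
  Hom := Hom
  id I := ⟨id, fun h => h, fun _ _ => rfl, fun j => ⟨j, le_rfl, le_rfl⟩⟩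
  comp f g :=
    { toFun := fun i => g.toFun (f.toFun i)
      mono := fun h => g.mono (f.mono h)
      equivariant := fun n i => by rw [f.equivariant, g.equivariant]
      essSurj := fun k => by
        obtain ⟨j, h₁, h₂⟩ := g.essSurj k
        obtain ⟨i, h₃, h₄⟩ := f.essSurj j
        exact ⟨i, (g.mono h₃).trans h₁, h₂.trans (g.mono h₄)⟩ }

/-- `Arr I`, the set of pairs `i ≤ j`. -/
def Arr (I : PreordPara.{u}) : Type u := {p : I × I // p.1 ≤ p.2}

/-- The element `i ≤ j` of `Arr I`. -/
def arr {I : PreordPara.{u}} {i j : I} (h : i ≤ j) : I.Arr := ⟨(i, j), h⟩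

/-- The map `Arr I → Arr J` induced by `r : I → J`. -/
def Hom.arrMap {I J : PreordPara.{u}} (r : I ⟶ J) (a : I.Arr) : J.Arr :=
  ⟨(r.toFun a.1.1, r.toFun a.1.2), r.mono a.2⟩

end PreordPara

/-! ### `I`-sections -/

/-- `I`-sections of `L_S → S`. -/
structure IsISection (I : PreordPara.{u}) (P : ZRSpaceOver.{u})
    (σ : (s : P.base) → I → P.Fiber s) : Prop where
  not_fixed : ∀ s i, σ s i ∉ fixedPts (P.Fiber s)
  continuous : ∀ i, Continuous fun s => (σ s i : P.total)
  surjective : ∀ (s : P.base) (x : P.Fiber s), x ∉ fixedPts (P.Fiber s) →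
    ∃ (i : I) (t : ℝ), ((0 : ℤ), t) +ᵥ σ s i = x
  dist_gt : ∀ (s : P.base) {i j : I}, i ≤ j → ⊥ < transDist (σ s i) (σ s j)
  equivariant : ∀ (s : P.base) (n : ℤ) (i : I), σ s (n +ᵥ i) = (n, (0 : ℝ)) +ᵥ σ s i

/-- If two points have distance `> -∞` in both directions, they lie on one `ℝ`-orbit. -/
theorem exists_vadd_eq {L : Type u} [TopologicalSpace L] [AddAction (ℤ × ℝ) L]
    (hL : IsBrokenParacycle L) {x y : L} (h₁ : ⊥ < transDist x y) (h₂ : ⊥ < transDist y x) :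
    ∃ t : ℝ, ((0 : ℤ), t) +ᵥ x = y := by
  by_contra hn
  have hn' : ¬ ∃ t : ℝ, ((0 : ℤ), t) +ᵥ y = x := by
    rintro ⟨t, rfl⟩
    refine hn ⟨-t, ?_⟩
    have e : (((0 : ℤ), -t) + ((0 : ℤ), t) : ℤ × ℝ) = 0 := by ext <;> simp
    rw [vadd_vadd, e, zero_vadd]
  unfold transDist at h₁ h₂
  rw [dif_neg hn] at h₁
  rw [dif_neg hn'] at h₂
  split_ifs at h₁ with k₁
  · split_ifs at h₂ with k₂
    · obtain ⟨φ, hφ⟩ := hL.directed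
      have z : ∀ w : L, ((0 : ℤ), (0 : ℝ)) +ᵥ w = w := fun w => zero_vadd (ℤ × ℝ) w
      have a := k₁ 0 φ hφ
      have b := k₂ 0 φ hφ
      rw [z] at a b
      exact hn ⟨0, by rw [z]; exact φ.injective (le_antisymm a b)⟩
    · exact lt_irrefl _ h₂
  · exact lt_irrefl _ h₁

theorem IsISection.comp {I J : PreordPara.{u}} (r : I ⟶ J) {P : ZRSpaceOver.{u}}
    (hP : P.IsFamily) {σ : (s : P.base) → J → P.Fiber s} (h : IsISection J P σ) :
    IsISection I P (fun s i => σ s (r.toFun i)) where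
  not_fixed s i := h.not_fixed s _
  continuous i := h.continuous _
  surjective s x hx := by
    obtain ⟨j, t, rfl⟩ := h.surjective s x hx
    obtain ⟨i, h₁, h₂⟩ := r.essSurj j
    obtain ⟨t', ht'⟩ := exists_vadd_eq (hP.fibers s) (h.dist_gt s h₁) (h.dist_gt s h₂)
    refine ⟨i, t + t', ?_⟩
    rw [← ht', vadd_vadd]
    simp
  dist_gt s _ _ hij := h.dist_gt s (r.mono hij)
  equivariant s n i := by rw [r.equivariant, h.equivariant]

/-- Objects of `Pt(Broken^I)`: families equipped with an `I`-section. -/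
structure SecFamily (I : PreordPara.{u}) where
  family : Family.{u}
  sec : (s : family.space.base) → I → family.space.Fiber s
  isSection : IsISection I family.space sec

namespace SecFamily

variable {I : PreordPara.{u}}

/-- Morphisms of `Pt(Broken^I)`: maps of families compatible with the `I`-sections. -/
@[ext]
structure Hom (X Y : SecFamily I) where
  map : X.family ⟶ Y.family
  compat : ∀ (s : X.family.space.base) (i : I),
    (Y.sec ((Family.Hom.sq map).base s) i : Y.family.space.total) =
      (Family.Hom.sq map).total (X.sec s i : X.family.space.total)

instance : Category (SecFamily I) where
  Hom := Hom
  id X := ⟨𝟙 _, fun _ _ => rfl⟩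
  comp f g := ⟨f.map ≫ g.map, fun s i => by
    rw [Family.sq_comp, ZRSpaceOver.comp_base, ZRSpaceOver.comp_total,
      ConcreteCategory.comp_apply, ConcreteCategory.comp_apply, ← f.compat, ← g.compat]⟩

@[ext]
theorem hom_ext {X Y : SecFamily I} {f g : X ⟶ Y} (h : f.map = g.map) : f = g := Hom.ext h

@[simp] theorem id_map (X : SecFamily I) : Hom.map (𝟙 X) = 𝟙 X.family := rfl
@[simp] theorem comp_map {X Y Z : SecFamily I} (f : X ⟶ Y) (g : Y ⟶ Z) :
    Hom.map (f ≫ g) = Hom.map f ≫ Hom.map g := rfl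

variable (I) in
/-- The forgetful functor `Pt(Broken^I) → Pt(Broken)`. -/
def forget : SecFamily I ⥤ Family.{u} where
  obj X := X.family
  map f := f.map

/-- The functor `Pt(Broken^J) → Pt(Broken^I)`, `σ ↦ σ ∘ r`, for `r : I → J`. -/
def restrict {I J : PreordPara.{u}} (r : I ⟶ J) : SecFamily J ⥤ SecFamily I where
  obj X := ⟨X.family, fun s i => X.sec s (r.toFun i), X.isSection.comp r X.family.isFamily⟩
  map f := ⟨f.map, fun s i => f.compat s (r.toFun i)⟩

end SecFamily

/-! ### The spaces `F^(I)` and the families over them -/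

/-- `F^(I) ⊂ (-∞,∞]^{Arr I}`. -/
def distFunctions (I : PreordPara.{u}) : Set (I.Arr → Set.Ioi (⊥ : EReal)) :=
  {α | (∀ i : I, (α (PreordPara.arr (le_refl i)) : EReal) = 0) ∧
    (∀ (i j k : I) (hij : i ≤ j) (hjk : j ≤ k),
      (α (PreordPara.arr hij) : EReal) + α (PreordPara.arr hjk) =
        α (PreordPara.arr (hij.trans hjk))) ∧
    (∀ (i j : I) (hij : i ≤ j),
      α (PreordPara.arr hij) = α (PreordPara.arr (I.vadd_le 1 hij))) ∧
    ∀ i : I, (α (PreordPara.arr (I.lt_succ i).le) : EReal) = ⊤}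

/-- The topological space `F^(I)`. -/
abbrev FSpace (I : PreordPara.{u}) : TopCat.{u} := TopCat.of (distFunctions I)

/-- The value `α(i,j)` for `i ≤ j`. -/
def FSpace.val {I : PreordPara.{u}} (α : FSpace I) {i j : I} (h : i ≤ j) : EReal :=
  (α.1 (PreordPara.arr h) : EReal)

/-- `c = a + b`, where `∞ + (-∞)` and `(-∞) + ∞` are undefined. -/
def SumEq (c a b : EReal) : Prop :=
  ¬ (a = ⊤ ∧ b = ⊥) ∧ ¬ (a = ⊥ ∧ b = ⊤) ∧ c = a + b

/-- `c = a - b`, where `∞ - ∞` and `(-∞) - (-∞)` are undefined. -/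
def DiffEq (c a b : EReal) : Prop :=
  ¬ (a = ⊤ ∧ b = ⊤) ∧ ¬ (a = ⊥ ∧ b = ⊥) ∧ c = a - b

/-- The pairs `(α, β)` in `F^(I) × [-∞,∞]^I` which belong to the total space of the family. -/
def totalSet (I : PreordPara.{u}) : Set (FSpace I × (I → EReal)) :=
  {p | (∀ (i j : I) (h : i ≤ j),
      SumEq (p.2 i) (FSpace.val p.1 h) (p.2 j) ∨
      DiffEq (FSpace.val p.1 h) (p.2 i) (p.2 j) ∨
      DiffEq (p.2 j) (p.2 i) (FSpace.val p.1 h)) ∧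
    (∃ i, p.2 i = ⊥) ∧ ∃ i, p.2 i = ⊤}

theorem FSpace.bot_lt {I : PreordPara.{u}} (α : FSpace I) {i j : I} (h : i ≤ j) :
    ⊥ < FSpace.val α h := (α.1 (PreordPara.arr h)).2

theorem FSpace.val_shift {I : PreordPara.{u}} (α : FSpace I) (n : ℤ) :
    ∀ {i j : I} (h : i ≤ j), FSpace.val α (I.vadd_le n h) = FSpace.val α h := by
  have step : ∀ {i j : I} (h : i ≤ j), FSpace.val α (I.vadd_le 1 h) = FSpace.val α h :=
    fun {i j} h => congrArg Subtype.val (α.2.2.2.1 i j h).symm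
  have cong : ∀ {i j i' j' : I} (h : i ≤ j) (h' : i' ≤ j'), i = i' → j = j' →
      FSpace.val α h = FSpace.val α h' := by
    rintro i j _ _ h h' rfl rfl
    rfl
  have nat : ∀ (m : ℕ) {i j : I} (h : i ≤ j),
      FSpace.val α (I.vadd_le (m : ℤ) h) = FSpace.val α h := by
    intro m
    induction m with
    | zero => intro i j h; exact cong _ _ (zero_vadd ℤ i) (zero_vadd ℤ j)
    | succ m ih =>
      intro i j h
      rw [← ih h, ← step (I.vadd_le (m : ℤ) h)]
      refine cong _ _ ?_ ?_ <;> rw [vadd_vadd, add_comm (1 : ℤ)] <;> push_cast <;> rfl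
  intro i j h
  obtain ⟨m, rfl | rfl⟩ := n.eq_nat_or_neg
  · exact nat m h
  · rw [← nat m (I.vadd_le (-(m : ℤ)) h)]
    exact cong _ _ (by simp) (by simp)

/-- The action of `(n,t)` on `(α,β)`: `β_i` becomes `β_{i-n} + t`. -/
def actBeta {I : PreordPara.{u}} (g : ℤ × ℝ) (β : I → EReal) : I → EReal :=
  fun i => β ((-g.1) +ᵥ i) + (g.2 : EReal)

/-- The condition relating `β_i`, `α(i,j)`, `β_j` is invariant under translation of `β`. -/
theorem triple_shift {x y c : EReal} (t : ℝ) (hc : ⊥ < c)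
    (h : SumEq x c y ∨ DiffEq c x y ∨ DiffEq y x c) :
    SumEq (x + t) c (y + t) ∨ DiffEq c (x + t) (y + t) ∨ DiffEq (y + t) (x + t) c := by
  unfold SumEq DiffEq at *
  induction c with
  | bot => exact absurd hc (lt_irrefl _)
  | top => induction x <;> induction y <;> simp_all [← EReal.coe_add, ← EReal.coe_sub]
  | coe c =>
    induction x <;> induction y <;> simp_all [← EReal.coe_add, ← EReal.coe_sub]
    left
    rcases h with h | h | h <;> linarith

theorem act_mem {I : PreordPara.{u}} (g : ℤ × ℝ) {p : FSpace I × (I → EReal)}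
    (hp : p ∈ totalSet I) : (p.1, actBeta g p.2) ∈ totalSet I := by
  obtain ⟨h, ⟨a, ha⟩, ⟨b, hb⟩⟩ := hp
  refine ⟨?_, ⟨g.1 +ᵥ a, ?_⟩, ⟨g.1 +ᵥ b, ?_⟩⟩
  · intro i j hij
    have := h _ _ (I.vadd_le (-g.1) hij)
    rw [FSpace.val_shift p.1 (-g.1) hij] at this
    have hc := FSpace.bot_lt p.1 hij
    revert this hc
    simp only [actBeta]
    generalize p.2 (-g.1 +ᵥ i) = x
    generalize p.2 (-g.1 +ᵥ j) = y
    generalize FSpace.val p.1 hij = c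
    generalize g.2 = t
    intro this hc
    exact triple_shift t hc this
  · simp [actBeta, ha]
  · simp [actBeta, hb]

/-- The family `F̃^(I) → F^(I)`. -/
def universalSpace (I : PreordPara.{u}) : ZRSpaceOver.{u} where
  base := FSpace I
  total := TopCat.of (totalSet I)
  proj := TopCat.ofHom ⟨fun p => p.1.1, by fun_prop⟩
  action :=
    { vadd := fun g p => ⟨(p.1.1, actBeta g p.1.2), act_mem g p.2⟩
      zero_vadd := fun p => Subtype.ext (Prod.ext rfl (by
        funext i
        change p.1.2 ((-(0 : ℤ)) +ᵥ i) + ((0 : ℝ) : EReal) = p.1.2 i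
        simp))
      add_vadd := fun g h p => Subtype.ext (Prod.ext rfl (by
        funext i
        change p.1.2 ((-(g.1 + h.1)) +ᵥ i) + ((g.2 + h.2 : ℝ) : EReal) =
          p.1.2 ((-h.1) +ᵥ (-g.1) +ᵥ i) + (h.2 : EReal) + (g.2 : EReal)
        rw [vadd_vadd, neg_add, add_comm (-g.1), EReal.coe_add, add_assoc,
          add_comm (g.2 : EReal)])) }
  proj_vadd _ _ := rfl

/-- The map `F^(J) → F^(I)`, `α ↦ α ∘ (r × r)`, for `r : I → J`. -/
def FSpace.map {I J : PreordPara.{u}} (r : I ⟶ J) : FSpace J ⟶ FSpace I :=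
  TopCat.ofHom
    ⟨fun α => ⟨fun a => α.1 (r.arrMap a), by
      refine ⟨fun i => α.2.1 _, fun i j k hij hjk => α.2.2.1 _ _ _ (r.mono hij) (r.mono hjk),
        fun i j hij => (α.2.2.2.1 _ _ (r.mono hij)).trans (congrArg α.1 ?_), fun i =>
          Eq.trans (congrArg (fun a => (α.1 a : EReal)) ?_) (α.2.2.2.2 (r.toFun i))⟩
      · exact Subtype.ext (Prod.ext (r.equivariant 1 i).symm (r.equivariant 1 j).symm)
      · exact Subtype.ext (Prod.ext rfl (r.equivariant 1 i))⟩, by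
      refine Continuous.subtype_mk (continuous_pi fun a => ?_) _
      exact (continuous_apply (r.arrMap a)).comp continuous_subtype_val⟩

theorem totalSet_bot {I : PreordPara.{u}} {p : FSpace I × (I → EReal)} (hp : p ∈ totalSet I)
    {i j : I} (h : i ≤ j) (hi : p.2 i = ⊥) : p.2 j = ⊥ := by
  have hc := FSpace.bot_lt p.1 h
  have := hp.1 i j h
  revert this hc
  rw [hi]
  generalize p.2 j = y
  generalize FSpace.val p.1 h = c
  unfold SumEq DiffEq
  induction c <;> induction y <;> simp [← EReal.coe_add]

theorem totalSet_top {I : PreordPara.{u}} {p : FSpace I × (I → EReal)} (hp : p ∈ totalSet I)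
    {i j : I} (h : i ≤ j) (hj : p.2 j = ⊤) : p.2 i = ⊤ := by
  have hc := FSpace.bot_lt p.1 h
  have := hp.1 i j h
  revert this hc
  rw [hj]
  generalize p.2 i = y
  generalize FSpace.val p.1 h = c
  unfold SumEq DiffEq
  induction c <;> induction y <;> simp [← EReal.coe_sub]

/-- The map `F̃^(J) → F̃^(I)`, `(α,β) ↦ (α ∘ (r × r), β ∘ r)`, for `r : I → J`. -/
def universalTotalMap {I J : PreordPara.{u}} (r : I ⟶ J) :
    (universalSpace J).total ⟶ (universalSpace I).total :=
  TopCat.ofHom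
    ⟨fun p => ⟨(FSpace.map r p.1.1, fun i => p.1.2 (r.toFun i)), by
      refine ⟨fun i j h => p.2.1 _ _ (r.mono h), ?_, ?_⟩
      · obtain ⟨j, hj⟩ := p.2.2.1
        obtain ⟨i, -, h⟩ := r.essSurj j
        exact ⟨i, totalSet_bot p.2 h hj⟩
      · obtain ⟨j, hj⟩ := p.2.2.2
        obtain ⟨i, h, -⟩ := r.essSurj j
        exact ⟨i, totalSet_top p.2 h hj⟩⟩, by
      refine Continuous.subtype_mk (Continuous.prodMk ?_ ?_) _
      · exact (FSpace.map r).hom.continuous.comp (continuous_fst.comp continuous_subtype_val)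
      · fun_prop⟩

open Classical in
/-- The coordinates `β_j` of the value at `(α,i)` of the universal `I`-section: `β_j = α(j,i)` if
`j ≤ i`, and `β_j = -α(i,j)` if `i ≤ j`. -/
def universalBeta {I : PreordPara.{u}} (α : FSpace I) (i : I) : I → EReal := fun j =>
  if h : j ≤ i then FSpace.val α h else -FSpace.val α ((I.total j i).resolve_left h)

/-- The universal `I`-section `(α,i) ↦ (α,β)`. -/
def universalSection {I : PreordPara.{u}}
    (hmem : ∀ (α : FSpace I) (i : I), (α, universalBeta α i) ∈ totalSet I) :
    (α : (universalSpace I).base) → I → (universalSpace I).Fiber α :=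
  fun α i => (universalSpace I).toFiber ⟨(α, universalBeta α i), hmem α i⟩ rfl

/-- The assertions that pullbacks of families of broken paracycles are families, that each
`F̃^(I) → F^(I)` is a family of broken paracycles with an `I`-section given by `universalBeta`, and
that every `r : I → J` induces a pullback square from `F̃^(J) → F^(J)` to `F̃^(I) → F^(I)`. -/
structure UniversalFamilies : Prop where
  pullbackStable : Family.PullbackStable.{u}
  isFamily : ∀ I : PreordPara.{u}, (universalSpace I).IsFamily
  section_mem : ∀ (I : PreordPara.{u}) (α : FSpace I) (i : I), (α, universalBeta α i) ∈ totalSet I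
  isSection : ∀ I : PreordPara.{u},
    IsISection I (universalSpace I) (universalSection (section_mem I))
  isPullback : ∀ {I J : PreordPara.{u}} (r : I ⟶ J),
    IsPullback (universalTotalMap r) (universalSpace J).proj (universalSpace I).proj (FSpace.map r)

namespace UniversalFamilies

variable (h : UniversalFamilies.{u})

/-- The family `F̃^(I) → F^(I)` as an object of `Pt(Broken)`. -/
def family (I : PreordPara.{u}) : Family.{u} := ⟨universalSpace I, h.isFamily I⟩

/-- The universal family with its `I`-section as an object of `Pt(Broken^I)`. -/
def secFamily (I : PreordPara.{u}) : SecFamily I :=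
  ⟨h.family I, universalSection (h.section_mem I), h.isSection I⟩

/-- The map of families `F̃^(J) → F̃^(I)` induced by `r : I → J`. -/
def familyMap {I J : PreordPara.{u}} (r : I ⟶ J) : h.family J ⟶ h.family I :=
  ({ base := FSpace.map r
     total := universalTotalMap r
     isPullback := h.isPullback r
     equivariant := fun g p => Subtype.ext (Prod.ext rfl (by
      funext i
      change p.1.2 ((-g.1) +ᵥ r.toFun i) + (g.2 : EReal) =
        p.1.2 (r.toFun ((-g.1) +ᵥ i)) + (g.2 : EReal)
      rw [r.equivariant])) } : universalSpace J ⟶ universalSpace I)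

/-- The functor `Pt(F^(I)) → Pt(Broken)`, `f ↦ f^* F̃^(I)`. -/
def toBroken (I : PreordPara.{u}) : Over (FSpace I) ⥤ Family.{u} :=
  Family.classify h.pullbackStable (h.family I)

end UniversalFamilies

/-! ### The (2,1)-category of categories over a given category -/

/-- A category with a functor to `B`. -/
structure CatOver (B : Type w) [Category.{v} B] where
  obj : Type w
  [cat : Category.{v} obj]
  p : obj ⥤ B

attribute [instance] CatOver.cat

namespace CatOver

variable {B : Type w} [Category.{v} B]

/-- A functor together with a natural isomorphism making the triangle over `B` commute. -/
structure Hom (X Y : CatOver B) where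
  functor : X.obj ⥤ Y.obj
  tri : X.p ≅ functor ⋙ Y.p

/-- A natural isomorphism compatible with the triangles over `B`. -/
@[ext]
structure Hom₂ {X Y : CatOver B} (f g : Hom X Y) where
  iso : f.functor ≅ g.functor
  compat : f.tri ≪≫ Functor.isoWhiskerRight iso Y.p = g.tri

instance : CategoryStruct (CatOver B) where
  Hom := Hom
  id X := ⟨𝟭 _, X.p.leftUnitor.symm⟩
  comp f g := ⟨f.functor ⋙ g.functor, f.tri ≪≫ Functor.isoWhiskerLeft f.functor g.tri ≪≫
    (Functor.associator _ _ _).symm⟩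

instance (X Y : CatOver B) : Category (X ⟶ Y) where
  Hom f g := Hom₂ f g
  id f := ⟨Iso.refl _, by ext; simp⟩
  comp a b := ⟨a.iso ≪≫ b.iso, by
    rw [← b.compat, ← a.compat]; ext; simp⟩
  id_comp a := by apply Hom₂.ext; ext; simp
  comp_id a := by apply Hom₂.ext; ext; simp
  assoc a b c := by apply Hom₂.ext; ext; simp

variable {X Y Z : CatOver B}

@[ext]
theorem hom₂_ext {f g : X ⟶ Y} {a b : f ⟶ g} (h : Hom₂.iso a = Hom₂.iso b) : a = b :=
  Hom₂.ext h

@[simp] theorem id_functor : Hom.functor (𝟙 X) = 𝟭 X.obj := rfl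
@[simp] theorem comp_functor (f : X ⟶ Y) (g : Y ⟶ Z) :
    Hom.functor (f ≫ g) = Hom.functor f ⋙ Hom.functor g := rfl
@[simp] theorem id_tri : Hom.tri (𝟙 X) = X.p.leftUnitor.symm := rfl
@[simp] theorem comp_tri (f : X ⟶ Y) (g : Y ⟶ Z) : Hom.tri (f ≫ g) =
    Hom.tri f ≪≫ Functor.isoWhiskerLeft (Hom.functor f) (Hom.tri g) ≪≫
      (Functor.associator _ _ _).symm := rfl
@[simp] theorem id_iso (f : X ⟶ Y) : Hom₂.iso (𝟙 f) = Iso.refl _ := rfl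
@[simp] theorem comp_iso {f g h : X ⟶ Y} (a : f ⟶ g) (b : g ⟶ h) :
    Hom₂.iso (a ≫ b) = Hom₂.iso a ≪≫ Hom₂.iso b := rfl

/-- Invertible 2-cells from natural isomorphisms over `B`. -/
def isoMk {f g : X ⟶ Y} (e : Hom.functor f ≅ Hom.functor g)
    (h : Hom.tri f ≪≫ Functor.isoWhiskerRight e Y.p = Hom.tri g) : f ≅ g where
  hom := ⟨e, h⟩
  inv := ⟨e.symm, by rw [← h]; ext; simp⟩
  hom_inv_id := by apply Hom₂.ext; ext; simp
  inv_hom_id := by apply Hom₂.ext; ext; simp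

@[simp] theorem isoMk_hom_iso {f g : X ⟶ Y} (e : Hom.functor f ≅ Hom.functor g)
    (h : Hom.tri f ≪≫ Functor.isoWhiskerRight e Y.p = Hom.tri g) :
    Hom₂.iso (isoMk e h).hom = e := rfl
@[simp] theorem isoMk_inv_iso {f g : X ⟶ Y} (e : Hom.functor f ≅ Hom.functor g)
    (h : Hom.tri f ≪≫ Functor.isoWhiskerRight e Y.p = Hom.tri g) :
    Hom₂.iso (isoMk e h).inv = e.symm := rfl

/-- Left whiskering. -/
def whiskerL (f : X ⟶ Y) {g h : Y ⟶ Z} (a : g ⟶ h) : f ≫ g ⟶ f ≫ h :=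
  (⟨Functor.isoWhiskerLeft (Hom.functor f) (Hom₂.iso a), by
    have := a.compat
    rw [comp_tri, comp_tri, ← this]; ext; simp⟩ : Hom₂ (f ≫ g) (f ≫ h))

/-- Right whiskering. -/
def whiskerR {f g : X ⟶ Y} (a : f ⟶ g) (h : Y ⟶ Z) : f ≫ h ⟶ g ≫ h :=
  (⟨Functor.isoWhiskerRight (Hom₂.iso a) (Hom.functor h), by
    have := a.compat
    rw [comp_tri, comp_tri, ← this]; ext; simp⟩ : Hom₂ (f ≫ h) (g ≫ h))

@[simp] theorem whiskerL_iso (f : X ⟶ Y) {g h : Y ⟶ Z} (a : g ⟶ h) :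
    Hom₂.iso (whiskerL f a) = Functor.isoWhiskerLeft (Hom.functor f) (Hom₂.iso a) := rfl
@[simp] theorem whiskerR_iso {f g : X ⟶ Y} (a : f ⟶ g) (h : Y ⟶ Z) :
    Hom₂.iso (whiskerR a h) = Functor.isoWhiskerRight (Hom₂.iso a) (Hom.functor h) := rfl

/-- The bicategory of categories over `B`. -/
instance : Bicategory (CatOver B) where
  homCategory := inferInstance
  whiskerLeft f _ _ a := whiskerL f a
  whiskerRight a h := whiskerR a h
  associator {W X Y Z} f g h := isoMk (f := (f ≫ g) ≫ h) (g := f ≫ g ≫ h)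
    (Functor.associator (Hom.functor f) (Hom.functor g) (Hom.functor h)) (by ext; simp)
  leftUnitor {X Y} f := isoMk (f := 𝟙 X ≫ f) (g := f) (Functor.leftUnitor (Hom.functor f))
    (by ext; simp)
  rightUnitor {X Y} f := isoMk (f := f ≫ 𝟙 Y) (g := f) (Functor.rightUnitor (Hom.functor f))
    (by ext; simp)
  whiskerLeft_id _ _ := by ext; simp
  whiskerLeft_comp _ _ _ _ _ _ := by ext; simp
  id_whiskerLeft _ := by ext; simp
  comp_whiskerLeft _ _ _ _ _ := by ext; simp
  id_whiskerRight _ _ := by ext; simp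
  comp_whiskerRight _ _ _ := by ext; simp
  whiskerRight_id _ := by ext; simp
  whiskerRight_comp _ _ _ := by ext; simp
  whisker_assoc _ _ _ _ _ := by ext; simp
  whisker_exchange _ _ := by ext; simp
  pentagon _ _ _ _ := by ext; simp
  triangle _ _ := by ext; simp

open Bicategory

@[simp] theorem whiskerLeft_iso (f : X ⟶ Y) {g h : Y ⟶ Z} (a : g ⟶ h) :
    Hom₂.iso (f ◁ a) = Functor.isoWhiskerLeft (Hom.functor f) (Hom₂.iso a) := rfl
@[simp] theorem whiskerRight_iso {f g : X ⟶ Y} (a : f ⟶ g) (h : Y ⟶ Z) :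
    Hom₂.iso (a ▷ h) = Functor.isoWhiskerRight (Hom₂.iso a) (Hom.functor h) := rfl
@[simp] theorem associator_hom_iso {W : CatOver B} (f : W ⟶ X) (g : X ⟶ Y) (h : Y ⟶ Z) :
    Hom₂.iso (α_ f g h).hom =
      Functor.associator (Hom.functor f) (Hom.functor g) (Hom.functor h) := rfl
@[simp] theorem leftUnitor_hom_iso (f : X ⟶ Y) :
    Hom₂.iso (λ_ f).hom = Functor.leftUnitor (Hom.functor f) := rfl
@[simp] theorem rightUnitor_hom_iso (f : X ⟶ Y) :
    Hom₂.iso (ρ_ f).hom = Functor.rightUnitor (Hom.functor f) := rfl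

theorem eqToHom_iso_app {f g : X ⟶ Y} (h : f = g) (x : X.obj) :
    (Hom₂.iso (eqToHom h)).hom.app x = eqToHom (by rw [h]) := by
  subst h
  rfl

end CatOver

/-! ### The two functors from paracyclic preorders to stacks over `Broken` -/

/-- `Broken^I → Broken`. -/
def brokenSecObj (I : PreordPara.{u}) : CatOver Family.{u} :=
  { obj := SecFamily I, p := SecFamily.forget I }

/-- `Broken^J → Broken^I` over `Broken`, for `r : I → J`. -/
def brokenSecMap {I J : PreordPara.{u}} (r : I ⟶ J) : brokenSecObj J ⟶ brokenSecObj I :=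
  (⟨SecFamily.restrict r, Iso.refl _⟩ : CatOver.Hom (brokenSecObj J) (brokenSecObj I))

/-- The functor `I ↦ (Broken^I → Broken)`. -/
def brokenSec : Pseudofunctor (LocallyDiscrete PreordPara.{u}ᵒᵖ) (CatOver Family.{u}) :=
  LocallyDiscrete.mkPseudofunctor
    (fun I => brokenSecObj I.unop)
    (fun r => brokenSecMap r.unop)
    (fun I => CatOver.isoMk (f := brokenSecMap (𝟙 I.unop)) (g := 𝟙 (brokenSecObj I.unop))
      (Iso.refl (𝟭 (SecFamily I.unop))) (by ext X <;> rfl))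
    (fun {I J K} r s => CatOver.isoMk (f := brokenSecMap (s.unop ≫ r.unop))
      (g := brokenSecMap r.unop ≫ brokenSecMap s.unop)
      (Iso.refl (SecFamily.restrict r.unop ⋙ SecFamily.restrict s.unop)) (by ext X <;> rfl))
    (fun r s t => by
      apply CatOver.hom₂_ext; ext X
      rw [CatOver.eqToHom_iso_app]
      rfl)
    (fun r => by
      apply CatOver.hom₂_ext; ext X
      rw [CatOver.eqToHom_iso_app]
      rfl)
    (fun r => by
      apply CatOver.hom₂_ext; ext X
      rw [CatOver.eqToHom_iso_app]
      rfl)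

namespace UniversalFamilies

variable (h : UniversalFamilies.{u})

/-- `F^(I) → Broken`. -/
def repObj (I : PreordPara.{u}) : CatOver Family.{u} :=
  { obj := Over (FSpace I), p := h.toBroken I }

/-- `F^(J) → F^(I)` over `Broken`, for `r : I → J`. -/
def repMap {I J : PreordPara.{u}} (r : I ⟶ J) : h.repObj J ⟶ h.repObj I :=
  (⟨Over.map (FSpace.map r), Family.classifyMap h.pullbackStable (h.familyMap r)⟩ :
    CatOver.Hom (h.repObj J) (h.repObj I))

/-- The functor `I ↦ (F^(I) → Broken)`. -/
def rep : Pseudofunctor (LocallyDiscrete PreordPara.{u}ᵒᵖ) (CatOver Family.{u}) :=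
  LocallyDiscrete.mkPseudofunctor
    (fun I => h.repObj I.unop)
    (fun r => h.repMap r.unop)
    (fun I => CatOver.isoMk (f := h.repMap (𝟙 I.unop)) (g := 𝟙 (h.repObj I.unop))
      (Over.mapId (FSpace I.unop)) (by ext X <;> rfl))
    (fun {I J K} r s => CatOver.isoMk (f := h.repMap (s.unop ≫ r.unop))
      (g := h.repMap r.unop ≫ h.repMap s.unop)
      (Over.mapComp (FSpace.map r.unop) (FSpace.map s.unop)) (by ext X <;> rfl))
    (fun r s t => by
      apply CatOver.hom₂_ext; ext X
      rw [CatOver.eqToHom_iso_app]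
      rfl)
    (fun r => by
      apply CatOver.hom₂_ext; ext X
      rw [CatOver.eqToHom_iso_app]
      rfl)
    (fun r => by
      apply CatOver.hom₂_ext; ext X
      rw [CatOver.eqToHom_iso_app]
      rfl)

/-- A morphism `Broken^I → F^(I)` of stacks over `Broken` is given by distances if it sends
`(L_S, σ)`, up to the identification of base spaces contained in its triangle over `Broken`, to
the map `s ↦ ((i,j) ↦ d(σ(s,i), σ(s,j)))`. -/
def GivenByDistances (I : PreordPara.{u}) (E : brokenSecObj I ⟶ h.repObj I) : Prop :=
  ∀ (X : SecFamily I) (s : X.family.space.base) (i j : I) (hij : i ≤ j),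
    let Y : Over (FSpace I) := (CatOver.Hom.functor E).obj X
    let b : X.family.space.base ⟶ Y.left := (Family.Hom.sq ((CatOver.Hom.tri E).hom.app X)).base
    FSpace.val (Y.hom (b s)) hij = transDist (X.sec s i) (X.sec s j)

end UniversalFamilies

/-! ### Fibrations over `Top` -/

/-- The functor to `Top` underlying a functor to `Pt(Broken)`. -/
def CatOver.toTop (X : CatOver Family.{u}) : X.obj ⥤ TopCat.{u} := X.p ⋙ Family.toTop

/-- Categories fibered in groupoids over `Top`. -/
def IsFiberedInGroupoids {X : Type w} [Category.{v} X] (p : X ⥤ TopCat.{u}) : Prop :=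
  p.IsFibered ∧ ∀ ⦃a b : X⦄ (φ : a ⟶ b), p.IsStronglyCartesian (p.map φ) φ

/-- The functor underlying a morphism respects Cartesian edges over `Top`. -/
def CatOver.RespectsCartesian {X Y : CatOver Family.{u}} (E : X ⟶ Y) : Prop :=
  ∀ ⦃a b : X.obj⦄ (φ : a ⟶ b), X.toTop.IsStronglyCartesian (X.toTop.map φ) φ →
    Y.toTop.IsStronglyCartesian (Y.toTop.map ((CatOver.Hom.functor E).map φ))
      ((CatOver.Hom.functor E).map φ)

open scoped Pseudofunctor.StrongTrans in
/-- Equivalences of functors from paracyclic preorders to stacks over `Broken`: pseudonatural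
transformations invertible up to invertible modifications. -/
abbrev FunctorEquivalence
    (F G : Pseudofunctor (LocallyDiscrete PreordPara.{u}ᵒᵖ) (CatOver Family.{u})) :=
  Bicategory.Equivalence F G

open scoped Pseudofunctor.StrongTrans in
/-- The component at `I` of an equivalence `Broken^• ≃ F^(•)`. -/
def FunctorEquivalence.at {h : UniversalFamilies.{u}} (e : FunctorEquivalence brokenSec h.rep)
    (I : PreordPara.{u}) : brokenSecObj I ⟶ h.repObj I :=
  Pseudofunctor.StrongTrans.app e.hom ⟨Opposite.op I⟩

end

end BrokenPara

namespace BrokenPara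

noncomputable section

/-! ### Broken paracycles -/

section Order

variable {L : Type u} [AddAction (ℤ × ℝ) L]

/-! A broken paracycle is a line divided into `ℝ`-orbits by discrete fixed points, so a point is
determined by its distances from one chosen point on each orbit. In a family with an `I`-section σ,
a point x over s has coordinates β_i = d(σ(s,i), x). Together with the mutual distances α(i,j) =
d(σ(s,i), σ(s,j)) they satisfy β_i = α(i,j) + β_j whenever this makes sense. This gives an
equivariant map from the family to the universal one, over s ↦ α. The core of the theorem is that
the resulting square is a pullback (`IsISection.classifyingHom`).

On fibres the map is injective because non-fixed points are dense (`eq_of_transDist_eq`), and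
surjective because compatible distances are realized by a supremum (`exists_transDist_eq`). The
coordinates are continuous because the order is closed (`continuous_beta`). Conversely they induce
the topology, relative to the base: `L_S/ℤ → S` is proper, so an ultrafilter with convergent image
has a limit modulo `ℤ`, and its infinite coordinates leave only finitely many translates to choose
from (`exists_le_nhds_of_region`, `isInducing_toUniversal`). Hence maps of families with `I`-section
are the same as maps of bases that respect distances, which makes `distFunctor` fully faithful.
Essential surjectivity comes from pulling back the universal family.

That the universal family is a family rests on rewriting the partially defined equations as a closed
relation `Rel`, valid for all pairs of indices once α is extended antisymmetrically (`dst`). The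
blocks of finite distance in `I` are numbered by `ℤ`. A fibre is parametrized by `ℝ` by letting one
block after another run from -∞ to ∞ (`exists_fiber_homeo`). Every `ℤ`-orbit meets a region that is
closed in the product of the base with the compact space [-∞,∞]^I, so the quotient projection is
closed (`universal_quotient_closed`). Fixed points are cuts of `I`, finitely many modulo `ℤ`
(`universal_unramified`).

Pullback stability uses that a closed quotient projection is automatically proper, its fibres being
compact (`isProperMap_quotProj`).

Both pseudofunctors take values in categories faithful over `Broken`, so parallel 2-cells coincide
and all coherence conditions hold automatically. A pointwise equivalence is then an equivalence of
functors (`equivalenceOfStrongTrans`). -/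

theorem real_vadd_vadd (s t : ℝ) (x : L) :
    ((0 : ℤ), s) +ᵥ (((0 : ℤ), t) +ᵥ x) = ((0 : ℤ), s + t) +ᵥ x := by
  rw [vadd_vadd]; simp

theorem real_zero_vadd (x : L) : ((0 : ℤ), (0 : ℝ)) +ᵥ x = x := zero_vadd (ℤ × ℝ) x

theorem int_vadd_vadd (m n : ℤ) (x : L) :
    (m, (0 : ℝ)) +ᵥ ((n, (0 : ℝ)) +ᵥ x) = (m + n, (0 : ℝ)) +ᵥ x := by
  rw [vadd_vadd]; simp

theorem int_real_vadd_comm (n : ℤ) (t : ℝ) (x : L) :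
    (n, (0 : ℝ)) +ᵥ (((0 : ℤ), t) +ᵥ x) = ((0 : ℤ), t) +ᵥ ((n, (0 : ℝ)) +ᵥ x) := by
  rw [vadd_vadd, vadd_vadd, add_comm]

theorem vadd_eq_int_real (g : ℤ × ℝ) (x : L) :
    g +ᵥ x = (g.1, (0 : ℝ)) +ᵥ (((0 : ℤ), g.2) +ᵥ x) := by
  rw [vadd_vadd]; simp

theorem vadd_mem_fixedPts_iff (g : ℤ × ℝ) (x : L) : g +ᵥ x ∈ fixedPts L ↔ x ∈ fixedPts L := by
  have key : ∀ (g : ℤ × ℝ) (x : L), x ∈ fixedPts L → g +ᵥ x ∈ fixedPts L := by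
    intro g x hx t
    rw [vadd_vadd, add_comm, ← vadd_vadd, hx t]
  refine ⟨fun h => ?_, key g x⟩
  simpa using key (-g) _ h

variable [TopologicalSpace L]

theorem IsDirectedHomeo.le_vadd {φ : L ≃ₜ ℝ} (hφ : IsDirectedHomeo φ) {s t : ℝ} (h : s ≤ t)
    (x : L) : φ (((0 : ℤ), s) +ᵥ x) ≤ φ (((0 : ℤ), t) +ᵥ x) := by
  have := hφ (t - s) (sub_nonneg.2 h) (((0 : ℤ), s) +ᵥ x)
  rwa [real_vadd_vadd, sub_add_cancel] at this

/-- A coincidence on the orbit yields a positive period. Any nonnegative time is at most some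
multiple of the period, so monotonicity squeezes its translate of x between x and x, and x would be
fixed. -/
theorem IsDirectedHomeo.vadd_eq_iff {φ : L ≃ₜ ℝ} (hφ : IsDirectedHomeo φ) {x : L}
    (hx : x ∉ fixedPts L) {s t : ℝ} :
    ((0 : ℤ), s) +ᵥ x = ((0 : ℤ), t) +ᵥ x ↔ s = t := by
  refine ⟨fun h => ?_, fun h => by rw [h]⟩
  by_contra hst
  apply hx
  -- a positive period
  obtain ⟨p, hp, hpx⟩ : ∃ p : ℝ, 0 < p ∧ ((0 : ℤ), p) +ᵥ x = x := by
    rcases lt_or_gt_of_ne hst with h' | h'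
    · refine ⟨t - s, sub_pos.2 h', ?_⟩
      have := congrArg (fun z => ((0 : ℤ), -s) +ᵥ z) h
      simp only [real_vadd_vadd] at this
      rw [neg_add_cancel, real_zero_vadd] at this
      rw [sub_eq_neg_add, ← this]
    · refine ⟨s - t, sub_pos.2 h', ?_⟩
      have := congrArg (fun z => ((0 : ℤ), -t) +ᵥ z) h
      simp only [real_vadd_vadd] at this
      rw [neg_add_cancel, real_zero_vadd] at this
      rw [sub_eq_neg_add, this]
  have hmul : ∀ n : ℕ, ((0 : ℤ), (n : ℝ) * p) +ᵥ x = x := by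
    intro n
    induction n with
    | zero => simpa using real_zero_vadd x
    | succ n ih =>
      rw [show ((n + 1 : ℕ) : ℝ) * p = p + n * p by push_cast; ring, ← real_vadd_vadd, ih, hpx]
  have hnn : ∀ r : ℝ, 0 ≤ r → ((0 : ℤ), r) +ᵥ x = x := by
    intro r hr
    obtain ⟨n, hn⟩ := exists_nat_ge (r / p)
    have hn' : r ≤ n * p := by rwa [div_le_iff₀ hp] at hn
    apply φ.injective
    refine le_antisymm ?_ (hφ r hr x)
    have := hφ.le_vadd hn' x
    rwa [hmul] at this
  intro r
  rcases le_total 0 r with hr | hr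
  · exact hnn r hr
  · have := hnn (-r) (by linarith)
    conv_lhs => rw [← this, real_vadd_vadd, add_neg_cancel, real_zero_vadd]

theorem IsDirectedHomeo.vadd_lt {φ : L ≃ₜ ℝ} (hφ : IsDirectedHomeo φ) {x : L}
    (hx : x ∉ fixedPts L) {s t : ℝ} (h : s < t) :
    φ (((0 : ℤ), s) +ᵥ x) < φ (((0 : ℤ), t) +ᵥ x) :=
  lt_of_le_of_ne (hφ.le_vadd h.le x) fun h' => h.ne ((hφ.vadd_eq_iff hx).1 (φ.injective h'))

/-- The transition map between two directed homeomorphisms is strictly monotone or antitone. The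
orbit of a non-fixed point increases in both, which excludes the second case. -/
theorem IsDirectedHomeo.leL_iff_of_not_fixed {φ : L ≃ₜ ℝ} (hφ : IsDirectedHomeo φ) {z : L}
    (hz : z ∉ fixedPts L) {x y : L} : leL x y ↔ φ x ≤ φ y := by
  refine ⟨fun h => h φ hφ, fun h ψ hψ => ?_⟩
  let e : ℝ ≃ₜ ℝ := φ.symm.trans ψ
  have he : ∀ z, e (φ z) = ψ z := fun z => by simp [e]
  have h₁ := hφ.vadd_lt hz zero_lt_one
  have h₂ := hψ.vadd_lt hz zero_lt_one
  rcases e.continuous.strictMono_of_inj e.injective with hm | hm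
  · rw [← he, ← he]
    exact hm.monotone h
  · have := hm h₁
    rw [he, he] at this
    exact absurd this h₂.not_gt

namespace IsBrokenParacycle

variable (hL : IsBrokenParacycle L)
include hL

/-- Every nonempty open interval contains a point which is not fixed. -/
theorem exists_between_not_fixed (φ : L ≃ₜ ℝ) {a b : ℝ} (hab : a < b) :
    ∃ x : L, x ∉ fixedPts L ∧ a < φ x ∧ φ x < b := by
  by_contra! hcon
  have hfix : ∀ x : L, a < φ x → φ x < b → x ∈ fixedPts L := fun x h₁ h₂ => by
    by_contra h
    exact absurd h₂ (not_lt.2 (hcon x h h₁))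
  obtain ⟨m, hm₁, hm₂⟩ := exists_between hab
  have hmem : φ.symm m ∈ fixedPts L := hfix _ (by simpa using hm₁) (by simpa using hm₂)
  have hd := hL.discrete
  have hopen : IsOpen ({⟨φ.symm m, hmem⟩} : Set (fixedPts L)) := isOpen_discrete _
  obtain ⟨O, hO, hOeq⟩ := isOpen_induced_iff.1 hopen
  have hset : O ∩ φ ⁻¹' (Set.Ioo a b) = {φ.symm m} := by
    ext x
    constructor
    · rintro ⟨hxO, hx₁, hx₂⟩
      have hx : (⟨x, hfix x hx₁ hx₂⟩ : fixedPts L) ∈ (Subtype.val ⁻¹' O : Set (fixedPts L)) := hxO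
      rw [hOeq] at hx
      exact congrArg Subtype.val hx
    · rintro rfl
      refine ⟨?_, by simpa using hm₁, by simpa using hm₂⟩
      have : (⟨φ.symm m, hmem⟩ : fixedPts L) ∈ (Subtype.val ⁻¹' O : Set (fixedPts L)) := by
        rw [hOeq]; rfl
      exact this
  -- By discreteness the fixed point m is isolated inside an interval consisting of fixed points, so
  -- a singleton would be open in `ℝ`.
  have h₁ : IsOpen ({φ.symm m} : Set L) := by
    rw [← hset]
    exact hO.inter (isOpen_Ioo.preimage φ.continuous)
  have h₂ : IsOpen ({m} : Set ℝ) := by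
    have := φ.isOpenMap _ h₁
    simpa using this
  exact not_isOpen_singleton m h₂

theorem exists_not_fixed : ∃ x : L, x ∉ fixedPts L := by
  obtain ⟨φ, hφ⟩ := hL.directed
  obtain ⟨x, hx, -⟩ := hL.exists_between_not_fixed φ zero_lt_one
  exact ⟨x, hx⟩

/-- All directed homeomorphisms induce the same order. -/
theorem leL_iff {φ : L ≃ₜ ℝ} (hφ : IsDirectedHomeo φ) {x y : L} : leL x y ↔ φ x ≤ φ y := by
  obtain ⟨z, hz⟩ := hL.exists_not_fixed
  exact hφ.leL_iff_of_not_fixed hz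

theorem not_leL_iff {φ : L ≃ₜ ℝ} (hφ : IsDirectedHomeo φ) {x y : L} :
    ¬ leL x y ↔ φ y < φ x := by
  rw [hL.leL_iff hφ, not_le]

theorem leL_total (x y : L) : leL x y ∨ leL y x := by
  obtain ⟨φ, hφ⟩ := hL.directed
  rw [hL.leL_iff hφ, hL.leL_iff hφ]
  exact le_total _ _

theorem leL_antisymm {x y : L} (h₁ : leL x y) (h₂ : leL y x) : x = y := by
  obtain ⟨φ, hφ⟩ := hL.directed
  rw [hL.leL_iff hφ] at h₁ h₂
  exact φ.injective (le_antisymm h₁ h₂)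

theorem continuous_vadd (g : ℤ × ℝ) : Continuous fun x : L => g +ᵥ x := by
  have := hL.continuous_action
  exact continuous_const_vadd g

/-- The action of `ℤ × ℝ` preserves the order. -/
theorem strictMono_vadd {φ : L ≃ₜ ℝ} (hφ : IsDirectedHomeo φ) (g : ℤ × ℝ) :
    StrictMono fun r : ℝ => φ (g +ᵥ φ.symm r) := by
  have hc : ∀ g : ℤ × ℝ, Continuous fun r : ℝ => φ (g +ᵥ φ.symm r) := fun g =>
    φ.continuous.comp ((hL.continuous_vadd g).comp φ.symm.continuous)
  have hi : ∀ g : ℤ × ℝ, Function.Injective fun r : ℝ => φ (g +ᵥ φ.symm r) := fun g r s h =>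
    φ.symm.injective (vadd_left_cancel g (φ.injective h))
  have hcomp : ∀ (g h : ℤ × ℝ), (fun r : ℝ => φ ((g + h) +ᵥ φ.symm r)) =
      (fun r : ℝ => φ (g +ᵥ φ.symm r)) ∘ fun r : ℝ => φ (h +ᵥ φ.symm r) := by
    intro g h
    funext r
    simp [add_vadd]
  have hreal : ∀ t : ℝ, StrictMono fun r : ℝ => φ (((0 : ℤ), t) +ᵥ φ.symm r) := by
    intro t
    -- Acting by t is the square of acting by t/2, and the square of a monotone or antitone
    -- injection is increasing.
    have e : ((0 : ℤ), t) = ((0 : ℤ), t / 2) + ((0 : ℤ), t / 2) := by simp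
    rw [e, hcomp]
    rcases (hc (0, t / 2)).strictMono_of_inj (hi (0, t / 2)) with h | h
    · exact h.comp h
    · exact h.comp h
  have hone : StrictMono fun r : ℝ => φ (((1 : ℤ), (0 : ℝ)) +ᵥ φ.symm r) := by
    rcases (hc (1, 0)).strictMono_of_inj (hi (1, 0)) with h | h
    · exact h
    -- The translation f by 1 satisfies r ≤ f r. If it were decreasing, then f (f 0) ≤ f 0, so f 0
    -- would be fixed by 1, against freeness.
    · exfalso
      have hle : ∀ r : ℝ, r ≤ φ (((1 : ℤ), (0 : ℝ)) +ᵥ φ.symm r) := fun r => by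
        simpa using hL.compatibly_directed (φ.symm r) φ hφ
      let f : ℝ → ℝ := fun r : ℝ => φ (((1 : ℤ), (0 : ℝ)) +ᵥ φ.symm r)
      have h0 : f (f 0) ≤ f 0 := h.antitone (hle 0)
      have h1 : f (f 0) = f 0 := le_antisymm h0 (hle _)
      have h2 : ((1 : ℤ), (0 : ℝ)) +ᵥ φ.symm (f 0) = φ.symm (f 0) := by
        apply φ.injective
        simpa [f] using h1
      exact one_ne_zero (hL.free 1 _ h2)
  have hnat : ∀ n : ℕ, StrictMono fun r : ℝ => φ (((n : ℤ), (0 : ℝ)) +ᵥ φ.symm r) := by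
    intro n
    induction n with
    | zero =>
      intro r s h
      simp only [Nat.cast_zero, real_zero_vadd]
      simpa using h
    | succ n ih =>
      have e : (((n + 1 : ℕ) : ℤ), (0 : ℝ)) = ((n : ℤ), (0 : ℝ)) + ((1 : ℤ), (0 : ℝ)) := by simp
      rw [e, hcomp]
      exact ih.comp hone
  have hint : ∀ n : ℤ, StrictMono fun r : ℝ => φ ((n, (0 : ℝ)) +ᵥ φ.symm r) := by
    intro n
    obtain ⟨m, rfl | rfl⟩ := n.eq_nat_or_neg
    · exact hnat m
    · intro r s h
      rw [← (hnat m).lt_iff_lt]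
      have e : ((m : ℤ), (0 : ℝ)) + (-(m : ℤ), (0 : ℝ)) = 0 := by ext <;> simp
      simpa [vadd_vadd, e] using h
  have e : g = (g.1, (0 : ℝ)) + ((0 : ℤ), g.2) := by ext <;> simp
  rw [e, hcomp]
  exact (hint g.1).comp (hreal g.2)

theorem vadd_leL_vadd_iff (g : ℤ × ℝ) {x y : L} : leL (g +ᵥ x) (g +ᵥ y) ↔ leL x y := by
  obtain ⟨φ, hφ⟩ := hL.directed
  rw [hL.leL_iff hφ, hL.leL_iff hφ]
  simpa using (hL.strictMono_vadd hφ g).le_iff_le (a := φ x) (b := φ y)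

/-- The `ℤ`-orbits are unbounded above. -/
theorem exists_int_vadd_gt {φ : L ≃ₜ ℝ} (hφ : IsDirectedHomeo φ) (x : L) (r : ℝ) :
    ∃ n : ℕ, r < φ (((n : ℤ), (0 : ℝ)) +ᵥ x) := by
  by_contra! hcon
  let u : ℕ → ℝ := fun n => φ (((n : ℤ), (0 : ℝ)) +ᵥ x)
  have hsucc : ∀ n, u (n + 1) = φ (((1 : ℤ), (0 : ℝ)) +ᵥ φ.symm (u n)) := by
    intro n
    simp only [u, φ.symm_apply_apply, int_vadd_vadd]
    push_cast
    rw [add_comm (n : ℤ)]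
  have hmono : Monotone u := monotone_nat_of_le_succ fun n => by
    rw [hsucc]
    simpa using hL.compatibly_directed (φ.symm (u n)) φ hφ
  -- A bounded orbit converges, and by continuity its limit would be fixed by 1.
  have hlim := tendsto_atTop_ciSup hmono ⟨r, by rintro _ ⟨n, rfl⟩; exact hcon n⟩
  set l := ⨆ n, u n
  have hc : Continuous fun r : ℝ => φ (((1 : ℤ), (0 : ℝ)) +ᵥ φ.symm r) :=
    φ.continuous.comp ((hL.continuous_vadd _).comp φ.symm.continuous)
  have h₁ := (hc.tendsto l).comp hlim
  have h₂ : Filter.Tendsto (fun n => u (n + 1)) Filter.atTop (nhds l) :=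
    hlim.comp (Filter.tendsto_add_atTop_nat 1)
  have h₃ := tendsto_nhds_unique h₂ (h₁.congr fun n => (hsucc n).symm)
  have h₄ : ((1 : ℤ), (0 : ℝ)) +ᵥ φ.symm l = φ.symm l := by
    apply φ.injective
    rw [← h₃, φ.apply_symm_apply]
  exact one_ne_zero (hL.free 1 _ h₄)

theorem exists_int_vadd_not_leL (x y : L) : ∃ n : ℕ, ¬ leL (((n : ℤ), (0 : ℝ)) +ᵥ x) y := by
  obtain ⟨φ, hφ⟩ := hL.directed
  obtain ⟨n, hn⟩ := hL.exists_int_vadd_gt hφ x (φ y)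
  exact ⟨n, (hL.not_leL_iff hφ).2 hn⟩

/-- A point and its translate by `1` lie on different `ℝ`-orbits. -/
theorem real_vadd_ne_one_vadd (x : L) (t : ℝ) :
    ((0 : ℤ), t) +ᵥ x ≠ ((1 : ℤ), (0 : ℝ)) +ᵥ x := by
  intro h
  obtain ⟨φ, hφ⟩ := hL.directed
  -- All translates of x by natural numbers would stay in its `ℝ`-orbit. That orbit cannot pass a
  -- fixed point above x, while the translates are unbounded.
  have hn : ∀ n : ℕ, ((n : ℤ), (0 : ℝ)) +ᵥ x = ((0 : ℤ), n * t) +ᵥ x := by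
    intro n
    induction n with
    | zero => simp
    | succ n ih =>
      have e : (((n + 1 : ℕ) : ℤ), (0 : ℝ)) = ((1 : ℤ), (0 : ℝ)) + ((n : ℤ), (0 : ℝ)) := by
        ext <;> simp [add_comm]
      rw [e, add_vadd, ih, int_real_vadd_comm, ← h, real_vadd_vadd]
      congr 2; push_cast; ring
  obtain ⟨p, hp⟩ := hL.nonempty
  -- a fixed point above `x`
  obtain ⟨m, hm⟩ := hL.exists_int_vadd_gt hφ p (φ x)
  set q := ((m : ℤ), (0 : ℝ)) +ᵥ p
  have hq : q ∈ fixedPts L := (vadd_mem_fixedPts_iff _ _).2 hp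
  obtain ⟨n, hn'⟩ := hL.exists_int_vadd_gt hφ x (φ q)
  rw [hn] at hn'
  have h₁ : leL (((0 : ℤ), (n : ℝ) * t) +ᵥ x) (((0 : ℤ), (n : ℝ) * t) +ᵥ q) :=
    (hL.vadd_leL_vadd_iff _).2 ((hL.leL_iff hφ).2 hm.le)
  rw [hq, hL.leL_iff hφ] at h₁
  exact absurd hn' h₁.not_gt

/-! ### The translation distance -/

theorem transDist_vadd_self {x : L} (hx : x ∉ fixedPts L) (t : ℝ) :
    transDist x (((0 : ℤ), t) +ᵥ x) = t := by
  obtain ⟨φ, hφ⟩ := hL.directed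
  have h : ∃ s : ℝ, ((0 : ℤ), s) +ᵥ x = ((0 : ℤ), t) +ᵥ x := ⟨t, rfl⟩
  rw [transDist, dif_pos h, (hφ.vadd_eq_iff hx).1 h.choose_spec]

/-- This and the next lemma turn comparisons of the distance with real numbers into order relations.
The case to exclude is y lying between two points of the orbit of x without being on it, which the
intermediate value theorem forbids. -/
theorem lt_transDist_iff {x : L} (hx : x ∉ fixedPts L) (y : L) (a : ℝ) :
    (a : EReal) < transDist x y ↔ ¬ leL y (((0 : ℤ), a) +ᵥ x) := by
  obtain ⟨φ, hφ⟩ := hL.directed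
  by_cases h : ∃ t : ℝ, ((0 : ℤ), t) +ᵥ x = y
  · obtain ⟨t, rfl⟩ := h
    rw [hL.transDist_vadd_self hx, hL.not_leL_iff hφ, EReal.coe_lt_coe_iff]
    refine ⟨fun h => hφ.vadd_lt hx h, fun h => ?_⟩
    by_contra h'
    exact absurd (hφ.le_vadd (not_lt.1 h') x) h.not_ge
  · rw [transDist, dif_neg h]
    split_ifs with h'
    · simp only [EReal.coe_lt_top, true_iff]
      intro h''
      exact h ⟨a, hL.leL_antisymm (h' a) h''⟩
    · simp only [not_lt_bot, false_iff, not_not]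
      push Not at h'
      obtain ⟨t, ht⟩ := h'
      by_contra hc
      rw [hL.not_leL_iff hφ] at hc ht
      -- intermediate value theorem on the orbit of `x`
      have hcont : Continuous fun s : ℝ => φ (((0 : ℤ), s) +ᵥ x) := by
        have := hL.continuous_action
        fun_prop
      obtain ⟨s, hs⟩ := mem_range_of_exists_le_of_exists_ge hcont ⟨a, hc.le⟩ ⟨t, ht.le⟩
      exact h ⟨s, φ.injective hs⟩

theorem transDist_lt_iff {x : L} (hx : x ∉ fixedPts L) (y : L) (a : ℝ) :
    transDist x y < a ↔ ¬ leL (((0 : ℤ), a) +ᵥ x) y := by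
  obtain ⟨φ, hφ⟩ := hL.directed
  constructor
  · intro h hle
    rw [hL.leL_iff hφ] at hle
    obtain ⟨b, hb₁, hb₂⟩ := EReal.lt_iff_exists_real_btwn.1 h
    have hb : ¬ ((b : EReal) < transDist x y) := hb₁.not_gt
    rw [hL.lt_transDist_iff hx, not_not, hL.leL_iff hφ] at hb
    exact absurd (hle.trans hb) (hφ.vadd_lt hx (EReal.coe_lt_coe_iff.1 hb₂)).not_ge
  · intro h
    rw [hL.not_leL_iff hφ] at h
    have h₁ : ¬ ((a : EReal) < transDist x y) := by
      rw [hL.lt_transDist_iff hx, not_not, hL.leL_iff hφ]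
      exact h.le
    -- Equality is excluded by continuity of the orbit: if every earlier translate of x lies below
    -- y, then so does the translate by a.
    refine lt_of_le_of_ne (not_lt.1 h₁) fun h₂ => ?_
    have h₃ : ∀ b : ℝ, b < a → φ (((0 : ℤ), b) +ᵥ x) < φ y := fun b hb => by
      rw [← hL.not_leL_iff hφ, ← hL.lt_transDist_iff hx, h₂]
      exact EReal.coe_lt_coe_iff.2 hb
    have hcont : Continuous fun s : ℝ => φ (((0 : ℤ), s) +ᵥ x) := by
      have := hL.continuous_action
      fun_prop
    have h₄ : φ (((0 : ℤ), a) +ᵥ x) ≤ φ y := by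
      have : Filter.Tendsto (fun s : ℝ => φ (((0 : ℤ), s) +ᵥ x)) (nhdsWithin a (Set.Iio a))
          (nhds (φ (((0 : ℤ), a) +ᵥ x))) := (hcont.tendsto a).mono_left nhdsWithin_le_nhds
      exact le_of_tendsto this (Filter.eventually_of_mem self_mem_nhdsWithin fun b hb =>
        (h₃ b hb).le)
    exact absurd h h₄.not_gt

theorem transDist_le_iff {x : L} (hx : x ∉ fixedPts L) (y : L) (a : ℝ) :
    transDist x y ≤ a ↔ leL y (((0 : ℤ), a) +ᵥ x) := by
  rw [← not_lt, hL.lt_transDist_iff hx, not_not]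

theorem le_transDist_iff {x : L} (hx : x ∉ fixedPts L) (y : L) (a : ℝ) :
    a ≤ transDist x y ↔ leL (((0 : ℤ), a) +ᵥ x) y := by
  rw [← not_lt, hL.transDist_lt_iff hx, not_not]

theorem transDist_eq_coe_iff {x : L} (hx : x ∉ fixedPts L) {y : L} {t : ℝ} :
    transDist x y = t ↔ ((0 : ℤ), t) +ᵥ x = y := by
  refine ⟨fun h => hL.leL_antisymm ?_ ?_, ?_⟩
  · exact (hL.le_transDist_iff hx y t).1 h.ge
  · exact (hL.transDist_le_iff hx y t).1 h.le
  · rintro rfl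
    exact hL.transDist_vadd_self hx t

end IsBrokenParacycle

end Order

theorem EReal_eq_of_forall_coe_lt_iff {x y : EReal} (h : ∀ a : ℝ, (a : EReal) < x ↔ (a : EReal) < y) :
    x = y := by
  refine le_antisymm ?_ ?_ <;> refine le_of_forall_lt fun c hc => ?_
  · obtain ⟨b, hb₁, hb₂⟩ := EReal.lt_iff_exists_real_btwn.1 hc
    exact hb₁.trans ((h b).1 hb₂)
  · obtain ⟨b, hb₁, hb₂⟩ := EReal.lt_iff_exists_real_btwn.1 hc
    exact hb₁.trans ((h b).2 hb₂)

/-! ### Transport of order and distance along equivariant homeomorphisms -/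

section Equivariant

variable {L M : Type u} [AddAction (ℤ × ℝ) L] [AddAction (ℤ × ℝ) M]

theorem fixedPts_iff_of_equivariant {e : L → M} (hi : Function.Injective e)
    (he : ∀ (g : ℤ × ℝ) (x : L), e (g +ᵥ x) = g +ᵥ e x) (x : L) :
    e x ∈ fixedPts M ↔ x ∈ fixedPts L := by
  simp only [fixedPts, Set.mem_ofPred_eq, ← he, hi.eq_iff]

variable [TopologicalSpace L] [TopologicalSpace M] (e : L ≃ₜ M) (he : ∀ (g : ℤ × ℝ) (x : L), e (g +ᵥ x) = g +ᵥ e x)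
include he

theorem equivariant_symm (g : ℤ × ℝ) (y : M) : e.symm (g +ᵥ y) = g +ᵥ e.symm y := by
  apply e.injective
  rw [he]; simp

theorem leL_of_equivariant (x y : L) : leL (e x) (e y) ↔ leL x y := by
  constructor
  · intro h φ hφ
    have := h (e.symm.trans φ) (fun t ht z => by
      simpa [equivariant_symm e he] using hφ t ht (e.symm z))
    simpa using this
  · intro h φ hφ
    exact h (e.trans φ) (fun t ht z => by simpa [he] using hφ t ht (e z))

theorem transDist_of_equivariant (x y : L) : transDist (e x) (e y) = transDist x y := by
  have h₁ : (fun t : ℝ => ((0 : ℤ), t) +ᵥ e x = e y) = fun t : ℝ => ((0 : ℤ), t) +ᵥ x = y :=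
    funext fun t => propext (by rw [← he, e.injective.eq_iff])
  -- A finite distance is a chosen witness, so the two choices agree because the predicates they
  -- come from are equal.
  have choose_congr : ∀ {p q : ℝ → Prop}, p = q → ∀ (hp : ∃ t, p t) (hq : ∃ t, q t),
      hp.choose = hq.choose := by
    rintro p _ rfl _ _
    rfl
  by_cases h : ∃ t : ℝ, ((0 : ℤ), t) +ᵥ x = y
  · have h' : ∃ t : ℝ, ((0 : ℤ), t) +ᵥ e x = e y := by
      obtain ⟨t, ht⟩ := h
      exact ⟨t, by rw [← he, ht]⟩
    rw [transDist, transDist, dif_pos h, dif_pos h', choose_congr h₁ h' h]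
  · have h' : ¬ ∃ t : ℝ, ((0 : ℤ), t) +ᵥ e x = e y := by
      rintro ⟨t, ht⟩
      exact h ⟨t, e.injective (by rw [he, ht])⟩
    rw [transDist, transDist, dif_neg h, dif_neg h']
    have h₂ : (∀ t : ℝ, leL (((0 : ℤ), t) +ᵥ e x) (e y)) ↔ ∀ t : ℝ, leL (((0 : ℤ), t) +ᵥ x) y :=
      forall_congr' fun t => by rw [← he, leL_of_equivariant e he]
    by_cases k : ∀ t : ℝ, leL (((0 : ℤ), t) +ᵥ x) y
    · rw [if_pos k, if_pos (h₂.2 k)]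
    · rw [if_neg k, if_neg (mt h₂.1 k)]

theorem IsBrokenParacycle.of_equivariant (hL : IsBrokenParacycle L) : IsBrokenParacycle M where
  continuous_action := by
    have := hL.continuous_action
    refine ⟨?_⟩
    have : (fun p : (ℤ × ℝ) × M => p.1 +ᵥ p.2) = fun p => e (p.1 +ᵥ e.symm p.2) := by
      funext p; rw [he]; simp
    rw [this]
    fun_prop
  homeo := hL.homeo.map fun φ => e.symm.trans φ
  free n x h := hL.free n (e.symm x) (by rw [← equivariant_symm e he, h])
  directed := by
    obtain ⟨φ, hφ⟩ := hL.directed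
    exact ⟨e.symm.trans φ, fun t ht z => by
      simpa [equivariant_symm e he] using hφ t ht (e.symm z)⟩
  compatibly_directed x := by
    have := hL.compatibly_directed (e.symm x)
    rw [← leL_of_equivariant e he, he] at this
    simpa using this
  discrete := by
    have := hL.discrete
    have hmem : ∀ y : fixedPts M, e.symm y ∈ fixedPts L := fun y =>
      (fixedPts_iff_of_equivariant e.symm.injective (equivariant_symm e he) _).2 y.2
    refine DiscreteTopology.of_continuous_injective
      (f := fun y : fixedPts M => (⟨e.symm y, hmem y⟩ : fixedPts L)) (by fun_prop) ?_
    intro y z h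
    exact Subtype.ext (e.symm.injective (congrArg Subtype.val h))
  nonempty := by
    obtain ⟨p, hp⟩ := hL.nonempty
    exact ⟨e p, (fixedPts_iff_of_equivariant e.injective he p).2 hp⟩

end Equivariant

/-! ### Pullback squares of spaces -/

section TopPullback

variable {W X Y Z : TopCat.{u}} {fst : W ⟶ X} {snd : W ⟶ Y} {f : X ⟶ Z} {g : Y ⟶ Z}

/-- A pointwise criterion for pullbacks of spaces: the comparison map to the product induces the
topology and is a bijection onto the compatible pairs. -/
theorem isPullback_of_isInducing (w : fst ≫ f = snd ≫ g)
    (hind : Topology.IsInducing fun p : W => (fst p, snd p))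
    (hinj : ∀ p q : W, fst p = fst q → snd p = snd q → p = q)
    (hex : ∀ x y, f x = g y → ∃ p, fst p = x ∧ snd p = y) : IsPullback fst snd f g := by
  choose l hl using hex
  have hc : ∀ c : Limits.PullbackCone f g, ∀ z, f (c.fst z) = g (c.snd z) := fun c z =>
    ConcreteCategory.congr_hom c.condition z
  refine ⟨⟨w⟩, ⟨Limits.PullbackCone.IsLimit.mk _ (fun c => TopCat.ofHom
      ⟨fun z => l (c.fst z) (c.snd z) (hc c z), ?_⟩) ?_ ?_ ?_⟩⟩
  · rw [hind.continuous_iff]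
    have : ((fun p : W => (fst p, snd p)) ∘ fun z => l (c.fst z) (c.snd z) (hc c z)) =
        fun z => (c.fst z, c.snd z) := by
      funext z
      exact Prod.ext (hl _ _ _).1 (hl _ _ _).2
    rw [this]
    fun_prop
  · intro c
    ext z
    exact (hl _ _ _).1
  · intro c
    ext z
    exact (hl _ _ _).2
  · intro c m h₁ h₂
    ext z
    refine hinj _ _ ?_ ?_
    · exact (ConcreteCategory.congr_hom h₁ z).trans (hl _ _ _).1.symm
    · exact (ConcreteCategory.congr_hom h₂ z).trans (hl _ _ _).2.symm

/-- The fibre product as a subspace of the product. -/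
def fibreProduct (f : X ⟶ Z) (g : Y ⟶ Z) : TopCat.{u} := TopCat.of {p : X × Y // f p.1 = g p.2}

theorem isPullback_fibreProduct (f : X ⟶ Z) (g : Y ⟶ Z) :
    IsPullback (TopCat.ofHom ⟨fun p => p.1.1, by fun_prop⟩ : fibreProduct f g ⟶ X)
      (TopCat.ofHom ⟨fun p => p.1.2, by fun_prop⟩ : fibreProduct f g ⟶ Y) f g :=
  isPullback_of_isInducing (by ext p; exact p.2) Topology.IsInducing.subtypeVal
    (fun _ _ h₁ h₂ => Subtype.ext (Prod.ext h₁ h₂)) (fun x y h => ⟨⟨(x, y), h⟩, rfl, rfl⟩)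

variable (h : IsPullback fst snd f g)
include h

theorem isInducing_of_isPullback : Topology.IsInducing fun p : W => (fst p, snd p) := by
  let e := h.isoIsPullback _ _ (isPullback_fibreProduct f g)
  have h₁ : Topology.IsInducing e.hom := (TopCat.homeoOfIso e).isInducing
  have h₂ := (Topology.IsInducing.subtypeVal
    (t := {p : X × Y | f p.1 = g p.2})).comp h₁
  convert h₂ using 1
  funext p
  refine Prod.ext ?_ ?_
  · exact (ConcreteCategory.congr_hom (h.isoIsPullback_hom_fst _ _ (isPullback_fibreProduct f g))
      p).symm
  · exact (ConcreteCategory.congr_hom (h.isoIsPullback_hom_snd _ _ (isPullback_fibreProduct f g))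
      p).symm

theorem exists_of_isPullback {x : X} {y : Y} (hxy : f x = g y) : ∃ p, fst p = x ∧ snd p = y := by
  let e := h.isoIsPullback _ _ (isPullback_fibreProduct f g)
  refine ⟨e.inv ⟨(x, y), hxy⟩, ?_, ?_⟩
  · exact ConcreteCategory.congr_hom
      (h.isoIsPullback_inv_fst _ _ (isPullback_fibreProduct f g)) _
  · exact ConcreteCategory.congr_hom
      (h.isoIsPullback_inv_snd _ _ (isPullback_fibreProduct f g)) _

theorem ext_of_isPullback {p q : W} (h₁ : fst p = fst q) (h₂ : snd p = snd q) : p = q := by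
  let e := h.isoIsPullback _ _ (isPullback_fibreProduct f g)
  apply (TopCat.homeoOfIso e).injective
  have k₁ := fun p => ConcreteCategory.congr_hom
    (h.isoIsPullback_hom_fst _ _ (isPullback_fibreProduct f g)) p
  have k₂ := fun p => ConcreteCategory.congr_hom
    (h.isoIsPullback_hom_snd _ _ (isPullback_fibreProduct f g)) p
  refine Subtype.ext (Prod.ext ?_ ?_)
  · exact (k₁ p).trans (h₁.trans (k₁ q).symm)
  · exact (k₂ p).trans (h₂.trans (k₂ q).symm)

end TopPullback

/-! ### Fibres of equivariant pullback squares -/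

namespace ZRSpaceOver

variable {P Q : ZRSpaceOver.{u}}

theorem leL_toFiber_iff {s : P.base} {x y : P.total} (hx : P.proj x = s) (hy : P.proj y = s) :
    leL (P.toFiber x hx) (P.toFiber y hy) ↔
      leL (P.toFiber x (hx.trans hy.symm)) (P.toFiber y rfl) := by
  subst hy
  rfl

theorem mem_fixedPts_fiber_iff {s : P.base} (x : P.Fiber s) :
    x ∈ fixedPts (P.Fiber s) ↔ (x : P.total) ∈ fixedPts P.total :=
  (fixedPts_iff_of_equivariant (e := fun x : P.Fiber s => (x : P.total)) Subtype.val_injective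
    (fun _ _ => rfl) x).symm

theorem Hom.proj_total (m : P ⟶ Q) (x : P.total) : Q.proj (m.total x) = m.base (P.proj x) :=
  ConcreteCategory.congr_hom m.isPullback.w x

/-- The map of fibres induced by an equivariant pullback square. -/
def Hom.fiberFun (m : P ⟶ Q) (s : P.base) (x : P.Fiber s) : Q.Fiber (m.base s) :=
  Q.toFiber (m.total x) ((Hom.proj_total m x).trans (congrArg m.base x.2))

theorem Hom.fiberFun_bijective (m : P ⟶ Q) (s : P.base) :
    Function.Bijective (Hom.fiberFun m s) := by
  constructor
  · intro x y h
    refine Subtype.ext (ext_of_isPullback m.isPullback ?_ ?_)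
    · exact congrArg Subtype.val h
    · exact x.2.trans y.2.symm
  · intro y
    obtain ⟨x, hx₁, hx₂⟩ := exists_of_isPullback m.isPullback (x := (y : Q.total)) (y := s) y.2
    exact ⟨⟨x, hx₂⟩, Subtype.ext hx₁⟩

theorem Hom.fiberFun_isInducing (m : P ⟶ Q) (s : P.base) :
    Topology.IsInducing (Hom.fiberFun m s) := by
  have h₁ := (isInducing_of_isPullback m.isPullback).comp
    (Topology.IsInducing.subtypeVal (t := {x : P.total | x ∈ P.fiberSub s}))
  have hc : Continuous (Hom.fiberFun m s) := by
    refine Continuous.subtype_mk ?_ _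
    exact m.total.hom.continuous.comp continuous_subtype_val
  have h₂ : Continuous fun y : Q.Fiber (m.base s) => ((y : Q.total), s) := by fun_prop
  refine Topology.IsInducing.of_comp hc h₂ ?_
  have e : ((fun y : Q.Fiber (m.base s) => ((y : Q.total), s)) ∘ Hom.fiberFun m s) =
      fun x : P.Fiber s => (m.total x, P.proj x) := funext fun x => Prod.ext rfl x.2.symm
  rw [e]
  exact h₁

/-- The homeomorphism of fibres induced by an equivariant pullback square. -/
def Hom.fiberHomeo (m : P ⟶ Q) (s : P.base) : P.Fiber s ≃ₜ Q.Fiber (m.base s) :=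
  (Equiv.ofBijective _ (Hom.fiberFun_bijective m s)).toHomeomorphOfIsInducing
    (Hom.fiberFun_isInducing m s)

theorem Hom.fiberHomeo_vadd (m : P ⟶ Q) (s : P.base) (g : ℤ × ℝ) (x : P.Fiber s) :
    Hom.fiberHomeo m s (g +ᵥ x) = g +ᵥ Hom.fiberHomeo m s x :=
  Subtype.ext (m.equivariant g x)

end ZRSpaceOver

/-! ### The quotient by `ℤ` -/

section Quot

variable {L : Type u} [AddAction (ℤ × ℝ) L]

theorem mk_eq_mk_iff {x y : L} :
    Quotient.mk (zSetoid L) x = Quotient.mk (zSetoid L) y ↔ ∃ n : ℤ, (n, (0 : ℝ)) +ᵥ x = y :=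
  Quotient.eq (r := zSetoid L)

theorem mk_mem_zQuotFixedPts_iff {x : L} :
    Quotient.mk (zSetoid L) x ∈ zQuotFixedPts L ↔
      ∀ t : ℝ, Quotient.mk (zSetoid L) (((0 : ℤ), t) +ᵥ x) = Quotient.mk (zSetoid L) x := by
  refine ⟨fun h t => h x rfl t, ?_⟩
  intro h y hy t
  obtain ⟨n, rfl⟩ := mk_eq_mk_iff.1 hy.symm
  rw [← h t, ← int_real_vadd_comm]
  exact (mk_eq_mk_iff.2 ⟨n, rfl⟩).symm

/-- The saturation of an open set is the union of its `ℤ`-translates. -/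
theorem isOpenMap_mk [TopologicalSpace L] [ContinuousVAdd (ℤ × ℝ) L] :
    IsOpenMap (Quotient.mk (zSetoid L)) := by
  intro O hO
  refine isQuotientMap_quot_mk.isOpen_preimage.1 ?_
  have : Quot.mk (zSetoid L).r ⁻¹' (Quotient.mk (zSetoid L) '' O) =
      ⋃ n : ℤ, (fun x : L => ((n, (0 : ℝ)) : ℤ × ℝ) +ᵥ x) ⁻¹' O := by
    ext x
    simp only [Set.mem_preimage, Set.mem_iUnion]
    constructor
    · rintro ⟨y, hy, h⟩
      obtain ⟨n, rfl⟩ := mk_eq_mk_iff.1 h.symm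
      exact ⟨n, hy⟩
    · rintro ⟨n, hn⟩
      exact ⟨_, hn, (mk_eq_mk_iff.2 ⟨n, rfl⟩).symm⟩
  exact this ▸ isOpen_iUnion fun n => hO.preimage (continuous_const_vadd _)

theorem continuous_mk [TopologicalSpace L] : Continuous (Quotient.mk (zSetoid L)) :=
  continuous_quot_mk

end Quot

/-- Every point has a translate by `ℤ` between `x` and `x + 1`. -/
theorem IsBrokenParacycle.exists_int_vadd_mem_Icc {L : Type u} [TopologicalSpace L]
    [AddAction (ℤ × ℝ) L] (hL : IsBrokenParacycle L) {φ : L ≃ₜ ℝ} (hφ : IsDirectedHomeo φ)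
    (x y : L) : ∃ n : ℤ,
      φ ((n, (0 : ℝ)) +ᵥ y) ∈ Set.Icc (φ x) (φ (((1 : ℤ), (0 : ℝ)) +ᵥ x)) := by
  classical
  -- First y is moved below x. The first of its further translates that exceeds x is then at most x
  -- + 1, since its predecessor is at most x.
  obtain ⟨N, hN⟩ := hL.exists_int_vadd_gt hφ x (φ y)
  set z := (-(N : ℤ), (0 : ℝ)) +ᵥ y with hz
  have hzx : leL z x := by
    rw [← hL.vadd_leL_vadd_iff ((N : ℤ), (0 : ℝ)), hz, int_vadd_vadd, add_neg_cancel,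
      real_zero_vadd, hL.leL_iff hφ]
    exact hN.le
  have hex := hL.exists_int_vadd_gt hφ z (φ x)
  have hk := Nat.find_spec hex
  have hmin := fun m => Nat.find_min hex (m := m)
  generalize Nat.find hex = k at hk hmin
  obtain _ | k := k
  · simp only [Nat.cast_zero, real_zero_vadd] at hk
    exact absurd ((hL.leL_iff hφ).1 hzx) hk.not_ge
  · refine ⟨((k + 1 : ℕ) : ℤ) + -N, ?_⟩
    rw [← int_vadd_vadd, ← hz]
    refine ⟨hk.le, ?_⟩
    have := not_lt.1 (hmin k (Nat.lt_succ_self k))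
    rw [← hL.leL_iff hφ, ← hL.vadd_leL_vadd_iff ((1 : ℤ), (0 : ℝ)), int_vadd_vadd,
      hL.leL_iff hφ] at this
    rwa [add_comm (1 : ℤ)] at this

namespace ZRSpaceOver

variable {P : ZRSpaceOver.{u}}

theorem continuous_quotProj : Continuous P.quotProj :=
  continuous_quot_lift _ P.proj.hom.continuous

/-- Each fibre of the quotient is compact, being the image of an interval from x to x + 1.
Properness, unlike closedness of a map, survives base change. -/
theorem isProperMap_quotProj (hP : P.IsFamily) : IsProperMap P.quotProj := by
  rw [isProperMap_iff_isClosedMap_and_compact_fibers]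
  refine ⟨continuous_quotProj, hP.quotient_closed, fun s => ?_⟩
  have hL := hP.fibers s
  obtain ⟨φ, hφ⟩ := hL.directed
  obtain ⟨x⟩ : Nonempty (P.Fiber s) := ⟨φ.symm 0⟩
  have hcomp : IsCompact ((fun r : ℝ => Quotient.mk (zSetoid P.total) (φ.symm r : P.total)) ''
      Set.Icc (φ x) (φ (((1 : ℤ), (0 : ℝ)) +ᵥ x))) := by
    refine isCompact_Icc.image ?_
    exact continuous_mk.comp (continuous_subtype_val.comp φ.symm.continuous)
  convert hcomp using 1
  ext q
  constructor
  · induction q using Quotient.inductionOn with | _ y => ?_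
    intro hy
    obtain ⟨n, hn⟩ := hL.exists_int_vadd_mem_Icc hφ x ⟨y, hy⟩
    refine ⟨_, hn, ?_⟩
    simp only [φ.symm_apply_apply]
    exact (mk_eq_mk_iff.2 ⟨n, rfl⟩).symm
  · rintro ⟨r, -, rfl⟩
    exact (φ.symm r).2

/-! ### Base change of the quotient by `ℤ` -/

section Pullback

variable {T : TopCat.{u}} (f : T ⟶ P.base)

/-- The map `(f^* L)/ℤ → L/ℤ`. -/
def pullbackQuotMap : ZQuot (P.pullback f).total → ZQuot P.total :=
  Quotient.map (fun x => (P.pullbackHom f).total x) (by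
    rintro x y ⟨n, rfl⟩
    exact ⟨n, rfl⟩)

theorem continuous_pullbackQuotMap : Continuous (pullbackQuotMap (P := P) f) :=
  continuous_quot_lift _ (continuous_mk.comp (P.pullbackHom f).total.hom.continuous)

theorem quotProj_pullbackQuotMap (q : ZQuot (P.pullback f).total) :
    P.quotProj (pullbackQuotMap f q) = f ((P.pullback f).quotProj q) := by
  induction q using Quotient.inductionOn with | _ x => exact x.2.symm

theorem mk_pullback_eq_iff {x y : (P.pullback f).total}
    (h : (P.pullback f).proj x = (P.pullback f).proj y) :
    Quotient.mk (zSetoid (P.pullback f).total) x = Quotient.mk (zSetoid (P.pullback f).total) y ↔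
      Quotient.mk (zSetoid P.total) ((P.pullbackHom f).total x) =
        Quotient.mk (zSetoid P.total) ((P.pullbackHom f).total y) := by
  rw [mk_eq_mk_iff, mk_eq_mk_iff]
  refine exists_congr fun n => ⟨fun e => congrArg (P.pullbackHom f).total e, fun e => ?_⟩
  exact Subtype.ext (Prod.ext h e)

theorem pullbackQuotMap_mem_fixed_iff (q : ZQuot (P.pullback f).total) :
    pullbackQuotMap f q ∈ zQuotFixedPts P.total ↔ q ∈ zQuotFixedPts (P.pullback f).total := by
  induction q using Quotient.inductionOn with | _ x => ?_
  rw [mk_mem_zQuotFixedPts_iff]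
  refine Iff.trans mk_mem_zQuotFixedPts_iff (forall_congr' fun t => ?_)
  exact (mk_pullback_eq_iff f ((P.pullback f).proj_vadd _ x)).symm

theorem pullback_continuousVAdd [ContinuousVAdd (ℤ × ℝ) P.total] :
    ContinuousVAdd (ℤ × ℝ) (P.pullback f).total := by
  refine ⟨?_⟩
  refine Continuous.subtype_mk (Continuous.prodMk ?_ ?_) _
  · exact continuous_fst.comp (continuous_subtype_val.comp continuous_snd)
  · exact continuous_fst.vadd (continuous_snd.comp (continuous_subtype_val.comp continuous_snd))

theorem pullback_quot_ext {p q : ZQuot (P.pullback f).total}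
    (h₁ : (P.pullback f).quotProj p = (P.pullback f).quotProj q)
    (h₂ : pullbackQuotMap f p = pullbackQuotMap f q) : p = q := by
  induction p using Quotient.inductionOn with | _ x => ?_
  induction q using Quotient.inductionOn with | _ y => ?_
  exact (mk_pullback_eq_iff f h₁).2 h₂

theorem pullback_quot_exists {t : T} {q : ZQuot P.total} (h : f t = P.quotProj q) :
    ∃ p, (P.pullback f).quotProj p = t ∧ pullbackQuotMap f p = q := by
  induction q using Quotient.inductionOn with | _ x => ?_
  exact ⟨Quotient.mk _ ⟨(t, x), h⟩, rfl, rfl⟩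

/-- `(f^* L)/ℤ` is the pullback of `L/ℤ`. -/
theorem isInducing_pullback_quot [ContinuousVAdd (ℤ × ℝ) P.total] :
    Topology.IsInducing fun q : ZQuot (P.pullback f).total =>
      ((P.pullback f).quotProj q, pullbackQuotMap f q) := by
  have hc : Continuous fun q : ZQuot (P.pullback f).total =>
      ((P.pullback f).quotProj q, pullbackQuotMap f q) :=
    continuous_quotProj.prodMk (continuous_pullbackQuotMap f)
  refine ⟨le_antisymm hc.le_induced ?_⟩
  intro O' hO'
  obtain ⟨O, hO, hOeq⟩ := isOpen_induced_iff.1 (hO'.preimage continuous_mk)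
  -- The quotient map is open, so the image of an open subset of `T × L` is open in `T × L/ℤ`. This
  -- is why forming the quotient commutes with base change.
  refine ⟨Prod.map id (Quotient.mk (zSetoid P.total)) '' O,
    (IsOpenMap.id.prodMap isOpenMap_mk) _ hO, ?_⟩
  ext q
  induction q using Quotient.inductionOn with | _ x => ?_
  constructor
  · rintro ⟨⟨t, y⟩, hy, h⟩
    have h₁ : t = x.1.1 := congrArg Prod.fst h
    have h₂ : Quotient.mk (zSetoid P.total) y = Quotient.mk (zSetoid P.total) x.1.2 :=
      congrArg Prod.snd h
    subst h₁
    have hty : f x.1.1 = P.proj y := by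
      rw [x.2]
      exact (congrArg P.quotProj h₂).symm
    have hm := (Set.ext_iff.1 hOeq (⟨(x.1.1, y), hty⟩ : (P.pullback f).total)).1 hy
    have e := (mk_pullback_eq_iff f (x := ⟨(x.1.1, y), hty⟩) (y := x) rfl).2 h₂
    rw [← e]
    exact hm
  · intro hx
    exact ⟨x.1, (Set.ext_iff.1 hOeq x).2 hx, rfl⟩

end Pullback

theorem unramifiedModZ_pullback (hP : P.IsFamily) {T : TopCat.{u}} (f : T ⟶ P.base) :
    (P.pullback f).UnramifiedModZ := by
  have := hP.continuous_action
  intro t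
  obtain ⟨U, hU, htU, n, K, hK, hdisj, hunion, hclosed, hemb⟩ := hP.unramified (f t)
  have hK' : ∀ a, Set.MapsTo (P.pullback f).quotProj (pullbackQuotMap f ⁻¹' K a) (f ⁻¹' U) := by
    intro a q hq
    have := hK a hq
    rwa [quotProj_pullbackQuotMap] at this
  refine ⟨f ⁻¹' U, hU.preimage f.hom.continuous, htU, n, fun a => pullbackQuotMap f ⁻¹' K a, hK',
    ?_, ?_, ?_, ?_⟩
  · intro a b hab
    exact (hdisj hab).preimage _
  · ext q
    rw [← Set.preimage_iUnion, hunion, Set.preimage_inter]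
    refine and_congr (pullbackQuotMap_mem_fixed_iff f q) ?_
    simp only [Set.mem_preimage, quotProj_pullbackQuotMap]
    rfl
  · intro a
    have hm : ∀ q : (P.pullback f).quotProj ⁻¹' (f ⁻¹' U),
        pullbackQuotMap f q ∈ P.quotProj ⁻¹' U := by
      intro q
      rw [Set.mem_preimage, quotProj_pullbackQuotMap]
      exact q.2
    have hcont : Continuous fun q : (P.pullback f).quotProj ⁻¹' (f ⁻¹' U) =>
        (⟨pullbackQuotMap f q, hm q⟩ : P.quotProj ⁻¹' U) :=
      ((continuous_pullbackQuotMap f).comp continuous_subtype_val).subtype_mk _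
    exact (hclosed a).preimage hcont
  · intro a
    let g := (hK' a).restrict (P.pullback f).quotProj (pullbackQuotMap f ⁻¹' K a) (f ⁻¹' U)
    have hg : Continuous g := continuous_quotProj.restrict (hK' a)
    let k : (f ⁻¹' U : Set T) → U := fun u => ⟨f u, u.2⟩
    have hk : Continuous k := (f.hom.continuous.comp continuous_subtype_val).subtype_mk _
    let e := (hK a).restrict P.quotProj (K a) U
    refine ⟨⟨?_, ?_⟩, ?_⟩
    · refine Topology.IsInducing.of_comp hg (g := fun u : (f ⁻¹' U : Set T) => (u.1, k u)) (by fun_prop) ?_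
      have h₁ := (isInducing_pullback_quot f).comp
        (Topology.IsInducing.subtypeVal (t := pullbackQuotMap f ⁻¹' K a))
      let pr : (pullbackQuotMap f ⁻¹' K a : Set (ZQuot (P.pullback f).total)) → K a :=
        fun q => ⟨pullbackQuotMap f q, q.2⟩
      have hpr : Continuous pr :=
        ((continuous_pullbackQuotMap f).comp continuous_subtype_val).subtype_mk _
      have h₂ : Topology.IsInducing fun q : (pullbackQuotMap f ⁻¹' K a :
          Set (ZQuot (P.pullback f).total)) => ((P.pullback f).quotProj q, pr q) := by
        refine Topology.IsInducing.of_comp ?_ (g := fun p : T × K a => (p.1, (p.2 : ZQuot P.total)))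
          (by fun_prop) h₁
        exact (continuous_quotProj.comp continuous_subtype_val).prodMk hpr
      have h₃ := (Topology.IsInducing.id.prodMap (hemb a).isInducing).comp h₂
      have h₄ : ((fun u : (f ⁻¹' U : Set T) => (u.1, k u)) ∘ g) =
          fun q => ((P.pullback f).quotProj q.1, e (pr q)) := funext fun q =>
        Prod.ext rfl (Subtype.ext (quotProj_pullbackQuotMap f q.1).symm)
      exact (congrArg Topology.IsInducing h₄).mpr h₃
    · intro p q h
      have h' : (P.pullback f).quotProj p.1 = (P.pullback f).quotProj q.1 := congrArg Subtype.val h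
      refine Subtype.ext (pullback_quot_ext f h' ?_)
      have h₂ : e ⟨_, p.2⟩ = e ⟨_, q.2⟩ := Subtype.ext (by
        change P.quotProj (pullbackQuotMap f p.1) = P.quotProj (pullbackQuotMap f q.1)
        rw [quotProj_pullbackQuotMap, quotProj_pullbackQuotMap, h'])
      exact congrArg Subtype.val ((hemb a).injective h₂)
    · have : Set.range g = k ⁻¹' Set.range e := by
        ext u
        constructor
        · rintro ⟨q, rfl⟩
          exact ⟨⟨_, q.2⟩, Subtype.ext (quotProj_pullbackQuotMap f q.1)⟩
        · rintro ⟨q, hq⟩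
          have hq' : P.quotProj q.1 = f u.1 := congrArg Subtype.val hq
          obtain ⟨p, hp₁, hp₂⟩ := pullback_quot_exists f hq'.symm
          exact ⟨⟨p, by rw [Set.mem_preimage, hp₂]; exact q.2⟩, Subtype.ext hp₁⟩
      change IsClosed (Set.range g)
      rw [this]
      exact (hemb a).isClosed_range.preimage hk

/-- By properness the product of the identity of `T` with the projection is closed. The image of a
closed set is then read off along the graph of f. -/
theorem isClosedMap_quotProj_pullback (hP : P.IsFamily) {T : TopCat.{u}} (f : T ⟶ P.base) :
    IsClosedMap (P.pullback f).quotProj := by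
  have := hP.continuous_action
  intro C hC
  obtain ⟨D, hD, rfl⟩ := (isInducing_pullback_quot f).isClosed_iff.1 hC
  have h₁ : IsClosed (Prod.map id P.quotProj '' D : Set (T × P.base)) :=
    (isProperMap_id.prodMap (isProperMap_quotProj hP)).isClosedMap _ hD
  have h₂ : Continuous fun t : T => (t, f t) := by fun_prop
  have h₃ : (P.pullback f).quotProj '' ((fun q : ZQuot (P.pullback f).total =>
      ((P.pullback f).quotProj q, pullbackQuotMap f q)) ⁻¹' D) =
      ((fun t : T => (t, f t)) ⁻¹' (Prod.map id P.quotProj '' D) : Set T) := ?_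
  · exact (congrArg IsClosed h₃).mpr (h₁.preimage h₂)
  refine Set.ext fun (t : T) => ?_
  constructor
  · rintro ⟨q, hq, rfl⟩
    exact ⟨_, hq, Prod.ext rfl (quotProj_pullbackQuotMap f q)⟩
  · rintro ⟨⟨t', q⟩, hq, h⟩
    obtain rfl : t' = t := congrArg Prod.fst h
    have hq' : P.quotProj q = f t' := congrArg Prod.snd h
    obtain ⟨p, rfl, rfl⟩ := pullback_quot_exists f hq'.symm
    exact ⟨p, hq, rfl⟩

theorem isFamily_pullback (hP : P.IsFamily) {T : TopCat.{u}} (f : T ⟶ P.base) :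
    (P.pullback f).IsFamily where
  continuous_action := by
    have := hP.continuous_action
    exact pullback_continuousVAdd f
  fibers t := (hP.fibers (f t)).of_equivariant (Hom.fiberHomeo (P.pullbackHom f) t).symm
    (equivariant_symm _ (Hom.fiberHomeo_vadd (P.pullbackHom f) t))
  unramified := unramifiedModZ_pullback hP f
  quotient_closed := isClosedMap_quotProj_pullback hP f
  separated := by
    let m := P.pullbackHom f
    have hproj : ∀ p : {p : (P.pullback f).total × (P.pullback f).total //
        (P.pullback f).proj p.1 = (P.pullback f).proj p.2},
        P.proj (m.total p.1.1) = P.proj (m.total p.1.2) := fun p => by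
      rw [Hom.proj_total, Hom.proj_total, p.2]
    have hc : Continuous fun p : {p : (P.pullback f).total × (P.pullback f).total //
        (P.pullback f).proj p.1 = (P.pullback f).proj p.2} =>
        (⟨(m.total p.1.1, m.total p.1.2), hproj p⟩ :
          {p : P.total × P.total // P.proj p.1 = P.proj p.2}) := by
      refine Continuous.subtype_mk (Continuous.prodMk ?_ ?_) _
      · exact m.total.hom.continuous.comp (continuous_fst.comp continuous_subtype_val)
      · exact m.total.hom.continuous.comp (continuous_snd.comp continuous_subtype_val)
    convert hP.separated.preimage hc using 1
    ext p
    have := leL_of_equivariant _ (Hom.fiberHomeo_vadd m ((P.pullback f).proj p.1.2))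
      ((P.pullback f).toFiber p.1.1 p.2) ((P.pullback f).toFiber p.1.2 rfl)
    exact this.symm.trans (leL_toFiber_iff _ _)
  local_lifting := by
    intro x hx
    have hfix : ∀ y : (P.pullback f).total, y ∈ fixedPts (P.pullback f).total ↔
        y.1.2 ∈ fixedPts P.total := by
      intro y
      refine forall_congr' fun t => ⟨fun h => congrArg (fun z => z.1.2) h, fun h => ?_⟩
      exact Subtype.ext (Prod.ext rfl h)
    obtain ⟨U, hxU, σ, hU, hσ, hσ', hσx⟩ := hP.local_lifting x.1.2 (by rwa [← hfix])
    have hm : f x.1.1 ∈ U := by rw [x.2]; exact hxU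
    refine ⟨f ⁻¹' U, hm, fun t => ⟨(t.1, σ ⟨f t.1, t.2⟩), (hσ' ⟨f t.1, t.2⟩).1.symm⟩,
      hU.preimage f.hom.continuous, ?_, ?_, ?_⟩
    · refine Continuous.subtype_mk (Continuous.prodMk continuous_subtype_val (hσ.comp ?_)) _
      exact (f.hom.continuous.comp continuous_subtype_val).subtype_mk _
    · intro t
      refine ⟨rfl, ?_⟩
      refine (not_congr (hfix _)).2 ?_
      exact (hσ' ⟨f t.1, t.2⟩).2
    · refine Subtype.ext (Prod.ext rfl ?_)
      rw [← hσx]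
      exact congrArg σ (Subtype.ext x.2)

end ZRSpaceOver

theorem pullbackStable : Family.PullbackStable.{u} :=
  fun _ hP _ f => ZRSpaceOver.isFamily_pullback hP f

/-! ### The relation between `β_i`, `α(i,j)` and `β_j` -/

/-- The closed relation on triples of extended reals which says that `x = c + y` whenever this
makes sense. -/
def Rel (x c y : EReal) : Prop :=
  ∀ a b : ℝ, ¬ (x < a ∧ (b : EReal) < y ∧ ((a - b : ℝ) : EReal) < c) ∧
    ¬ ((a : EReal) < x ∧ y < b ∧ c < ((a - b : ℝ) : EReal))

theorem coe_add_lt_coe_iff (c r : ℝ) (y : EReal) : (c : EReal) + y < r ↔ y < ((r - c : ℝ) : EReal) := by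
  induction y with
  | bot => simp [-EReal.coe_sub]
  | top => simp [-EReal.coe_sub]
  | coe y =>
    norm_cast
    exact ⟨fun h => by linarith, fun h => by linarith⟩

theorem coe_lt_coe_add_iff (c r : ℝ) (y : EReal) : (r : EReal) < c + y ↔ ((r - c : ℝ) : EReal) < y := by
  induction y with
  | bot => simp [-EReal.coe_sub]
  | top => simp [-EReal.coe_sub]
  | coe y =>
    norm_cast
    exact ⟨fun h => by linarith, fun h => by linarith⟩

theorem rel_symm {x c y : EReal} (h : Rel x c y) : Rel y (-c) x := by
  intro a b
  have e : ((a - b : ℝ) : EReal) = -((b - a : ℝ) : EReal) := by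
    rw [← EReal.coe_neg]; congr 1; ring
  refine ⟨fun ⟨h₁, h₂, h₃⟩ => (h b a).2 ⟨h₂, h₁, ?_⟩, fun ⟨h₁, h₂, h₃⟩ => (h b a).1 ⟨h₂, h₁, ?_⟩⟩
  · rwa [e, EReal.neg_lt_neg_iff] at h₃
  · rwa [e, EReal.neg_lt_neg_iff] at h₃

theorem rel_top_iff {x y : EReal} : Rel x ⊤ y ↔ x = ⊤ ∨ y = ⊥ := by
  constructor
  · intro h
    by_contra! hn
    obtain ⟨a, ha, -⟩ := EReal.lt_iff_exists_real_btwn.1 (lt_top_iff_ne_top.2 hn.1)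
    obtain ⟨b, -, hb⟩ := EReal.lt_iff_exists_real_btwn.1 (bot_lt_iff_ne_bot.2 hn.2)
    exact (h a b).1 ⟨ha, hb, EReal.coe_lt_top _⟩
  · rintro (rfl | rfl) a b
    · exact ⟨fun h => not_top_lt h.1, fun h => not_top_lt h.2.2⟩
    · exact ⟨fun h => not_lt_bot h.2.1, fun h => not_top_lt h.2.2⟩

/-- If x were smaller, two reals r < r' strictly between x and a + c would violate the first clause
of `Rel`. This covers infinite c as well, and the next lemma is the mirror image. -/
theorem Rel.coe_add_le {x c y : EReal} (h : Rel x c y) {a : ℝ} (ha : (a : EReal) ≤ y) :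
    a + c ≤ x := by
  by_contra! hn
  obtain ⟨r, hr₁, hr₂⟩ := EReal.lt_iff_exists_real_btwn.1 hn
  obtain ⟨r', hr'₁, hr'₂⟩ := EReal.lt_iff_exists_real_btwn.1 hr₂
  refine (h r (a - (r' - r))).1 ⟨hr₁, lt_of_lt_of_le ?_ ha, ?_⟩
  · have := EReal.coe_lt_coe_iff.1 hr'₁
    exact EReal.coe_lt_coe_iff.2 (by linarith)
  · rw [coe_lt_coe_add_iff] at hr'₂
    convert hr'₂ using 2
    ring

theorem Rel.le_coe_add {x c y : EReal} (h : Rel x c y) {a : ℝ} (ha : y ≤ a) :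
    x ≤ a + c := by
  by_contra! hn
  obtain ⟨r, hr₁, hr₂⟩ := EReal.lt_iff_exists_real_btwn.1 hn
  obtain ⟨r', hr'₁, hr'₂⟩ := EReal.lt_iff_exists_real_btwn.1 hr₁
  refine (h r (a + (r - r'))).2 ⟨hr₂, lt_of_le_of_lt ha ?_, ?_⟩
  · have := EReal.coe_lt_coe_iff.1 hr'₂
    exact EReal.coe_lt_coe_iff.2 (by linarith)
  · rw [coe_add_lt_coe_iff] at hr'₁
    convert hr'₁ using 2
    ring

theorem rel_coe_iff {x y : EReal} {c : ℝ} : Rel x c y ↔ x = c + y := by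
  constructor
  · intro h
    refine le_antisymm ?_ ?_
    · refine le_of_forall_gt fun d hd => ?_
      obtain ⟨r, hr₁, hr₂⟩ := EReal.lt_iff_exists_real_btwn.1 hd
      rw [coe_add_lt_coe_iff] at hr₁
      refine lt_of_le_of_lt (h.le_coe_add hr₁.le) ?_
      rw [← EReal.coe_add, sub_add_cancel]
      exact hr₂
    · refine le_of_forall_lt fun d hd => ?_
      obtain ⟨r, hr₁, hr₂⟩ := EReal.lt_iff_exists_real_btwn.1 hd
      rw [coe_lt_coe_add_iff] at hr₂
      refine lt_of_lt_of_le ?_ (h.coe_add_le hr₂.le)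
      rw [← EReal.coe_add, sub_add_cancel]
      exact hr₁
  · rintro rfl a b
    simp only [coe_add_lt_coe_iff, coe_lt_coe_add_iff, EReal.coe_lt_coe_iff]
    refine ⟨fun ⟨h₁, h₂, h₃⟩ => ?_, fun ⟨h₁, h₂, h₃⟩ => ?_⟩
    · have := EReal.coe_lt_coe_iff.1 (h₂.trans h₁)
      linarith
    · have := EReal.coe_lt_coe_iff.1 (h₁.trans h₂)
      linarith

/-- For real c all three equations say x = c + y. For c = ∞, their disjunction says that x = ∞ or y
= -∞, each undefined expression being compensated by one of the other equations. -/
theorem triple_iff_rel {x c y : EReal} (hc : ⊥ < c) :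
    SumEq x c y ∨ DiffEq c x y ∨ DiffEq y x c ↔ Rel x c y := by
  unfold SumEq DiffEq
  induction c with
  | bot => exact absurd hc (lt_irrefl _)
  | top =>
    rw [rel_top_iff]
    induction x <;> induction y <;> simp [← EReal.coe_sub]
  | coe c =>
    rw [rel_coe_iff]
    induction x <;> induction y <;> simp [← EReal.coe_add, ← EReal.coe_sub]
    rintro (h | h) <;> linarith

/-- `Rel` forbids a family of configurations defined by strict inequalities. Its closedness is what
permits compactness arguments in the universal family. -/
theorem isClosed_rel : IsClosed {p : EReal × EReal × EReal | Rel p.1 p.2.1 p.2.2} := by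
  have : {p : EReal × EReal × EReal | Rel p.1 p.2.1 p.2.2} = ⋂ (a : ℝ) (b : ℝ),
      {p | p.1 < (a : EReal) ∧ (b : EReal) < p.2.2 ∧ ((a - b : ℝ) : EReal) < p.2.1}ᶜ ∩
      {p | (a : EReal) < p.1 ∧ p.2.2 < (b : EReal) ∧ p.2.1 < ((a - b : ℝ) : EReal)}ᶜ := by
    ext p
    simp only [Set.mem_iInter]
    rfl
  rw [this]
  have h₁ : Continuous fun p : EReal × EReal × EReal => p.1 := by fun_prop
  have h₂ : Continuous fun p : EReal × EReal × EReal => p.2.1 := by fun_prop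
  have h₃ : Continuous fun p : EReal × EReal × EReal => p.2.2 := by fun_prop
  refine isClosed_iInter fun a => isClosed_iInter fun b => IsClosed.inter ?_ ?_
  · exact isClosed_compl_iff.2 ((isOpen_lt h₁ continuous_const).inter
      ((isOpen_lt continuous_const h₃).inter (isOpen_lt continuous_const h₂)))
  · exact isClosed_compl_iff.2 ((isOpen_lt continuous_const h₁).inter
      ((isOpen_lt h₃ continuous_const).inter (isOpen_lt h₂ continuous_const)))

theorem Rel.bot_lt {x c y : EReal} (h : Rel x c y) (hc : ⊥ < c) (hy : ⊥ < y) : ⊥ < x := by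
  induction c with
  | bot => exact absurd hc (lt_irrefl _)
  | top =>
    rcases rel_top_iff.1 h with h | h
    · rw [h]; exact bot_lt_top
    · exact absurd h hy.ne'
  | coe c =>
    rw [rel_coe_iff.1 h]
    induction y with
    | bot => exact absurd hy (lt_irrefl _)
    | top => simp
    | coe y => exact EReal.bot_lt_coe (c + y)

section RelAdd

variable {p q : EReal} (hp : ⊥ < p) (hq : ⊥ < q)
include hp hq

theorem rel_add : Rel (p + q) p q := by
  induction p with
  | bot => exact absurd hp (lt_irrefl _)
  | top => rw [rel_top_iff, EReal.top_add_of_ne_bot hq.ne']; exact Or.inl rfl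
  | coe p => exact rel_coe_iff.2 rfl

theorem rel_self_add_neg : Rel p (p + q) (-q) := by
  induction p with
  | bot => exact absurd hp (lt_irrefl _)
  | top => rw [EReal.top_add_of_ne_bot hq.ne', rel_top_iff]; exact Or.inl rfl
  | coe p =>
    induction q with
    | bot => exact absurd hq (lt_irrefl _)
    | top => rw [EReal.coe_add_top, rel_top_iff]; exact Or.inr rfl
    | coe q =>
      rw [← EReal.coe_add, rel_coe_iff, ← EReal.coe_neg, ← EReal.coe_add]
      congr 1; ring

theorem rel_neg_neg_add : Rel (-p) q (-(p + q)) := by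
  induction q with
  | bot => exact absurd hq (lt_irrefl _)
  | top => rw [EReal.add_top_of_ne_bot hp.ne', rel_top_iff]; exact Or.inr rfl
  | coe q =>
    rw [rel_coe_iff]
    induction p with
    | bot => exact absurd hp (lt_irrefl _)
    | top => simp
    | coe p =>
      rw [← EReal.coe_add, ← EReal.coe_neg, ← EReal.coe_neg, ← EReal.coe_add]
      congr 1; ring

end RelAdd

/-! ### Paracyclic preorders -/

namespace PreordPara

variable (I : PreordPara.{u})

theorem strictMono_vadd (i : I) : StrictMono fun n : ℤ => n +ᵥ i := by
  refine strictMono_int_of_lt_succ fun n => ?_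
  have := I.lt_succ (n +ᵥ i)
  rwa [vadd_vadd, add_comm] at this

/-- Otherwise the translates of i would give infinitely many classes between i and j. -/
theorem exists_le_nat_vadd (i j : I) : ∃ n : ℕ, j ≤ (n : ℤ) +ᵥ i := by
  by_contra! hn
  have hle : ∀ n : ℕ, (n : ℤ) +ᵥ i ≤ j := fun n => (I.total _ _).resolve_right (hn n)
  refine Set.infinite_of_injective_forall_mem
    (f := fun n : ℕ => toAntisymmetrization (· ≤ ·) ((n : ℤ) +ᵥ i)) ?_ ?_ (I.finite_Icc i j)
  · have hm : StrictMono fun n : ℕ => toAntisymmetrization (· ≤ ·) ((n : ℤ) +ᵥ i) := by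
      intro m n hmn
      exact toAntisymmetrization_lt_toAntisymmetrization_iff.2
        (I.strictMono_vadd i (Int.ofNat_lt.2 hmn))
    exact hm.injective
  · intro n
    refine ⟨?_, toAntisymmetrization_le_toAntisymmetrization_iff.2 (hle n)⟩
    refine toAntisymmetrization_le_toAntisymmetrization_iff.2 ?_
    have := (I.strictMono_vadd i).monotone (Int.natCast_nonneg n)
    simpa using this

theorem exists_neg_nat_vadd_le (i j : I) : ∃ n : ℕ, (-(n : ℤ)) +ᵥ i ≤ j := by
  obtain ⟨n, hn⟩ := I.exists_le_nat_vadd j i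
  refine ⟨n, ?_⟩
  have := I.vadd_le (-(n : ℤ)) hn
  simpa [vadd_vadd] using this

theorem exists_finite_reps (i j : I) : ∃ s : Set I, s.Finite ∧
    ∀ k, i ≤ k → k ≤ j → ∃ l ∈ s, k ≤ l ∧ l ≤ k := by
  refine ⟨ofAntisymmetrization (· ≤ ·) '' _, (I.finite_Icc i j).image _, fun k h₁ h₂ => ?_⟩
  refine ⟨_, ⟨toAntisymmetrization (· ≤ ·) k, ⟨?_, ?_⟩, rfl⟩, ?_⟩
  · exact toAntisymmetrization_le_toAntisymmetrization_iff.2 h₁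
  · exact toAntisymmetrization_le_toAntisymmetrization_iff.2 h₂
  · have h : toAntisymmetrization (· ≤ ·) (ofAntisymmetrization (· ≤ ·)
        (toAntisymmetrization (· ≤ ·) k)) = toAntisymmetrization (α := I) (· ≤ ·) k :=
      toAntisymmetrization_ofAntisymmetrization _ _
    exact ⟨toAntisymmetrization_le_toAntisymmetrization_iff.1 h.ge,
      toAntisymmetrization_le_toAntisymmetrization_iff.1 h.le⟩

end PreordPara

/-- A total preorder which is locally finite up to equivalence and has no greatest and no least
element maps onto `ℤ`. -/
theorem exists_int_index {J : Type u} [Nonempty J] (r : J → J → Prop) (hrefl : ∀ i, r i i)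
    (htrans : ∀ i j k, r i j → r j k → r i k) (htot : ∀ i j, r i j ∨ r j i)
    (hfin : ∀ i j, ∃ s : Set J, s.Finite ∧ ∀ k, r i k → r k j → ∃ l ∈ s, r k l ∧ r l k)
    (hmax : ∀ i, ∃ j, ¬ r j i) (hmin : ∀ i, ∃ j, ¬ r i j) :
    ∃ κ : J → ℤ, Function.Surjective κ ∧ ∀ i j, κ i ≤ κ j ↔ r i j := by
  classical
  let : Preorder J := { le := r, le_refl := hrefl, le_trans := htrans }
  have : Std.Total (α := J) (· ≤ ·) := ⟨htot⟩
  -- The classes form a locally finite linear order without endpoints, hence a copy of `ℤ`.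
  let A := Antisymmetrization J (· ≤ ·)
  let q : J → A := toAntisymmetrization (· ≤ ·)
  have hq : ∀ i j, q i ≤ q j ↔ r i j := fun i j =>
    toAntisymmetrization_le_toAntisymmetrization_iff
  have hsurj : Function.Surjective q := Quotient.mk_surjective
  let : LocallyFiniteOrder A := LocallyFiniteOrder.ofFiniteIcc fun a b => by
    obtain ⟨i, rfl⟩ := hsurj a
    obtain ⟨j, rfl⟩ := hsurj b
    obtain ⟨s, hs, h⟩ := hfin i j
    refine (hs.image q).subset ?_
    rintro c ⟨h₁, h₂⟩
    obtain ⟨k, rfl⟩ := hsurj c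
    obtain ⟨l, hl, h₃, h₄⟩ := h k ((hq _ _).1 h₁) ((hq _ _).1 h₂)
    exact ⟨l, hl, le_antisymm ((hq _ _).2 h₄) ((hq _ _).2 h₃)⟩
  have : NoMaxOrder A := ⟨fun a => by
    obtain ⟨i, rfl⟩ := hsurj a
    obtain ⟨j, hj⟩ := hmax i
    exact ⟨q j, not_le.1 (mt (hq _ _).1 hj)⟩⟩
  have : NoMinOrder A := ⟨fun a => by
    obtain ⟨i, rfl⟩ := hsurj a
    obtain ⟨j, hj⟩ := hmin i
    exact ⟨q j, not_le.1 (mt (hq _ _).1 hj)⟩⟩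
  have : Nonempty A := ⟨q (Classical.arbitrary J)⟩
  let : SuccOrder A := LinearLocallyFiniteOrder.succOrder A
  let : PredOrder A := LinearLocallyFiniteOrder.predOrder A
  let e : A ≃o ℤ := orderIsoIntOfLinearSuccPredArch
  exact ⟨fun i => e (q i), e.surjective.comp hsurj, fun i j => by rw [e.le_iff_le, hq]⟩

/-! ### Distances -/

section Dst

variable {I : PreordPara.{u}} (α : FSpace I)

/-- The antisymmetric extension of `α` to all pairs. -/
def dst (i j : I) : EReal := universalBeta α j i

variable {α}

theorem FSpace.val_add {i j k : I} (hij : i ≤ j) (hjk : j ≤ k) :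
    FSpace.val α hij + FSpace.val α hjk = FSpace.val α (hij.trans hjk) :=
  α.2.2.1 i j k hij hjk

theorem FSpace.val_self (i : I) : FSpace.val α (le_refl i) = 0 := α.2.1 i

theorem dst_of_le {i j : I} (h : i ≤ j) : dst α i j = FSpace.val α h := by
  rw [dst, universalBeta, dif_pos h]

/-- Only equivalent indices need an argument: α(i,j) and α(j,i) are both > -∞ and add up to 0, hence
are finite and opposite. -/
theorem dst_neg (i j : I) : dst α j i = -dst α i j := by
  have key : ∀ {i j : I} (h : i ≤ j), dst α j i = -dst α i j := by
    intro i j h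
    rw [dst_of_le h]
    by_cases h' : j ≤ i
    · rw [dst_of_le h']
      have h₁ := FSpace.val_add (α := α) h h'
      have h₂ := FSpace.val_self (α := α) i
      have h₃ := FSpace.bot_lt α h
      have h₄ := FSpace.bot_lt α h'
      rw [h₂] at h₁
      revert h₁ h₃ h₄
      generalize FSpace.val α h = p
      generalize FSpace.val α h' = q
      intro h₁ h₃ h₄
      induction p <;> induction q <;> simp_all
      norm_cast at h₁ ⊢
      linarith
    · rw [dst, universalBeta, dif_neg h']
  rcases I.total i j with h | h
  · exact key h
  · rw [key h, neg_neg]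

theorem dst_self (i : I) : dst α i i = 0 := by
  rw [dst_of_le le_rfl, FSpace.val_self]

theorem bot_lt_dst {i j : I} (h : i ≤ j) : ⊥ < dst α i j := by
  rw [dst_of_le h]; exact FSpace.bot_lt α h

theorem dst_add {i j k : I} (hij : i ≤ j) (hjk : j ≤ k) : dst α i j + dst α j k = dst α i k := by
  rw [dst_of_le hij, dst_of_le hjk, dst_of_le (hij.trans hjk), FSpace.val_add]

/-- The cocycle relation freed of any assumption on the order of the three indices. Sums that may be
undefined are expressed through `Rel`. -/
theorem rel_dst (i j k : I) : Rel (dst α i k) (dst α i j) (dst α j k) := by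
  have key : ∀ {i j : I}, i ≤ j → Rel (dst α i k) (dst α i j) (dst α j k) := by
    intro i j hij
    rcases I.total j k with hjk | hkj
    · rw [← dst_add hij hjk]
      exact rel_add (bot_lt_dst hij) (bot_lt_dst hjk)
    · rcases I.total i k with hik | hki
      · rw [← dst_add hik hkj, dst_neg k j]
        exact rel_self_add_neg (bot_lt_dst hik) (bot_lt_dst hkj)
      · rw [dst_neg k i, dst_neg k j, ← dst_add hki hij]
        exact rel_neg_neg_add (bot_lt_dst hki) (bot_lt_dst hij)
  rcases I.total i j with h | h
  · exact key h
  · rw [dst_neg j i]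
    exact rel_symm (key h)

theorem dst_vadd (n : ℤ) (i j : I) : dst α (n +ᵥ i) (n +ᵥ j) = dst α i j := by
  rcases I.total i j with h | h
  · rw [dst_of_le h, dst_of_le (I.vadd_le n h), FSpace.val_shift]
  · rw [dst_neg j i, dst_neg (n +ᵥ j) (n +ᵥ i), dst_of_le h, dst_of_le (I.vadd_le n h),
      FSpace.val_shift]

theorem dst_one_vadd (i : I) : dst α i ((1 : ℤ) +ᵥ i) = ⊤ := by
  rw [dst_of_le (I.lt_succ i).le]
  exact α.2.2.2.2 i

theorem dst_eq_top_of_one_vadd_le {i j : I} (h : (1 : ℤ) +ᵥ i ≤ j) : dst α i j = ⊤ := by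
  rw [← dst_add (I.lt_succ i).le h, dst_one_vadd, EReal.top_add_of_ne_bot (bot_lt_dst h).ne']

/-- Blocks: `κ` numbers the maximal subsets of `I` on which all distances are finite. -/
theorem exists_block_index (α : FSpace I) : ∃ (κ : I → ℤ) (c : I → ℝ), Function.Surjective κ ∧
    (∀ i j, κ i < κ j → dst α i j = ⊤) ∧
    ∀ i j, κ i = κ j → dst α i j = ((c i - c j : ℝ) : EReal) := by
  have := I.nonempty
  -- The relation that the distance exceeds -∞ is a total preorder coarser than ≤. It is locally
  -- finite: since a full period has infinite length, anything between i and j for this relation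
  -- lies between i - 1 and j + 1 in `I`.
  obtain ⟨κ, hκ, hle⟩ := exists_int_index (fun i j : I => ⊥ < dst α i j)
    (fun i => by simp [dst_self]) (fun i j k h₁ h₂ => (rel_dst i j k).bot_lt h₁ h₂)
    (fun i j => (I.total i j).imp bot_lt_dst bot_lt_dst)
    (fun i j => by
      obtain ⟨s, hs, h⟩ := I.exists_finite_reps ((-1 : ℤ) +ᵥ i) ((1 : ℤ) +ᵥ j)
      refine ⟨s, hs, fun k h₁ h₂ => ?_⟩
      have hk₁ : (-1 : ℤ) +ᵥ i ≤ k := (I.total _ _).resolve_right fun h => h₁.ne' (by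
        rw [dst_neg k i, dst_eq_top_of_one_vadd_le (by simpa [vadd_vadd] using I.vadd_le 1 h),
          EReal.neg_top])
      have hk₂ : k ≤ (1 : ℤ) +ᵥ j := (I.total _ _).resolve_right fun h => h₂.ne' (by
        rw [dst_neg j k, dst_eq_top_of_one_vadd_le h, EReal.neg_top])
      obtain ⟨l, hl, h₃, h₄⟩ := h k hk₁ hk₂
      exact ⟨l, hl, bot_lt_dst h₃, bot_lt_dst h₄⟩)
    (fun i => ⟨(1 : ℤ) +ᵥ i, by rw [dst_neg i, dst_one_vadd]; simp⟩)
    (fun i => ⟨(-1 : ℤ) +ᵥ i, by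
      rw [dst_neg _ i, dst_eq_top_of_one_vadd_le (by simp [vadd_vadd])]; simp⟩)
  obtain ⟨b, hb⟩ := hκ.hasRightInverse
  have hlt : ∀ i j, κ i < κ j → dst α i j = ⊤ := by
    intro i j h
    have := mt (hle j i).2 h.not_ge
    rw [not_bot_lt_iff, dst_neg i j, EReal.neg_eq_bot_iff] at this
    exact this
  have hreal : ∀ i j, κ i = κ j → ∃ r : ℝ, dst α i j = r := by
    intro i j h
    have h₁ := (hle i j).1 h.le
    have h₂ := (hle j i).1 h.ge
    rw [dst_neg i j, bot_lt_iff_ne_bot, Ne, EReal.neg_eq_bot_iff] at h₂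
    exact ⟨_, (EReal.coe_toReal h₂ h₁.ne').symm⟩
  -- The offset of i is its finite distance to the chosen representative of its block. The cocycle
  -- relation expresses distances within the block as differences of offsets.
  refine ⟨κ, fun i => (dst α i (b (κ i))).toReal, hκ, hlt, fun i j h => ?_⟩
  obtain ⟨r₁, h₁⟩ := hreal i (b (κ i)) (hb _).symm
  obtain ⟨r₂, h₂⟩ := hreal j (b (κ i)) (h.symm.trans (hb _).symm)
  obtain ⟨r, h₃⟩ := hreal i j h
  have := rel_dst (α := α) i j (b (κ i))
  rw [h₁, h₂, h₃, rel_coe_iff, ← EReal.coe_add, EReal.coe_eq_coe_iff] at this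
  simp only [← h]
  rw [h₁, h₂, h₃]
  simp only [EReal.toReal_coe, EReal.coe_eq_coe_iff]
  linarith

end Dst

/-! ### Points of the fibres -/

section Points

variable {I : PreordPara.{u}} {α : FSpace I}

/-- This form is symmetric in the indices and, apart from the two existence conditions, closed. -/
theorem mem_totalSet_iff {β : I → EReal} : (α, β) ∈ totalSet I ↔
    (∀ i j, Rel (β i) (dst α i j) (β j)) ∧ (∃ i, β i = ⊥) ∧ ∃ i, β i = ⊤ := by
  refine and_congr ?_ Iff.rfl
  constructor
  · intro h i j
    rcases I.total i j with hij | hij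
    · rw [dst_of_le hij]
      exact (triple_iff_rel (FSpace.bot_lt α hij)).1 (h i j hij)
    · rw [dst_neg j i]
      apply rel_symm
      rw [dst_of_le hij]
      exact (triple_iff_rel (FSpace.bot_lt α hij)).1 (h j i hij)
  · intro h i j hij
    refine (triple_iff_rel (FSpace.bot_lt α hij)).2 ?_
    have := h i j
    rwa [dst_of_le hij] at this

theorem universalBeta_mem (α : FSpace I) (i : I) : (α, universalBeta α i) ∈ totalSet I := by
  refine mem_totalSet_iff.2 ⟨fun j k => rel_dst j k i, ⟨(1 : ℤ) +ᵥ i, ?_⟩, ⟨(-1 : ℤ) +ᵥ i, ?_⟩⟩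
  · change dst α _ i = ⊥
    rw [dst_neg i, dst_one_vadd, EReal.neg_top]
  · exact dst_eq_top_of_one_vadd_le (by simp [vadd_vadd])

end Points

/-! ### Coordinates on the total space -/

section Coord

variable {I : PreordPara.{u}}

/-- A point of the base of the universal family, as a point of `F^(I)`. -/
def basePt (α : (universalSpace I).base) : FSpace I := α

/-- The coordinates `β` of a point `(α,β)`. -/
def coord (x : (universalSpace I).total) (i : I) : EReal := x.1.2 i

/-- The point `(α,β)` of the total space. -/
def mkPoint (α : FSpace I) (β : I → EReal) (h : (α, β) ∈ totalSet I) : (universalSpace I).total :=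
  ⟨(α, β), h⟩

theorem coord_vadd (g : ℤ × ℝ) (x : (universalSpace I).total) (i : I) :
    coord (g +ᵥ x) i = coord x ((-g.1) +ᵥ i) + (g.2 : EReal) := rfl

theorem coord_real_vadd (t : ℝ) (x : (universalSpace I).total) (i : I) :
    coord (((0 : ℤ), t) +ᵥ x) i = coord x i + (t : EReal) := by
  rw [coord_vadd]; simp

theorem coord_int_vadd (n : ℤ) (x : (universalSpace I).total) (i : I) :
    coord ((n, (0 : ℝ)) +ᵥ x) i = coord x ((-n) +ᵥ i) := by
  rw [coord_vadd]; simp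

theorem total_ext {x y : (universalSpace I).total}
    (h : (universalSpace I).proj x = (universalSpace I).proj y)
    (h' : ∀ i, coord x i = coord y i) : x = y :=
  Subtype.ext (Prod.ext h (funext h'))

theorem rel_coord (x : (universalSpace I).total) (i j : I) :
    Rel (coord x i) (dst (basePt ((universalSpace I).proj x)) i j) (coord x j) :=
  (mem_totalSet_iff.1 x.2).1 i j

theorem exists_coord_bot (x : (universalSpace I).total) : ∃ i, coord x i = ⊥ := x.2.2.1

theorem exists_coord_top (x : (universalSpace I).total) : ∃ i, coord x i = ⊤ := x.2.2.2

theorem continuous_coord (i : I) : Continuous fun x : (universalSpace I).total => coord x i :=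
  (continuous_apply i).comp (continuous_snd.comp continuous_subtype_val)

theorem isInducing_proj_coord : Topology.IsInducing fun x : (universalSpace I).total =>
    ((universalSpace I).proj x, coord x) :=
  Topology.IsInducing.subtypeVal

theorem continuous_dst (i j : I) : Continuous fun α : FSpace I => dst α i j := by
  rcases I.total i j with h | h
  · have : (fun α : FSpace I => dst α i j) = fun α : FSpace I => FSpace.val α h :=
      funext fun α => dst_of_le h
    rw [this]
    exact continuous_subtype_val.comp ((continuous_apply _).comp continuous_subtype_val)
  · have : (fun α : FSpace I => dst α i j) = fun α : FSpace I => -FSpace.val α h :=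
      funext fun α => by rw [dst_neg j i, dst_of_le h]
    rw [this]
    exact (continuous_subtype_val.comp ((continuous_apply _).comp continuous_subtype_val)).neg

theorem coord_antitone (x : (universalSpace I).total) {i j : I} (h : i ≤ j) :
    (coord x i = ⊥ → coord x j = ⊥) ∧ (coord x j = ⊤ → coord x i = ⊤) :=
  ⟨totalSet_bot x.2 h, totalSet_top x.2 h⟩

theorem coord_eq_of_dst_top (x : (universalSpace I).total) {i j : I}
    (h : dst (basePt ((universalSpace I).proj x)) i j = ⊤) : coord x i = ⊤ ∨ coord x j = ⊥ := by
  have := rel_coord x i j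
  rwa [h, rel_top_iff] at this

theorem mem_fixedPts_universal_iff {x : (universalSpace I).total} :
    x ∈ fixedPts (universalSpace I).total ↔ ∀ i, coord x i = ⊤ ∨ coord x i = ⊥ := by
  constructor
  · intro h i
    have h₁ := coord_real_vadd 1 x i
    rw [h 1] at h₁
    revert h₁
    generalize coord x i = y
    intro h₁
    induction y with
    | bot => exact Or.inr rfl
    | top => exact Or.inl rfl
    | coe y =>
      norm_cast at h₁
      linarith
  · intro h t
    refine total_ext ((universalSpace I).proj_vadd _ _) fun i => ?_
    rw [coord_real_vadd]
    rcases h i with h | h <;> simp [h]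

end Coord

/-! ### The fibres of the universal family -/

/-- A continuous parametrization by `ℝ` which is strictly increasing with respect to a family of
continuous coordinates is a homeomorphism. -/
theorem exists_homeo_of_strictMono {X J : Type u} [TopologicalSpace X] (c : J → X → EReal)
    (hc : ∀ i, Continuous (c i)) (ψ : ℝ → X) (hψ : Continuous ψ) (hs : Function.Surjective ψ)
    (hmono : ∀ a b, a ≤ b → ∀ i, c i (ψ a) ≤ c i (ψ b))
    (hstrict : ∀ a b, a < b → ∃ i, c i (ψ a) < c i (ψ b)) :
    ∃ φ : X ≃ₜ ℝ, ∀ x y, φ x ≤ φ y ↔ ∀ i, c i x ≤ c i y := by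
  have hiff : ∀ a b, a ≤ b ↔ ∀ i, c i (ψ a) ≤ c i (ψ b) := by
    refine fun a b => ⟨hmono a b, fun h => ?_⟩
    by_contra hn
    obtain ⟨i, hi⟩ := hstrict b a (not_le.1 hn)
    exact absurd (h i) hi.not_ge
  have hinj : Function.Injective ψ := fun a b h =>
    le_antisymm ((hiff a b).2 fun i => by rw [h]) ((hiff b a).2 fun i => by rw [h])
  let e := (Equiv.ofBijective ψ ⟨hinj, hs⟩).symm
  have he : ∀ x, ψ (e x) = x := fun x => (Equiv.ofBijective ψ ⟨hinj, hs⟩).apply_symm_apply x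
  -- Continuity of the inverse: a strict inequality between parameters is witnessed by some
  -- coordinate, and persists where that coordinate keeps its strict inequality.
  have hcont : Continuous e := by
    refine continuous_iff_continuousAt.2 fun x => tendsto_order.2 ⟨fun a ha => ?_, fun a ha => ?_⟩
    · obtain ⟨i, hi⟩ := hstrict _ _ ha
      rw [he] at hi
      filter_upwards [(isOpen_lt continuous_const (hc i)).mem_nhds hi] with y hy
      by_contra hn
      have := hmono _ _ (not_lt.1 hn) i
      rw [he] at this
      exact absurd hy this.not_gt
    · obtain ⟨i, hi⟩ := hstrict _ _ ha
      rw [he] at hi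
      filter_upwards [(isOpen_lt (hc i) continuous_const).mem_nhds hi] with y hy
      by_contra hn
      have := hmono _ _ (not_lt.1 hn) i
      rw [he] at this
      exact absurd hy this.not_gt
  refine ⟨⟨e, hcont, hψ⟩, fun x y => ?_⟩
  change e x ≤ e y ↔ _
  rw [hiff, he, he]

/-- An order isomorphism from the extended reals to the unit interval. -/
def unitIso : EReal ≃o Set.Icc (0 : ℝ) 1 :=
  EReal.expOrderIso.trans ENNReal.orderIsoUnitIntervalBirational

/-- A continuous monotone map `ℝ → [-∞,∞]` which is `-∞` on `(-∞,0]` and `∞` on `[1,∞)`. -/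
def stretch (x : ℝ) : EReal := unitIso.symm (Set.projIcc 0 1 zero_le_one x)

theorem continuous_stretch : Continuous stretch :=
  unitIso.symm.continuous.comp continuous_projIcc

theorem monotone_stretch : Monotone stretch :=
  unitIso.symm.monotone.comp (Set.monotone_projIcc _)

theorem stretch_of_nonpos {x : ℝ} (h : x ≤ 0) : stretch x = ⊥ := by
  rw [stretch, Set.projIcc_of_le_left _ h]
  exact unitIso.symm.map_bot

theorem stretch_of_one_le {x : ℝ} (h : 1 ≤ x) : stretch x = ⊤ := by
  rw [stretch, Set.projIcc_of_right_le _ h]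
  exact unitIso.symm.map_top

theorem stretch_unitIso (y : EReal) : stretch (unitIso y) = y := by
  rw [stretch, Set.projIcc_val, unitIso.symm_apply_apply]

theorem stretch_lt_stretch {x y : ℝ} (hx₀ : 0 ≤ x) (hx₁ : x < 1) (h : x < y) :
    stretch x < stretch y := by
  refine unitIso.symm.lt_iff_lt.2 ?_
  rw [← Subtype.coe_lt_coe, Set.coe_projIcc, Set.coe_projIcc, min_eq_right hx₁.le,
    max_eq_right hx₀]
  exact lt_max_of_lt_right (lt_min hx₁ h)

theorem continuous_add_of_real {X : Type*} [TopologicalSpace X] {f g : X → EReal}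
    (hf : Continuous f) (hg : Continuous g) (h : ∀ x, g x ≠ ⊤ ∧ g x ≠ ⊥) :
    Continuous fun x => f x + g x := by
  refine continuous_iff_continuousAt.2 fun x => ?_
  exact (EReal.continuousAt_add (p := (f x, g x)) (Or.inr (h x).2) (Or.inr (h x).1)).comp
    (f := fun x => (f x, g x)) (by fun_prop)

section Fibers

variable {I : PreordPara.{u}}

/-- While the parameter runs through [k, k+1], the coordinates of block k run from -∞ to ∞, shifted
by their offsets, lower blocks are at ∞ and higher blocks at -∞. The infinite distance between
different blocks forces every point of the fibre to have this shape. -/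
theorem exists_fiber_homeo (α : (universalSpace I).base) : ∃ φ : (universalSpace I).Fiber α ≃ₜ ℝ,
    ∀ x y, φ x ≤ φ y ↔ ∀ i, coord x.1 i ≤ coord y.1 i := by
  obtain ⟨κ, c, hκ, hlt, heq⟩ := exists_block_index (basePt α)
  let β : ℝ → I → EReal := fun x i => stretch (x - κ i) + (c i : EReal)
  have htop : ∀ {x : ℝ} {i : I}, 1 ≤ x - κ i → β x i = ⊤ := fun h => by
    simp [β, stretch_of_one_le h]
  have hbot : ∀ {x : ℝ} {i : I}, x - κ i ≤ 0 → β x i = ⊥ := fun h => by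
    simp [β, stretch_of_nonpos h]
  have hlt' : ∀ x i j, κ i < κ j → Rel (β x i) (dst (basePt α) i j) (β x j) := by
    intro x i j h
    rw [hlt i j h, rel_top_iff]
    have h' : (κ i : ℝ) + 1 ≤ κ j := by exact_mod_cast h
    rcases le_total 1 (x - κ i) with hx | hx
    · exact Or.inl (htop hx)
    · exact Or.inr (hbot (by linarith))
  have hmem : ∀ x, (basePt α, β x) ∈ totalSet I := by
    intro x
    refine mem_totalSet_iff.2 ⟨fun i j => ?_, ?_, ?_⟩
    · rcases lt_trichotomy (κ i) (κ j) with h | h | h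
      · exact hlt' x i j h
      · rw [heq i j h, rel_coe_iff]
        simp only [β, h]
        generalize stretch (x - κ j) = y
        induction y with
        | bot => simp
        | top => simp [-EReal.coe_sub]
        | coe y =>
          norm_cast
          ring
      · rw [dst_neg j i]
        exact rel_symm (hlt' x j i h)
    · obtain ⟨i, hi⟩ := hκ ⌈x⌉
      exact ⟨i, hbot (by rw [hi]; linarith [Int.le_ceil x])⟩
    · obtain ⟨i, hi⟩ := hκ (⌊x⌋ - 1)
      refine ⟨i, htop ?_⟩
      rw [hi]
      push_cast
      linarith [Int.floor_le x]
  let ψ : ℝ → (universalSpace I).Fiber α := fun x =>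
    (universalSpace I).toFiber (mkPoint (basePt α) (β x) (hmem x)) rfl
  refine exists_homeo_of_strictMono (fun i (x : (universalSpace I).Fiber α) => coord x.1 i)
    (fun i => (continuous_coord i).comp continuous_subtype_val) ψ ?_ ?_ ?_ ?_
  · refine Continuous.subtype_mk (Continuous.subtype_mk (continuous_const.prodMk ?_) _) _
    refine continuous_pi fun i => continuous_add_of_real
      (continuous_stretch.comp (by fun_prop)) continuous_const
      fun _ => ⟨EReal.coe_ne_top _, EReal.coe_ne_bot _⟩
  · rintro ⟨x, hx⟩
    have hrel : ∀ i j, Rel (coord x i) (dst (basePt α) i j) (coord x j) := by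
      have := rel_coord x
      rwa [show (universalSpace I).proj x = α from hx] at this
    have hlt₂ : ∀ i j, κ i < κ j → coord x i = ⊤ ∨ coord x j = ⊥ := fun i j h => by
      have := hrel i j
      rwa [hlt i j h, rel_top_iff] at this
    -- The integer part of the parameter is the last block that is not at -∞. One coordinate in this
    -- block determines the position inside the unit interval.
    obtain ⟨k, ⟨i₀, hk, hi₀⟩, hmax⟩ := Int.exists_greatest_of_bdd
      (P := fun k => ∃ i, κ i = k ∧ coord x i ≠ ⊥)
      (by
        obtain ⟨j, hj⟩ := exists_coord_bot x
        obtain ⟨l, hl⟩ := hκ (κ j + 1)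
        refine ⟨κ j, ?_⟩
        rintro _ ⟨i, rfl, hi⟩
        by_contra hn
        rcases hlt₂ j i (not_le.1 hn) with h | h
        · rw [hj] at h
          exact bot_ne_top h
        · exact hi h)
      (by
        obtain ⟨j, hj⟩ := exists_coord_top x
        exact ⟨κ j, j, rfl, by rw [hj]; exact top_ne_bot⟩)
    refine ⟨k + unitIso (coord x i₀ + ((-c i₀ : ℝ) : EReal)), Subtype.ext
      (total_ext (I := I) hx.symm fun i => ?_)⟩
    set y : Set.Icc (0 : ℝ) 1 := unitIso (coord x i₀ + ((-c i₀ : ℝ) : EReal)) with hy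
    change β (k + y) i = coord x i
    rcases lt_trichotomy (κ i) k with h | h | h
    · rw [(hlt₂ i i₀ (hk.symm ▸ h)).resolve_right hi₀]
      refine htop ?_
      have : (κ i : ℝ) + 1 ≤ k := by exact_mod_cast h
      linarith [y.2.1]
    · have h₁ := hrel i i₀
      rw [heq i i₀ (h.trans hk.symm), rel_coe_iff] at h₁
      rw [h₁]
      simp only [β, h, add_sub_cancel_left, hy, stretch_unitIso]
      generalize coord x i₀ = z
      induction z with
      | bot => simp
      | top => simp [-EReal.coe_sub, -EReal.coe_neg]
      | coe z =>
        norm_cast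
        ring
    · have : coord x i = ⊥ := by
        by_contra hn
        exact absurd (hmax _ ⟨i, rfl, hn⟩) h.not_ge
      rw [this]
      refine hbot ?_
      have : (k : ℝ) + 1 ≤ κ i := by exact_mod_cast h
      linarith [y.2.2]
  · intro a b hab i
    change stretch (a - κ i) + (c i : EReal) ≤ stretch (b - κ i) + (c i : EReal)
    gcongr
    exact monotone_stretch (by linarith)
  · intro a b hab
    obtain ⟨i, hi⟩ := hκ ⌊a⌋
    refine ⟨i, ?_⟩
    change stretch (a - κ i) + (c i : EReal) < stretch (b - κ i) + (c i : EReal)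
    refine EReal.add_lt_add_right_coe (stretch_lt_stretch ?_ ?_ ?_) _
    · rw [hi]; linarith [Int.floor_le a]
    · rw [hi]; linarith [Int.lt_floor_add_one a]
    · linarith

/-- The value at `(α,i)` of the universal section, as a point of the fibre. -/
def secPoint (α : (universalSpace I).base) (i : I) : (universalSpace I).Fiber α :=
  (universalSpace I).toFiber (mkPoint (basePt α) (universalBeta (basePt α) i) (universalBeta_mem (basePt α) i)) rfl

theorem coord_secPoint (α : (universalSpace I).base) (i j : I) :
    coord (secPoint α i).1 j = dst (basePt α) j i := rfl

theorem secPoint_not_fixed (α : (universalSpace I).base) (i : I) :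
    secPoint α i ∉ fixedPts ((universalSpace I).Fiber α) := by
  intro h
  have := mem_fixedPts_universal_iff.1
    ((ZRSpaceOver.mem_fixedPts_fiber_iff (P := universalSpace I) _).1 h) i
  rw [coord_secPoint, dst_self] at this
  simp at this

theorem universal_isDirectedHomeo {α : (universalSpace I).base} {φ : (universalSpace I).Fiber α ≃ₜ ℝ}
    (hφ : ∀ x y, φ x ≤ φ y ↔ ∀ i, coord x.1 i ≤ coord y.1 i) : IsDirectedHomeo φ := by
  intro t ht x
  rw [hφ]
  intro i
  refine le_of_le_of_eq ?_ (coord_real_vadd t x.1 i).symm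
  exact le_add_of_nonneg_right (EReal.coe_nonneg.2 ht)

theorem universal_leL_iff {α : (universalSpace I).base} (x y : (universalSpace I).Fiber α) :
    leL x y ↔ ∀ i, coord x.1 i ≤ coord y.1 i := by
  obtain ⟨φ, hφ⟩ := exists_fiber_homeo α
  have hd := universal_isDirectedHomeo hφ
  obtain ⟨i⟩ := I.nonempty
  rw [hd.leL_iff_of_not_fixed (secPoint_not_fixed α i), hφ]

theorem coord_le_int_vadd (x : (universalSpace I).total) {n : ℤ} (hn : 1 ≤ n) (i : I) :
    coord x i ≤ coord ((n, (0 : ℝ)) +ᵥ x) i := by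
  rw [coord_int_vadd]
  have h : dst (basePt ((universalSpace I).proj x)) ((-n) +ᵥ i) i = ⊤ := by
    refine dst_eq_top_of_one_vadd_le ?_
    rw [vadd_vadd]
    have := (I.strictMono_vadd i).monotone (show 1 + -n ≤ 0 by omega)
    simpa using this
  rcases coord_eq_of_dst_top x h with h | h
  · rw [h]; exact le_top
  · rw [h]; exact bot_le

/-- A nonzero period n of the coordinates would carry an index with value -∞ below an index with
value ∞, against their monotonicity. -/
theorem universal_free (n : ℤ) (x : (universalSpace I).total) (h : (n, (0 : ℝ)) +ᵥ x = x) :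
    n = 0 := by
  by_contra hn
  wlog hpos : 0 < n generalizing n
  · refine this (-n) ?_ (by omega) (by omega)
    conv_lhs => rw [← h]
    rw [int_vadd_vadd, neg_add_cancel, real_zero_vadd]
  have hk : ∀ k : ℕ, (((k : ℤ) * n, (0 : ℝ)) : ℤ × ℝ) +ᵥ x = x := by
    intro k
    induction k with
    | zero => simpa using real_zero_vadd x
    | succ k ih =>
      rw [show ((k + 1 : ℕ) : ℤ) * n = n + k * n by push_cast; ring, ← int_vadd_vadd, ih, h]
  obtain ⟨i, hi⟩ := exists_coord_top x
  obtain ⟨j, hj⟩ := exists_coord_bot x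
  obtain ⟨N, hN⟩ := I.exists_neg_nat_vadd_le j i
  have h₁ : (-((N : ℤ) * n)) +ᵥ j ≤ i := by
    refine le_trans ((I.strictMono_vadd j).monotone ?_) hN
    nlinarith [Int.natCast_nonneg N]
  have h₂ := coord_int_vadd ((N : ℤ) * n) x j
  rw [hk, hj] at h₂
  have h₃ := (coord_antitone x h₁).1 h₂.symm
  rw [hi] at h₃
  exact top_ne_bot h₃

theorem universal_continuousVAdd : ContinuousVAdd (ℤ × ℝ) (universalSpace I).total := by
  refine ⟨isInducing_proj_coord.continuous_iff.2 (Continuous.prodMk ?_ (continuous_pi fun i => ?_))⟩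
  · have h : (fun p : (ℤ × ℝ) × (universalSpace I).total => (universalSpace I).proj (p.1 +ᵥ p.2)) =
        fun p => (universalSpace I).proj p.2 :=
      funext fun p => (universalSpace I).proj_vadd _ _
    rw [h]
    exact (universalSpace I).proj.hom.continuous.comp continuous_snd
  · change Continuous fun p : (ℤ × ℝ) × (universalSpace I).total =>
      coord p.2 ((-p.1.1) +ᵥ i) + (p.1.2 : EReal)
    refine continuous_add_of_real ?_ (continuous_coe_real_ereal.comp (by fun_prop))
      (fun p => ⟨EReal.coe_ne_top _, EReal.coe_ne_bot _⟩)
    have h : Continuous fun p : ℤ × (universalSpace I).total => coord p.2 ((-p.1) +ᵥ i) :=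
      continuous_prod_of_discrete_left.2 fun n => continuous_coord ((-n) +ᵥ i)
    exact h.comp (f := fun p : (ℤ × ℝ) × (universalSpace I).total => (p.1.1, p.2)) (by fun_prop)

theorem fiber_continuousVAdd {P : ZRSpaceOver.{u}} [ContinuousVAdd (ℤ × ℝ) P.total]
    (s : P.base) : ContinuousVAdd (ℤ × ℝ) (P.Fiber s) := by
  refine ⟨Continuous.subtype_mk ?_ _⟩
  exact continuous_fst.vadd (continuous_subtype_val.comp continuous_snd)

theorem PreordPara.exists_index (I : PreordPara.{u}) :
    ∃ ρ : I → ℤ, Function.Surjective ρ ∧ ∀ i j, ρ i ≤ ρ j ↔ i ≤ j := by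
  have := I.nonempty
  refine exists_int_index (fun i j : I => i ≤ j) (fun _ => le_rfl) (fun _ _ _ h₁ h₂ => h₁.trans h₂)
    I.total I.exists_finite_reps (fun i => ⟨(1 : ℤ) +ᵥ i, (I.lt_succ i).not_ge⟩)
    (fun i => ⟨(-1 : ℤ) +ᵥ i, ?_⟩)
  have := (I.lt_succ ((-1 : ℤ) +ᵥ i)).not_ge
  simpa [vadd_vadd] using this

/-- A fixed point is a cut of `I`, given by two consecutive classes. -/
theorem exists_cut {x : (universalSpace I).total} (hx : x ∈ fixedPts (universalSpace I).total) :
    ∃ i j, coord x i = ⊤ ∧ coord x j = ⊥ ∧ ∀ k, k ≤ i ∨ j ≤ k := by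
  rw [mem_fixedPts_universal_iff] at hx
  obtain ⟨ρ, hρ, hle⟩ := I.exists_index
  obtain ⟨m, ⟨i, rfl, hi⟩, hmax⟩ := Int.exists_greatest_of_bdd
    (P := fun k => ∃ i, ρ i = k ∧ coord x i = ⊤)
    (by
      obtain ⟨j, hj⟩ := exists_coord_bot x
      refine ⟨ρ j, ?_⟩
      rintro _ ⟨i, rfl, hi⟩
      rw [hle]
      refine (I.total _ _).resolve_right fun h => ?_
      rw [(coord_antitone x h).1 hj] at hi
      exact bot_ne_top hi)
    (by
      obtain ⟨j, hj⟩ := exists_coord_top x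
      exact ⟨ρ j, j, rfl, hj⟩)
  obtain ⟨j, hj⟩ := hρ (ρ i + 1)
  refine ⟨i, j, hi, (hx j).resolve_left fun h => ?_, fun k => ?_⟩
  · have := hmax _ ⟨j, rfl, h⟩
    omega
  · rw [← hle, ← hle]
    omega

theorem coord_eq_of_cut {x y : (universalSpace I).total} {i j : I} (hxi : coord x i = ⊤)
    (hxj : coord x j = ⊥) (hyi : coord y i = ⊤) (hyj : coord y j = ⊥)
    (hij : ∀ k, k ≤ i ∨ j ≤ k) (k : I) : coord x k = coord y k := by
  rcases hij k with h | h
  · rw [(coord_antitone x h).2 hxi, (coord_antitone y h).2 hyi]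
  · rw [(coord_antitone x h).1 hxj, (coord_antitone y h).1 hyj]

open Classical in
/-- The function on `I` which is `∞` on `D` and `-∞` elsewhere. -/
def cutBeta (D : Set I) (k : I) : EReal := if k ∈ D then ⊤ else ⊥

/-- A cut of `I` gives a point of the fibre as soon as all distances across it are infinite. -/
theorem cutBeta_mem {α : FSpace I} {D : Set I} (hD : ∀ i ∈ D, ∀ j ∉ D, dst α i j = ⊤)
    (hne : D.Nonempty) (hne' : Dᶜ.Nonempty) : (α, cutBeta D) ∈ totalSet I := by
  obtain ⟨a, ha⟩ := hne
  obtain ⟨b, hb⟩ := hne'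
  refine mem_totalSet_iff.2 ⟨fun i j => ?_, ⟨b, if_neg hb⟩, ⟨a, if_pos ha⟩⟩
  by_cases hi : i ∈ D <;> by_cases hj : j ∈ D <;> simp only [cutBeta, hi, hj, if_true, if_false]
  · intro a b
    exact ⟨fun h => not_top_lt h.1, fun h => not_top_lt h.2.1⟩
  · rw [hD i hi j hj, rel_top_iff]
    exact Or.inl rfl
  · rw [dst_neg j i, hD j hj i hi]
    apply rel_symm
    rw [rel_top_iff]
    exact Or.inl rfl
  · intro a b
    exact ⟨fun h => not_lt_bot h.2.1, fun h => not_lt_bot h.1⟩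

theorem universal_isBrokenParacycle (α : (universalSpace I).base) :
    IsBrokenParacycle ((universalSpace I).Fiber α) where
  continuous_action := by
    have := universal_continuousVAdd (I := I)
    exact fiber_continuousVAdd _
  homeo := (exists_fiber_homeo α).nonempty
  free n x h := universal_free n x.1 (congrArg Subtype.val h)
  directed := by
    obtain ⟨φ, hφ⟩ := exists_fiber_homeo α
    exact ⟨φ, universal_isDirectedHomeo hφ⟩
  compatibly_directed x := (universal_leL_iff _ _).2 (coord_le_int_vadd x.1 le_rfl)
  discrete := by
    rw [discreteTopology_iff_isOpen_singleton]
    rintro ⟨x, hx⟩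
    obtain ⟨i, j, hi, hj, hij⟩ := exists_cut ((ZRSpaceOver.mem_fixedPts_fiber_iff x).1 hx)
    have hc : ∀ k, Continuous fun y : fixedPts ((universalSpace I).Fiber α) => coord y.1.1 k :=
      fun k => (continuous_coord k).comp (continuous_subtype_val.comp continuous_subtype_val)
    -- The indices i and j belong to consecutive classes on either side of the cut, so a fixed point
    -- with β_i > 0 and β_j < 0 has the same cut as x.
    have hopen := (isOpen_lt (continuous_const (y := (0 : EReal))) (hc i)).inter
      (isOpen_lt (hc j) (continuous_const (y := (0 : EReal))))
    convert hopen using 1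
    refine Set.ext fun y => ⟨?_, ?_⟩
    · rintro rfl
      refine ⟨?_, ?_⟩
      · change 0 < coord x.1 i
        rw [hi]; exact EReal.zero_lt_top
      · change coord x.1 j < 0
        rw [hj]; exact EReal.bot_lt_zero
    · rintro ⟨h₁, h₂⟩
      have hy := mem_fixedPts_universal_iff.1 ((ZRSpaceOver.mem_fixedPts_fiber_iff y.1).1 y.2)
      have h₁' : coord y.1.1 i = ⊤ := (hy i).resolve_right fun h => by
        change 0 < coord y.1.1 i at h₁
        rw [h] at h₁; exact not_lt_bot h₁
      have h₂' : coord y.1.1 j = ⊥ := (hy j).resolve_left fun h => by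
        change coord y.1.1 j < 0 at h₂
        rw [h] at h₂; exact not_top_lt h₂
      refine Subtype.ext (Subtype.ext (total_ext (y.1.2.trans x.2.symm) fun k => ?_))
      exact coord_eq_of_cut h₁' h₂' hi hj hij k
  nonempty := by
    -- The cut between blocks 0 and 1 provides a fixed point.
    obtain ⟨κ, c, hκ, hlt, -⟩ := exists_block_index (basePt α)
    obtain ⟨a, ha⟩ := hκ 0
    obtain ⟨b, hb⟩ := hκ 1
    have hmem := cutBeta_mem (α := basePt α) (D := {i | κ i ≤ 0})
      (fun i hi j hj => hlt i j (lt_of_le_of_lt hi (not_le.1 hj))) ⟨a, ha.le⟩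
      ⟨b, by change ¬ κ b ≤ 0; omega⟩
    refine ⟨(universalSpace I).toFiber (mkPoint (basePt α) _ hmem) rfl, ?_⟩
    rw [ZRSpaceOver.mem_fixedPts_fiber_iff, mem_fixedPts_universal_iff]
    intro i
    change cutBeta _ i = ⊤ ∨ cutBeta _ i = ⊥
    unfold cutBeta
    split_ifs
    · exact Or.inl rfl
    · exact Or.inr rfl

end Fibers

/-! ### The universal family is a family of broken paracycles -/

section UniversalFamily

variable {I : PreordPara.{u}}

theorem coord_eq_add {x : (universalSpace I).total} {i : I} {t : ℝ} (h : coord x i = t) (j : I) :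
    coord x j = dst (basePt ((universalSpace I).proj x)) j i + t := by
  have hr := rel_coord x j i
  rw [h] at hr
  rw [add_comm]
  exact le_antisymm (hr.le_coe_add le_rfl) (hr.coe_add_le le_rfl)

/-- One finite coordinate determines all the others. So every non-fixed point lies on the orbit of a
value of the universal section, which yields both local lifting and surjectivity on orbits. -/
theorem eq_vadd_secPoint {α : (universalSpace I).base} {x : (universalSpace I).total}
    (hx : (universalSpace I).proj x = α) {i : I} {t : ℝ} (h : coord x i = t) :
    x = ((0 : ℤ), t) +ᵥ (secPoint α i).1 := by
  subst hx
  refine total_ext ((universalSpace I).proj_vadd ((0 : ℤ), t) _).symm fun j => ?_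
  rw [coord_eq_add h, coord_real_vadd, coord_secPoint]

theorem exists_coord_real {x : (universalSpace I).total}
    (hx : x ∉ fixedPts (universalSpace I).total) : ∃ (i : I) (t : ℝ), coord x i = t := by
  rw [mem_fixedPts_universal_iff] at hx
  push Not at hx
  obtain ⟨i, h₁, h₂⟩ := hx
  exact ⟨i, _, (EReal.coe_toReal h₁ h₂).symm⟩

theorem continuous_secPoint (i : I) : Continuous fun α : (universalSpace I).base => (secPoint α i).1 := by
  refine isInducing_proj_coord.continuous_iff.2 (Continuous.prodMk continuous_id ?_)
  exact continuous_pi fun j => continuous_dst j i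

theorem universal_separated : IsClosed {p : {p : (universalSpace I).total × (universalSpace I).total
      // (universalSpace I).proj p.1 = (universalSpace I).proj p.2} |
    leL ((universalSpace I).toFiber p.1.1 p.2) ((universalSpace I).toFiber p.1.2 rfl)} := by
  have : {p : {p : (universalSpace I).total × (universalSpace I).total
      // (universalSpace I).proj p.1 = (universalSpace I).proj p.2} |
      leL ((universalSpace I).toFiber p.1.1 p.2) ((universalSpace I).toFiber p.1.2 rfl)} =
      ⋂ i : I, {p | coord p.1.1 i ≤ coord p.1.2 i} := by
    ext p
    rw [Set.mem_iInter]
    exact universal_leL_iff _ _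
  rw [this]
  refine isClosed_iInter fun i => isClosed_le ?_ ?_
  · exact (continuous_coord i).comp (continuous_fst.comp continuous_subtype_val)
  · exact (continuous_coord i).comp (continuous_snd.comp continuous_subtype_val)

/-- Every point has a translate in the compact region `β_{i-1} = ∞`, `β_{i+1} = -∞`. -/
theorem exists_translate_mem_region (i : I) (x : (universalSpace I).total) : ∃ n : ℤ,
    coord ((n, (0 : ℝ)) +ᵥ x) ((-1 : ℤ) +ᵥ i) = ⊤ ∧ coord ((n, (0 : ℝ)) +ᵥ x) ((1 : ℤ) +ᵥ i) = ⊥ := by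
  -- The index m + i is the last translate of i whose coordinate is not -∞. Its distance from m - 1
  -- + i is infinite, so the coordinate at m - 1 + i must be ∞.
  obtain ⟨m, hm, hmax⟩ := Int.exists_greatest_of_bdd (P := fun n => coord x (n +ᵥ i) ≠ ⊥)
    (by
      obtain ⟨j, hj⟩ := exists_coord_bot x
      obtain ⟨N, hN⟩ := I.exists_le_nat_vadd i j
      refine ⟨N, fun n hn => ?_⟩
      by_contra hlt
      exact hn ((coord_antitone x (hN.trans
        ((I.strictMono_vadd i).monotone (not_le.1 hlt).le))).1 hj))
    (by
      obtain ⟨j, hj⟩ := exists_coord_top x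
      obtain ⟨N, hN⟩ := I.exists_neg_nat_vadd_le i j
      refine ⟨-N, ?_⟩
      rw [(coord_antitone x hN).2 hj]
      exact top_ne_bot)
  refine ⟨-m, ?_, ?_⟩
  · rw [coord_int_vadd, neg_neg]
    refine (coord_eq_of_dst_top x (j := m +ᵥ i) ?_).resolve_right hm
    refine dst_eq_top_of_one_vadd_le (le_of_eq ?_)
    rw [vadd_vadd, vadd_vadd]
    congr 1
    ring
  · rw [coord_int_vadd, neg_neg, vadd_vadd]
    by_contra hn
    have := hmax _ hn
    omega

/-- The region β_{i-1} = ∞, β_{i+1} = -∞ meets every `ℤ`-orbit. On it both infinite values are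
attained automatically, so it is closed in the whole product of `F^(I)` with [-∞,∞]^I. Projecting
away the compact factor is a closed map. -/
theorem universal_quotient_closed : IsClosedMap (universalSpace I).quotProj := by
  intro C hC
  obtain ⟨i⟩ := I.nonempty
  obtain ⟨D, hD, hDC⟩ := isClosed_induced_iff.1 (hC.preimage continuous_mk)
  have hDC' : ∀ x : (universalSpace I).total, x.1 ∈ D ↔ Quotient.mk (zSetoid _) x ∈ C :=
    fun x => Set.ext_iff.1 hDC x
  let Z : Set (FSpace I × (I → EReal)) :=
    (⋂ (j : I) (k : I), {p | Rel (p.2 j) (dst p.1 j k) (p.2 k)}) ∩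
      ({p | p.2 ((-1 : ℤ) +ᵥ i) = ⊤} ∩ {p | p.2 ((1 : ℤ) +ᵥ i) = ⊥})
  have hcoord : ∀ k : I, Continuous fun p : FSpace I × (I → EReal) => p.2 k := fun k =>
    (continuous_apply k).comp continuous_snd
  have hZ : IsClosed Z := by
    refine IsClosed.inter (isClosed_iInter fun j => isClosed_iInter fun k => ?_)
      ((isClosed_eq (hcoord _) continuous_const).inter (isClosed_eq (hcoord _) continuous_const))
    exact isClosed_rel.preimage ((hcoord j).prodMk
      (((continuous_dst j k).comp continuous_fst).prodMk (hcoord k)))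
  have hZt : ∀ p ∈ Z, p ∈ totalSet I := fun p hp =>
    mem_totalSet_iff.2 ⟨fun j k => Set.mem_iInter.1 (Set.mem_iInter.1 hp.1 j) k,
      ⟨_, hp.2.2⟩, ⟨_, hp.2.1⟩⟩
  have himage : (universalSpace I).quotProj '' C = Prod.fst '' (Z ∩ D) := by
    refine Set.ext fun α => ⟨?_, ?_⟩
    · rintro ⟨q, hq, rfl⟩
      induction q using Quotient.inductionOn with | _ x => ?_
      obtain ⟨n, h₁, h₂⟩ := exists_translate_mem_region i x
      refine ⟨((n, (0 : ℝ)) +ᵥ x : (universalSpace I).total).1, ⟨⟨?_, h₁, h₂⟩, ?_⟩, ?_⟩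
      · exact Set.mem_iInter.2 fun j => Set.mem_iInter.2 fun k => rel_coord _ j k
      · rw [hDC', ← mk_eq_mk_iff.2 ⟨n, rfl⟩]
        exact hq
      · exact (universalSpace I).proj_vadd (n, (0 : ℝ)) x
    · rintro ⟨p, ⟨hp, hpD⟩, rfl⟩
      exact ⟨Quotient.mk (zSetoid _) ⟨p, hZt p hp⟩, (hDC' ⟨p, hZt p hp⟩).1 hpD, rfl⟩
  exact (congrArg IsClosed himage).mpr (isClosedMap_fst_of_compactSpace _ (hZ.inter hD))

/-- Translating by time 1 cannot agree with a nonzero integer translation at a point with a finite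
coordinate, because an integer translation makes that coordinate infinite. -/
theorem mk_mem_zQuotFixedPts_universal_iff {x : (universalSpace I).total} :
    Quotient.mk (zSetoid (universalSpace I).total) x ∈ zQuotFixedPts (universalSpace I).total ↔
      x ∈ fixedPts (universalSpace I).total := by
  rw [mk_mem_zQuotFixedPts_iff]
  refine ⟨fun h => ?_, fun h t => by rw [h t]⟩
  by_contra hx
  obtain ⟨i, y, hy⟩ := exists_coord_real hx
  obtain ⟨n, hn⟩ := mk_eq_mk_iff.1 (h 1)
  have h₁ := congrArg (fun z => coord z i) hn
  simp only [coord_int_vadd, coord_real_vadd, hy] at h₁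
  rcases lt_trichotomy n 0 with h0 | rfl | h0
  · have hd : dst (basePt ((universalSpace I).proj x)) i ((-n) +ᵥ i) = ⊤ :=
      dst_eq_top_of_one_vadd_le ((I.strictMono_vadd i).monotone (by omega))
    rcases coord_eq_of_dst_top x hd with h | h
    · rw [hy] at h; exact EReal.coe_ne_top _ h
    · rw [h, EReal.bot_add] at h₁
      exact EReal.bot_ne_coe _ h₁
  · rw [neg_zero, zero_vadd, hy] at h₁
    norm_cast at h₁
    linarith
  · have hd : dst (basePt ((universalSpace I).proj x)) ((-n) +ᵥ i) i = ⊤ := by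
      refine dst_eq_top_of_one_vadd_le ?_
      rw [vadd_vadd]
      have := (I.strictMono_vadd i).monotone (show 1 + -n ≤ 0 by omega)
      simpa using this
    rcases coord_eq_of_dst_top x hd with h | h
    · rw [h, EReal.top_add_coe] at h₁
      exact EReal.top_ne_coe _ h₁
    · rw [hy] at h; exact EReal.coe_ne_bot _ h

/-- The fixed points whose underlying cut is `{k | k ≤ i}`. -/
def cutSet (i : I) : Set (universalSpace I).total := {x | ∀ k, coord x k = cutBeta (Set.Iic i) k}

theorem isClosed_cutSet (i : I) : IsClosed (cutSet i) := by
  have : cutSet i = ⋂ k, {x | coord x k = cutBeta (Set.Iic i) k} := by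
    ext x
    rw [Set.mem_iInter]
    rfl
  rw [this]
  exact isClosed_iInter fun k => isClosed_eq (continuous_coord k) continuous_const

theorem cutBeta_eq_top_iff {D : Set I} {k : I} : cutBeta D k = ⊤ ↔ k ∈ D := by
  unfold cutBeta
  split_ifs with h <;> simp [h]

theorem cutBeta_eq_bot_iff {D : Set I} {k : I} : cutBeta D k = ⊥ ↔ k ∉ D := by
  unfold cutBeta
  split_ifs with h <;> simp [h]

theorem vadd_mem_cutSet_iff {n : ℤ} {i : I} {x : (universalSpace I).total} :
    (n, (0 : ℝ)) +ᵥ x ∈ cutSet (n +ᵥ i) ↔ x ∈ cutSet i := by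
  have hle : ∀ k, (n +ᵥ k ≤ n +ᵥ i) ↔ k ≤ i := fun k =>
    ⟨fun h => by simpa [vadd_vadd] using I.vadd_le (-n) h, fun h => I.vadd_le n h⟩
  have hcut : ∀ k, cutBeta (Set.Iic (n +ᵥ i)) (n +ᵥ k) = cutBeta (Set.Iic i) k := by
    intro k
    by_cases hk : k ≤ i
    · rw [cutBeta_eq_top_iff.2 (Set.mem_Iic.2 hk),
        cutBeta_eq_top_iff.2 (Set.mem_Iic.2 ((hle k).2 hk))]
    · rw [cutBeta_eq_bot_iff.2 (mt Set.mem_Iic.1 hk),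
        cutBeta_eq_bot_iff.2 (mt Set.mem_Iic.1 (mt (hle k).1 hk))]
  constructor
  · intro h k
    have := h (n +ᵥ k)
    rwa [coord_int_vadd, hcut, vadd_vadd, neg_add_cancel, zero_vadd] at this
  · intro h k
    have := h ((-n) +ᵥ k)
    rw [← hcut, vadd_vadd, add_neg_cancel, zero_vadd] at this
    rw [coord_int_vadd, this]

theorem mem_fixedPts_iff_exists_cutSet {x : (universalSpace I).total} :
    x ∈ fixedPts (universalSpace I).total ↔ ∃ i, x ∈ cutSet i := by
  constructor
  · intro h
    obtain ⟨i, j, hi, hj, hij⟩ := exists_cut h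
    refine ⟨i, fun k => ?_⟩
    by_cases hk : k ≤ i
    · rw [(coord_antitone x hk).2 hi, cutBeta_eq_top_iff.2 (Set.mem_Iic.2 hk)]
    · rw [(coord_antitone x ((hij k).resolve_left hk)).1 hj, cutBeta_eq_bot_iff.2 (mt Set.mem_Iic.1 hk)]
  · rintro ⟨i, h⟩
    rw [mem_fixedPts_universal_iff]
    intro k
    rw [h k]
    by_cases hk : k ∈ Set.Iic i
    · exact Or.inl (cutBeta_eq_top_iff.2 hk)
    · exact Or.inr (cutBeta_eq_bot_iff.2 hk)

theorem le_of_mem_cutSet {x : (universalSpace I).total} {i j : I} (hi : x ∈ cutSet i)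
    (hj : x ∈ cutSet j) : i ≤ j := by
  have := hi i
  rw [hj i, cutBeta_eq_top_iff.2 (Set.mem_Iic.2 le_rfl), cutBeta_eq_top_iff] at this
  exact this

theorem cutSet_eq_of_equiv {i j : I} (hij : i ≤ j) (hji : j ≤ i) : cutSet i = cutSet j := by
  have : Set.Iic i = Set.Iic j :=
    Set.ext fun k => ⟨fun h => le_trans (Set.mem_Iic.1 h) hij, fun h => le_trans (Set.mem_Iic.1 h) hji⟩
  unfold cutSet
  rw [this]

theorem PreordPara.finite_vadd_between (I : PreordPara.{u}) (g g' i j : I) :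
    {n : ℤ | i ≤ n +ᵥ g ∧ n +ᵥ g' ≤ j}.Finite := by
  obtain ⟨N, hN⟩ := I.exists_le_nat_vadd g' j
  obtain ⟨M, hM⟩ := I.exists_neg_nat_vadd_le g i
  refine (Set.finite_Icc (-(M : ℤ)) N).subset fun n hn => ⟨?_, ?_⟩
  · by_contra hlt
    exact ((I.strictMono_vadd g (not_le.1 hlt)).trans_le (hM.trans hn.1)).false
  · by_contra hlt
    exact ((I.strictMono_vadd g' (not_le.1 hlt)).trans_le (hn.2.trans hN)).false

/-- The preimage is the union of the translated cut loci. It is closed because the family is locally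
finite: near a point with β_a = ∞ and β_b = -∞, the cut index must lie between a and b. -/
theorem isClosed_image_cutSet (i : I) :
    IsClosed (Quotient.mk (zSetoid (universalSpace I).total) '' cutSet i) := by
  refine isQuotientMap_quot_mk.isClosed_preimage.1 ?_
  have : Quot.mk (zSetoid (universalSpace I).total).r ⁻¹'
      (Quotient.mk (zSetoid (universalSpace I).total) '' cutSet i) =
      ⋃ n : ℤ, cutSet (n +ᵥ i) := by
    ext x
    simp only [Set.mem_preimage, Set.mem_iUnion]
    constructor
    · rintro ⟨y, hy, h⟩
      obtain ⟨n, rfl⟩ := mk_eq_mk_iff.1 h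
      exact ⟨n, vadd_mem_cutSet_iff.2 hy⟩
    · rintro ⟨n, hn⟩
      refine ⟨(-n, (0 : ℝ)) +ᵥ x, ?_, mk_eq_mk_iff.2 ⟨n, ?_⟩⟩
      · rw [← vadd_mem_cutSet_iff (n := n), int_vadd_vadd, add_neg_cancel, real_zero_vadd]
        exact hn
      · rw [int_vadd_vadd, add_neg_cancel, real_zero_vadd]
  refine this ▸ LocallyFinite.isClosed_iUnion ?_ fun n => isClosed_cutSet _
  intro x
  obtain ⟨a, ha⟩ := exists_coord_top x
  obtain ⟨b, hb⟩ := exists_coord_bot x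
  refine ⟨{y | 0 < coord y a} ∩ {y | coord y b < 0}, ?_, ?_⟩
  · refine ((isOpen_lt continuous_const (continuous_coord a)).inter
      (isOpen_lt (continuous_coord b) continuous_const)).mem_nhds ⟨?_, ?_⟩
    · change 0 < coord x a
      rw [ha]; exact EReal.zero_lt_top
    · change coord x b < 0
      rw [hb]; exact EReal.bot_lt_zero
  · refine (I.finite_vadd_between i i a b).subset ?_
    rintro n ⟨y, hy, h₁, h₂⟩
    change 0 < coord y a at h₁
    change coord y b < 0 at h₂
    rw [hy] at h₁ h₂
    refine ⟨?_, ?_⟩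
    · by_contra hn
      rw [cutBeta_eq_bot_iff.2 (mt Set.mem_Iic.1 hn)] at h₁
      exact not_lt_bot h₁
    · refine (I.total _ _).resolve_right fun hn => ?_
      rw [cutBeta_eq_top_iff.2 (Set.mem_Iic.2 hn)] at h₂
      exact not_top_lt h₂

theorem PreordPara.exists_vadd_between (I : PreordPara.{u}) (i j : I) :
    ∃ n : ℤ, i ≤ n +ᵥ j ∧ n +ᵥ j < (1 : ℤ) +ᵥ i := by
  obtain ⟨m, hm, hmax⟩ := Int.exists_greatest_of_bdd (P := fun n => n +ᵥ j < (1 : ℤ) +ᵥ i)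
    (by
      obtain ⟨N, hN⟩ := I.exists_le_nat_vadd j ((1 : ℤ) +ᵥ i)
      refine ⟨N, fun n hn => ?_⟩
      by_contra hlt
      exact ((hn.trans_le hN).trans (I.strictMono_vadd j (not_le.1 hlt))).false)
    (by
      obtain ⟨N, hN⟩ := I.exists_neg_nat_vadd_le j i
      exact ⟨-N, hN.trans_lt (I.lt_succ i)⟩)
  refine ⟨m, ?_, hm⟩
  have h₁ : ¬ ((m + 1) +ᵥ j < (1 : ℤ) +ᵥ i) := fun h => by
    have := hmax _ h
    omega
  have h₂ : (1 : ℤ) +ᵥ i ≤ (m + 1) +ᵥ j := by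
    rcases I.total ((1 : ℤ) +ᵥ i) ((m + 1) +ᵥ j) with h | h
    · exact h
    · by_contra hn
      exact h₁ (lt_of_le_not_ge h hn)
  have h₃ := I.vadd_le (-1) h₂
  rw [vadd_vadd, vadd_vadd, neg_add_cancel, zero_vadd] at h₃
  rwa [show (-1 : ℤ) + (m + 1) = m by ring] at h₃

/-- A decomposition exists over the whole base: fixed points modulo `ℤ` are sorted by the class in
one period of `I` at which the cut occurs. Each piece meets a fibre at most once, and its projection
is closed by `universal_quotient_closed`. -/
theorem universal_unramified : (universalSpace I).UnramifiedModZ := by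
  intro s
  obtain ⟨i₀⟩ := I.nonempty
  obtain ⟨ρ, hρ, hle⟩ := I.exists_index
  have hlt : ∀ i j, ρ i < ρ j ↔ i < j := fun i j => by
    rw [lt_iff_le_not_ge, lt_iff_le_not_ge, hle, hle]
  obtain ⟨g, hg⟩ := hρ.hasRightInverse
  -- One representative for each class from i₀, included, to i₀ + 1, excluded.
  let c : Fin (ρ ((1 : ℤ) +ᵥ i₀) - ρ i₀).toNat → I := fun a => g (ρ i₀ + (a : ℕ))
  have hρc : ∀ a, ρ (c a) = ρ i₀ + (a : ℕ) := fun a => hg _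
  have hc₁ : ∀ a, i₀ ≤ c a := fun a => by
    rw [← hle, hρc]; omega
  have hc₂ : ∀ a, c a < (1 : ℤ) +ᵥ i₀ := fun a => by
    rw [← hlt, hρc]
    have := a.2
    omega
  let K : Fin (ρ ((1 : ℤ) +ᵥ i₀) - ρ i₀).toNat → Set (ZQuot (universalSpace I).total) :=
    fun a => Quotient.mk (zSetoid (universalSpace I).total) '' cutSet (c a)
  have hinj : ∀ a, Set.InjOn (universalSpace I).quotProj (K a) := by
    rintro a _ ⟨x, hx, rfl⟩ _ ⟨y, hy, rfl⟩ h
    exact congrArg _ (total_ext h fun k => by rw [hx k, hy k])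
  refine ⟨Set.univ, isOpen_univ, trivial, _, K, fun a => Set.mapsTo_univ _ _, ?_, ?_, ?_, ?_⟩
  · intro a b hab
    refine Set.disjoint_left.2 ?_
    rintro _ ⟨x, hx, rfl⟩ ⟨y, hy, h⟩
    obtain ⟨n, rfl⟩ := mk_eq_mk_iff.1 h.symm
    rw [← vadd_mem_cutSet_iff (n := n)] at hx
    have h₁ := le_of_mem_cutSet hx hy
    have h₂ := le_of_mem_cutSet hy hx
    -- Both representatives lie in the same half-open period, so no nonzero translate of one is
    -- equivalent to the other.
    have hn : n = 0 := by
      by_contra hn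
      rcases lt_or_gt_of_ne hn with hn | hn
      · have h₃ : i₀ < i₀ := calc
          i₀ ≤ c b := hc₁ b
          _ ≤ n +ᵥ c a := h₂
          _ ≤ (-1 : ℤ) +ᵥ c a := (I.strictMono_vadd (c a)).monotone (by omega)
          _ < i₀ := by
            have h := I.strictMono_vadd
            have h₄ := (lt_iff_le_not_ge.1 (hc₂ a))
            refine lt_iff_le_not_ge.2 ⟨?_, fun h₅ => h₄.2 ?_⟩
            · simpa [vadd_vadd] using I.vadd_le (-1) h₄.1
            · simpa [vadd_vadd] using I.vadd_le 1 h₅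
        exact h₃.false
      · have h₃ : (1 : ℤ) +ᵥ i₀ < (1 : ℤ) +ᵥ i₀ := calc
          (1 : ℤ) +ᵥ i₀ ≤ (1 : ℤ) +ᵥ c a := I.vadd_le 1 (hc₁ a)
          _ ≤ n +ᵥ c a := (I.strictMono_vadd (c a)).monotone (by omega)
          _ ≤ c b := h₁
          _ < (1 : ℤ) +ᵥ i₀ := hc₂ b
        exact h₃.false
    rw [hn, zero_vadd] at h₁ h₂
    have := le_antisymm ((hle _ _).2 h₁) ((hle _ _).2 h₂)
    rw [hρc, hρc] at this
    exact hab (Fin.ext (by omega))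
  · rw [Set.preimage_univ, Set.inter_univ]
    ext q
    induction q using Quotient.inductionOn with | _ x => ?_
    refine Iff.trans ?_ mk_mem_zQuotFixedPts_universal_iff.symm
    rw [Set.mem_iUnion]
    constructor
    · rintro ⟨a, y, hy, h⟩
      obtain ⟨n, rfl⟩ := mk_eq_mk_iff.1 h
      rw [vadd_mem_fixedPts_iff]
      exact mem_fixedPts_iff_exists_cutSet.2 ⟨_, hy⟩
    · intro hx
      obtain ⟨i, hi⟩ := mem_fixedPts_iff_exists_cutSet.1 hx
      obtain ⟨n, h₁, h₂⟩ := I.exists_vadd_between i₀ i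
      have h₃ := (hle _ _).2 h₁
      have h₄ := (hlt _ _).2 h₂
      let a : Fin (ρ ((1 : ℤ) +ᵥ i₀) - ρ i₀).toNat := ⟨(ρ (n +ᵥ i) - ρ i₀).toNat, by omega⟩
      have ha : ρ (c a) = ρ (n +ᵥ i) := by
        rw [hρc]
        change ρ i₀ + (((ρ (n +ᵥ i) - ρ i₀).toNat : ℕ) : ℤ) = _
        omega
      refine ⟨a, (n, (0 : ℝ)) +ᵥ x, ?_, (mk_eq_mk_iff.2 ⟨n, rfl⟩).symm⟩
      rw [cutSet_eq_of_equiv ((hle _ _).1 ha.le) ((hle _ _).1 ha.ge), vadd_mem_cutSet_iff]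
      exact hi
  · intro a
    exact (isClosed_image_cutSet _).preimage continuous_subtype_val
  · intro a
    refine Topology.IsClosedEmbedding.of_continuous_injective_isClosedMap ?_ ?_ ?_
    · exact ZRSpaceOver.continuous_quotProj.restrict _
    · intro p q h
      exact Subtype.ext (hinj a p.2 q.2 (congrArg Subtype.val h))
    · intro C hC
      have h₁ := universal_quotient_closed _
        ((isClosed_image_cutSet (c a)).isClosedEmbedding_subtypeVal.isClosedMap _ hC)
      convert h₁.preimage (continuous_subtype_val (p := fun s => s ∈ Set.univ)) using 1
      refine Set.ext fun u => ⟨?_, ?_⟩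
      · rintro ⟨q, hq, rfl⟩
        exact ⟨_, ⟨q, hq, rfl⟩, rfl⟩
      · rintro ⟨_, ⟨q, hq, rfl⟩, h⟩
        exact ⟨q, hq, Subtype.ext h⟩

theorem universal_isFamily (I : PreordPara.{u}) : (universalSpace I).IsFamily where
  continuous_action := universal_continuousVAdd
  fibers := universal_isBrokenParacycle
  unramified := universal_unramified
  quotient_closed := universal_quotient_closed
  separated := universal_separated
  local_lifting := by
    intro x hx
    obtain ⟨i, t, hi⟩ := exists_coord_real hx
    have := universal_continuousVAdd (I := I)
    refine ⟨Set.univ, trivial, fun α => ((0 : ℤ), t) +ᵥ (secPoint α.1 i).1, isOpen_univ, ?_, ?_,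
      (eq_vadd_secPoint rfl hi).symm⟩
    · exact (continuous_const_vadd ((0 : ℤ), t)).comp
        ((continuous_secPoint i).comp continuous_subtype_val)
    · intro α
      refine ⟨(universalSpace I).proj_vadd _ _, ?_⟩
      rw [vadd_mem_fixedPts_iff]
      exact fun h => secPoint_not_fixed α.1 i
        ((ZRSpaceOver.mem_fixedPts_fiber_iff (P := universalSpace I) _).2 h)

/-- The coordinates of a point are its distances from the universal section. -/
theorem transDist_secPoint {α : (universalSpace I).base} (i : I)
    (x : (universalSpace I).Fiber α) :
    transDist (secPoint α i) x = coord x.1 i := by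
  have hL := universal_isBrokenParacycle α
  refine EReal_eq_of_forall_coe_lt_iff fun a => ?_
  rw [hL.lt_transDist_iff (secPoint_not_fixed α i), universal_leL_iff, ← not_le, not_iff_not]
  have hc : ∀ k, coord (((0 : ℤ), a) +ᵥ secPoint α i : (universalSpace I).Fiber α).1 k =
      dst (basePt α) k i + a := fun k => coord_real_vadd a (secPoint α i).1 k
  simp only [hc]
  -- Coordinate i alone decides the comparison: the relation propagates the bound at i to every
  -- other coordinate.
  constructor
  · intro h
    have := h i
    rwa [dst_self, zero_add] at this
  · intro h k
    have hr := rel_coord x.1 k i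
    rw [show (universalSpace I).proj x.1 = α from x.2] at hr
    rw [add_comm]
    exact hr.le_coe_add h

theorem universal_isSection (I : PreordPara.{u}) :
    IsISection I (universalSpace I) (universalSection universalBeta_mem) where
  not_fixed α i := secPoint_not_fixed α i
  continuous i := continuous_secPoint i
  surjective α x hx := by
    rw [ZRSpaceOver.mem_fixedPts_fiber_iff] at hx
    obtain ⟨i, t, hi⟩ := exists_coord_real hx
    exact ⟨i, t, Subtype.ext (eq_vadd_secPoint x.2 hi).symm⟩
  dist_gt α i j hij := by
    have := transDist_secPoint (α := α) i (secPoint α j)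
    refine lt_of_lt_of_eq ?_ this.symm
    rw [coord_secPoint]
    exact bot_lt_dst hij
  equivariant α n i := by
    refine Subtype.ext (total_ext ((universalSpace I).proj_vadd (n, (0 : ℝ)) _).symm fun k => ?_)
    change dst (basePt α) k (n +ᵥ i) = coord ((n, (0 : ℝ)) +ᵥ (secPoint α i).1) k
    rw [coord_int_vadd, coord_secPoint, ← dst_vadd (-n) k, vadd_vadd (-n) n, neg_add_cancel,
      zero_vadd]

end UniversalFamily

/-! ### Functoriality of the universal family -/

theorem rel_shift {x c y : EReal} (h : Rel x c y) (p q : ℝ) :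
    Rel (p + x) (p + (((-q : ℝ) : EReal) + c)) (q + y) := by
  intro a b
  simp only [coe_add_lt_coe_iff, coe_lt_coe_add_iff]
  have e : a - b - p - -q = (a - p) - (b - q) := by ring
  rw [e]
  exact h (a - p) (b - q)

section Functoriality

variable {I J : PreordPara.{u}} (r : I ⟶ J)

theorem dst_map (α : FSpace J) (i j : I) : dst (FSpace.map r α) i j = dst α (r.toFun i) (r.toFun j) := by
  have key : ∀ {i j : I}, i ≤ j →
      dst (FSpace.map r α) i j = dst α (r.toFun i) (r.toFun j) := by
    intro i j h
    rw [dst_of_le h, dst_of_le (r.mono h)]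
    rfl
  rcases I.total i j with h | h
  · exact key h
  · rw [dst_neg j i, key h, dst_neg (r.toFun j)]

/-- Every j in `J` is equivalent to some r(e j), at finite distance. Hence β_j is recovered from
β_{e j} by adding a real number that depends continuously on α. The same formula reconstructs β from
its restriction to `I`. -/
theorem universal_isPullback :
    IsPullback (universalTotalMap r) (universalSpace J).proj (universalSpace I).proj
      (FSpace.map r) := by
  choose e he₁ he₂ using r.essSurj
  have hreal : ∀ (α : FSpace J) j, dst α j (r.toFun (e j)) ≠ ⊤ ∧ dst α j (r.toFun (e j)) ≠ ⊥ := by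
    intro α j
    refine ⟨fun h => ?_, (bot_lt_dst (he₂ j)).ne'⟩
    have := bot_lt_dst (α := α) (he₁ j)
    rw [dst_neg j, h, EReal.neg_top] at this
    exact this.false
  choose c hc using fun (α : FSpace J) (j : J) =>
    (⟨_, (EReal.coe_toReal (hreal α j).1 (hreal α j).2).symm⟩ :
      ∃ c : ℝ, dst α j (r.toFun (e j)) = c)
  have hcoord : ∀ (p : (universalSpace J).total) j,
      coord p j = coord (universalTotalMap r p) (e j) +
        dst (basePt ((universalSpace J).proj p)) j (r.toFun (e j)) := by
    intro p j
    have := rel_coord p j (r.toFun (e j))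
    rw [hc, rel_coe_iff] at this
    rw [this, hc, add_comm]
    rfl
  refine isPullback_of_isInducing rfl ?_ ?_ ?_
  · let G : (universalSpace I).total × FSpace J → FSpace J × (J → EReal) := fun p =>
      (p.2, fun j => coord p.1 (e j) + dst p.2 j (r.toFun (e j)))
    have hG : Continuous G := by
      refine continuous_snd.prodMk (continuous_pi fun j => ?_)
      exact continuous_add_of_real ((continuous_coord _).comp continuous_fst)
        ((continuous_dst _ _).comp continuous_snd) fun p => hreal p.2 j
    have hF : Continuous fun p : (universalSpace J).total =>
        (universalTotalMap r p, (universalSpace J).proj p) :=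
      (universalTotalMap r).hom.continuous.prodMk (universalSpace J).proj.hom.continuous
    refine Topology.IsInducing.of_comp hF hG ?_
    have : (G ∘ fun p : (universalSpace J).total =>
        (universalTotalMap r p, (universalSpace J).proj p)) =
        fun p => ((universalSpace J).proj p, coord p) :=
      funext fun p => Prod.ext rfl (funext fun j => (hcoord p j).symm)
    exact (congrArg Topology.IsInducing this).mpr isInducing_proj_coord
  · intro p q h₁ h₂
    refine total_ext h₂ fun j => ?_
    rw [hcoord, hcoord, h₁, h₂]
  · refine fun y (α : FSpace J) hy => ?_
    have hy' : basePt ((universalSpace I).proj y) = FSpace.map r α := hy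
    have hr : ∀ i i', Rel (coord y i) (dst α (r.toFun i) (r.toFun i')) (coord y i') := by
      intro i i'
      have := rel_coord y i i'
      rwa [hy', dst_map] at this
    let β : J → EReal := fun j => (c α j : EReal) + coord y (e j)
    have hβ : ∀ i, β (r.toFun i) = coord y i := by
      intro i
      have := hr i (e (r.toFun i))
      rw [hc, rel_coe_iff] at this
      exact this.symm
    have hmem : (α, β) ∈ totalSet J := by
      refine mem_totalSet_iff.2 ⟨fun j k => ?_, ?_, ?_⟩
      · have hd : dst α j k = (c α j : EReal) + (((-c α k : ℝ) : EReal) +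
            dst α (r.toFun (e j)) (r.toFun (e k))) := by
          have h₁ := rel_dst (α := α) j (r.toFun (e j)) k
          have h₂ := rel_dst (α := α) k (r.toFun (e k)) (r.toFun (e j))
          rw [hc, rel_coe_iff] at h₁ h₂
          rw [h₁, dst_neg k, h₂, dst_neg (r.toFun (e j)) (r.toFun (e k))]
          congr 1
          generalize dst α (r.toFun (e j)) (r.toFun (e k)) = z
          induction z with
          | bot => simp
          | top => simp [-EReal.coe_neg]
          | coe z =>
            norm_cast
            ring
        rw [hd]
        exact rel_shift (hr (e j) (e k)) _ _
      · obtain ⟨i, hi⟩ := exists_coord_bot y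
        exact ⟨r.toFun i, (hβ i).trans hi⟩
      · obtain ⟨i, hi⟩ := exists_coord_top y
        exact ⟨r.toFun i, (hβ i).trans hi⟩
    exact ⟨mkPoint α β hmem, total_ext hy.symm hβ, rfl⟩

end Functoriality

theorem universalFamilies : UniversalFamilies.{u} where
  pullbackStable := pullbackStable
  isFamily := universal_isFamily
  section_mem _ := universalBeta_mem
  isSection := universal_isSection
  isPullback := universal_isPullback

/-! ### Further properties of the translation distance -/

namespace IsBrokenParacycle

variable {L : Type u} [TopologicalSpace L] [AddAction (ℤ × ℝ) L] (hL : IsBrokenParacycle L)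
include hL

/-- After translation, a violation of `Rel` becomes a strict cycle among a·x, b·y and z in the order
of `L`. -/
theorem rel_transDist {x y : L} (hx : x ∉ fixedPts L) (hy : y ∉ fixedPts L) (z : L) :
    Rel (transDist x z) (transDist x y) (transDist y z) := by
  obtain ⟨φ, hφ⟩ := hL.directed
  intro a b
  have e : ((0 : ℤ), a) +ᵥ x = ((0 : ℤ), b) +ᵥ (((0 : ℤ), a - b) +ᵥ x) := by
    rw [real_vadd_vadd, add_sub_cancel]
  rw [hL.transDist_lt_iff hx, hL.lt_transDist_iff hy, hL.lt_transDist_iff hx,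
    hL.lt_transDist_iff hx, hL.transDist_lt_iff hy, hL.transDist_lt_iff hx,
    ← hL.vadd_leL_vadd_iff ((0 : ℤ), b) (x := y),
    ← hL.vadd_leL_vadd_iff ((0 : ℤ), b) (y := y), ← e]
  simp only [hL.not_leL_iff hφ]
  refine ⟨fun ⟨h₁, h₂, h₃⟩ => ?_, fun ⟨h₁, h₂, h₃⟩ => ?_⟩
  · exact ((h₂.trans h₁).trans h₃).false
  · exact ((h₁.trans h₂).trans h₃).false

theorem transDist_vadd_vadd (g : ℤ × ℝ) (x y : L) :
    transDist (g +ᵥ x) (g +ᵥ y) = transDist x y := by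
  have := hL.continuous_action
  refine transDist_of_equivariant (Homeomorph.vadd g) (fun h z => ?_) x y
  change g +ᵥ (h +ᵥ z) = h +ᵥ (g +ᵥ z)
  rw [vadd_vadd, vadd_vadd, add_comm]

theorem transDist_vadd_right {x : L} (hx : x ∉ fixedPts L) (y : L) (t : ℝ) :
    transDist x (((0 : ℤ), t) +ᵥ y) = transDist x y + t := by
  refine EReal_eq_of_forall_coe_lt_iff fun a => ?_
  rw [add_comm, coe_lt_coe_add_iff, hL.lt_transDist_iff hx, hL.lt_transDist_iff hx,
    ← hL.vadd_leL_vadd_iff ((0 : ℤ), t) (x := y), real_vadd_vadd, add_sub_cancel]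

theorem transDist_neg {x y : L} (hx : x ∉ fixedPts L) (hy : y ∉ fixedPts L) :
    transDist y x = -transDist x y := by
  refine EReal_eq_of_forall_coe_lt_iff fun a => ?_
  rw [EReal.lt_neg_comm, ← EReal.coe_neg, hL.lt_transDist_iff hy, hL.transDist_lt_iff hx,
    ← hL.vadd_leL_vadd_iff ((0 : ℤ), a) (y := y), real_vadd_vadd, add_neg_cancel, real_zero_vadd]

/-- Distances from a set of representatives of the orbits separate points. -/
theorem eq_of_transDist_eq {J : Type*} (τ : J → L) (hτ : ∀ i, τ i ∉ fixedPts L)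
    (hsurj : ∀ x, x ∉ fixedPts L → ∃ (i : J) (t : ℝ), ((0 : ℤ), t) +ᵥ τ i = x) {x y : L}
    (h : ∀ i, transDist (τ i) x = transDist (τ i) y) : x = y := by
  obtain ⟨φ, hφ⟩ := hL.directed
  by_contra hne
  wlog hlt : φ x < φ y generalizing x y
  · exact this (fun i => (h i).symm) (Ne.symm hne)
      (lt_of_le_of_ne (not_lt.1 hlt) fun h' => hne (φ.injective h'.symm))
  -- A non-fixed point strictly between x and y lies on the orbit of some `τ i`, and the distance
  -- from that `τ i` separates x from y.
  obtain ⟨z, hz, h₁, h₂⟩ := hL.exists_between_not_fixed φ hlt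
  obtain ⟨i, t, rfl⟩ := hsurj z hz
  rw [← hL.not_leL_iff hφ, ← hL.transDist_lt_iff (hτ i)] at h₁
  rw [← hL.not_leL_iff hφ, ← hL.lt_transDist_iff (hτ i), ← h i] at h₂
  exact (h₁.trans h₂).false

/-- A family of prescribed distances which is compatible with the mutual distances of the points
`τ i` is realized by a point. -/
theorem exists_transDist_eq {J : Type*} (τ : J → L) (hτ : ∀ i, τ i ∉ fixedPts L) (β : J → EReal)
    (hβ : ∀ i j, Rel (β i) (transDist (τ i) (τ j)) (β j)) (hbot : ∃ i, β i = ⊥)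
    (htop : ∃ i, β i = ⊤) : ∃ x, ∀ i, transDist (τ i) x = β i := by
  obtain ⟨φ, hφ⟩ := hL.directed
  -- These are the points the solution must not lie below. The relation between the β_i makes every
  -- prescribed upper bound an upper bound of this set, so its supremum satisfies all conditions.
  let A : Set ℝ := {r | ∃ (j : J) (t : ℝ), (t : EReal) ≤ β j ∧ r = φ (((0 : ℤ), t) +ᵥ τ j)}
  have key : ∀ (i : J) (t : ℝ), β i ≤ t → φ (((0 : ℤ), t) +ᵥ τ i) ∈ upperBounds A := by
    rintro i t hi _ ⟨j, t', ht', rfl⟩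
    rw [← hL.leL_iff hφ, ← hL.le_transDist_iff (hτ j), hL.transDist_vadd_right (hτ j), add_comm]
    exact ht'.trans ((hβ j i).le_coe_add hi)
  have hne : A.Nonempty := by
    obtain ⟨i, hi⟩ := htop
    exact ⟨_, i, 0, by rw [hi]; exact le_top, rfl⟩
  have hbdd : BddAbove A := by
    obtain ⟨i, hi⟩ := hbot
    exact ⟨_, key i 0 (by rw [hi]; exact bot_le)⟩
  refine ⟨φ.symm (sSup A), fun i => le_antisymm ?_ ?_⟩
  · refine le_of_forall_gt fun d hd => ?_
    obtain ⟨t, ht₁, ht₂⟩ := EReal.lt_iff_exists_real_btwn.1 hd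
    refine lt_of_le_of_lt ?_ ht₂
    rw [hL.transDist_le_iff (hτ i), hL.leL_iff hφ, φ.apply_symm_apply]
    exact csSup_le hne (key i t ht₁.le)
  · refine le_of_forall_lt fun d hd => ?_
    obtain ⟨t, ht₁, ht₂⟩ := EReal.lt_iff_exists_real_btwn.1 hd
    refine lt_of_lt_of_le ht₁ ?_
    rw [hL.le_transDist_iff (hτ i), hL.leL_iff hφ, φ.apply_symm_apply]
    exact le_csSup hbdd ⟨i, t, ht₂.le, rfl⟩

end IsBrokenParacycle

theorem Rel.add_eq {x c y : EReal} (h : Rel x c y) (hc : ⊥ < c) (hy : ⊥ < y) : c + y = x := by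
  induction c with
  | bot => exact absurd hc (lt_irrefl _)
  | top => rw [(rel_top_iff.1 h).resolve_right hy.ne', EReal.top_add_of_ne_bot hy.ne']
  | coe c => exact (rel_coe_iff.1 h).symm

/-! ### The classifying map of a family with an `I`-section -/

namespace IsISection

variable {I : PreordPara.{u}} {P : ZRSpaceOver.{u}} {σ : (s : P.base) → I → P.Fiber s}
  (hσ : IsISection I P σ) (hP : P.IsFamily)

/-- The point `(i,j) ↦ d(σ(s,i), σ(s,j))` of `F^(I)`. -/
def alpha (s : P.base) : FSpace I :=
  ⟨fun a => ⟨transDist (σ s a.1.1) (σ s a.1.2), hσ.dist_gt s a.2⟩, by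
    have hL := hP.fibers s
    refine ⟨fun i => ?_, fun i j k hij hjk => ?_, fun i j hij => Subtype.ext ?_, fun i => ?_⟩
    · have := hL.transDist_vadd_self (hσ.not_fixed s i) 0
      rw [real_zero_vadd] at this
      exact this
    · exact (hL.rel_transDist (hσ.not_fixed s i) (hσ.not_fixed s j) (σ s k)).add_eq
        (hσ.dist_gt s hij) (hσ.dist_gt s hjk)
    · change transDist (σ s i) (σ s j) = transDist (σ s ((1 : ℤ) +ᵥ i)) (σ s ((1 : ℤ) +ᵥ j))
      rw [hσ.equivariant, hσ.equivariant, hL.transDist_vadd_vadd]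
    -- A finite distance would put a point and its translate by 1 on one `ℝ`-orbit.
    · change transDist (σ s i) (σ s ((1 : ℤ) +ᵥ i)) = ⊤
      have h₁ := hσ.dist_gt s (I.lt_succ i).le
      by_contra hn
      have h₂ := (EReal.coe_toReal hn h₁.ne').symm
      rw [hL.transDist_eq_coe_iff (hσ.not_fixed s i), hσ.equivariant] at h₂
      exact hL.real_vadd_ne_one_vadd _ _ h₂⟩

theorem dst_alpha (s : P.base) (i j : I) :
    dst (hσ.alpha hP s) i j = transDist (σ s i) (σ s j) := by
  rcases I.total i j with h | h
  · rw [dst_of_le h]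
    rfl
  · rw [dst_neg j i, dst_of_le h,
      (hP.fibers s).transDist_neg (hσ.not_fixed s j) (hσ.not_fixed s i)]
    rfl

variable (σ) in
/-- The distance of a point from the section with index `i`. -/
def beta (x : P.total) (i : I) : EReal := transDist (σ (P.proj x) i) (P.toFiber x rfl)

theorem beta_fiber {s : P.base} (x : P.Fiber s) (i : I) :
    beta σ x.1 i = transDist (σ s i) x := by
  obtain ⟨x, rfl⟩ := x
  rfl

include hσ hP in
theorem rel_beta (x : P.total) (i j : I) :
    Rel (beta σ x i) (dst (hσ.alpha hP (P.proj x)) i j) (beta σ x j) := by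
  rw [dst_alpha]
  exact (hP.fibers _).rel_transDist (hσ.not_fixed _ i) (hσ.not_fixed _ j) _

include hσ hP in
-- The `ℤ`-translates of a section value eventually pass x in both directions. One more translation
-- crosses an infinite distance and makes the coordinate infinite.
theorem beta_mem (x : P.total) : (hσ.alpha hP (P.proj x), beta σ x) ∈ totalSet I := by
  have hL := hP.fibers (P.proj x)
  obtain ⟨i⟩ := I.nonempty
  refine mem_totalSet_iff.2 ⟨hσ.rel_beta hP x, ?_, ?_⟩
  · obtain ⟨n, hn⟩ := hL.exists_int_vadd_not_leL (σ (P.proj x) i) (P.toFiber x rfl)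
    have h₁ : beta σ x ((n : ℤ) +ᵥ i) ≤ (0 : ℝ) := by
      rw [beta, hL.transDist_le_iff (hσ.not_fixed _ _), real_zero_vadd, hσ.equivariant]
      exact (hL.leL_total _ _).resolve_right hn
    refine ⟨(1 : ℤ) +ᵥ ((n : ℤ) +ᵥ i), ?_⟩
    have h₂ := hσ.rel_beta hP x ((n : ℤ) +ᵥ i) ((1 : ℤ) +ᵥ ((n : ℤ) +ᵥ i))
    rw [dst_one_vadd, rel_top_iff] at h₂
    refine h₂.resolve_left fun h => ?_
    rw [h] at h₁
    exact absurd h₁ (EReal.coe_lt_top _).not_ge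
  · obtain ⟨n, hn⟩ := hL.exists_int_vadd_not_leL (P.toFiber x rfl) (σ (P.proj x) i)
    have h₁ : (0 : ℝ) ≤ beta σ x ((-(n : ℤ)) +ᵥ i) := by
      rw [beta, hL.le_transDist_iff (hσ.not_fixed _ _), real_zero_vadd, hσ.equivariant,
        ← hL.vadd_leL_vadd_iff ((n : ℤ), (0 : ℝ)), int_vadd_vadd, add_neg_cancel, real_zero_vadd]
      exact (hL.leL_total _ _).resolve_right hn
    refine ⟨(-1 : ℤ) +ᵥ ((-(n : ℤ)) +ᵥ i), ?_⟩
    have h₂ := hσ.rel_beta hP x ((-1 : ℤ) +ᵥ ((-(n : ℤ)) +ᵥ i)) ((-(n : ℤ)) +ᵥ i)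
    rw [dst_eq_top_of_one_vadd_le (by rw [vadd_vadd]; simp), rel_top_iff] at h₂
    refine h₂.resolve_right fun h => ?_
    rw [h] at h₁
    exact absurd h₁ (EReal.bot_lt_coe _).not_ge

include hσ hP in
theorem beta_vadd (g : ℤ × ℝ) (x : P.total) (i : I) :
    beta σ (g +ᵥ x) i = beta σ x ((-g.1) +ᵥ i) + (g.2 : EReal) := by
  have hL := hP.fibers (P.proj x)
  have h := beta_fiber (σ := σ) (g +ᵥ P.toFiber x rfl) i
  change beta σ (g +ᵥ x) i = _ at h
  rw [h, vadd_eq_int_real, beta, ← hL.transDist_vadd_right (hσ.not_fixed _ _),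
    ← hL.transDist_vadd_vadd (g.1, (0 : ℝ)) (σ (P.proj x) ((-g.1) +ᵥ i)), ← hσ.equivariant,
    vadd_vadd (M := ℤ), add_neg_cancel, zero_vadd]

/-- The set where one section lies below another one is closed. -/
theorem _root_.BrokenPara.ZRSpaceOver.IsFamily.isClosed_leL {Y : Type*} [TopologicalSpace Y]
    {P : ZRSpaceOver.{u}} (hP : P.IsFamily) {a b : Y → P.total} (ha : Continuous a)
    (hb : Continuous b) (hab : ∀ y, P.proj (a y) = P.proj (b y)) :
    IsClosed {y | leL (P.toFiber (a y) (hab y)) (P.toFiber (b y) rfl)} :=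
  hP.separated.preimage (f := fun y => (⟨(a y, b y), hab y⟩ :
    {p : P.total × P.total // P.proj p.1 = P.proj p.2})) ((ha.prodMk hb).subtype_mk _)

theorem _root_.BrokenPara.continuous_of_isOpen_real {Y : Type*} [TopologicalSpace Y]
    {f : Y → EReal} (h₁ : ∀ a : ℝ, IsOpen {y | (a : EReal) < f y})
    (h₂ : ∀ a : ℝ, IsOpen {y | f y < a}) : Continuous f := by
  refine continuous_iff_continuousAt.2 fun x => tendsto_order.2 ⟨fun a ha => ?_, fun a ha => ?_⟩
  · obtain ⟨r, hr₁, hr₂⟩ := EReal.lt_iff_exists_real_btwn.1 ha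
    filter_upwards [(h₁ r).mem_nhds hr₂] with y hy
    exact hr₁.trans hy
  · obtain ⟨r, hr₁, hr₂⟩ := EReal.lt_iff_exists_real_btwn.1 ha
    filter_upwards [(h₂ r).mem_nhds hr₁] with y hy
    exact lt_trans hy hr₂

include hσ hP in
-- The sets where a coordinate is greater or less than a real number are complements of order
-- relations between x and a translated section, which are closed by separatedness.
theorem continuous_beta (i : I) : Continuous fun x => beta σ x i := by
  have := hP.continuous_action
  let τ : ℝ → P.total → P.total := fun a x => ((0 : ℤ), a) +ᵥ (σ (P.proj x) i).1
  have hτ : ∀ a, Continuous (τ a) := fun a =>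
    (continuous_const_vadd _).comp ((hσ.continuous i).comp P.proj.hom.continuous)
  have hπ : ∀ a x, P.proj (τ a x) = P.proj x := fun a x =>
    (P.proj_vadd _ _).trans (σ (P.proj x) i).2
  refine continuous_of_isOpen_real (fun a => ?_) (fun a => ?_)
  · have h := hP.isClosed_leL continuous_id (hτ a) fun x => (hπ a x).symm
    convert h.isOpen_compl using 1
    ext x
    refine ((hP.fibers _).lt_transDist_iff (hσ.not_fixed _ _) _ a).trans (not_congr ?_)
    exact ZRSpaceOver.leL_toFiber_iff rfl (hπ a x)
  · have h := hP.isClosed_leL (hτ a) continuous_id fun x => hπ a x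
    convert h.isOpen_compl using 1
    ext x
    exact (hP.fibers _).transDist_lt_iff (hσ.not_fixed _ _) _ a

theorem continuous_alpha : Continuous (hσ.alpha hP) := by
  refine Continuous.subtype_mk (continuous_pi fun a => Continuous.subtype_mk ?_ _) _
  have h := (hσ.continuous_beta hP a.1.1).comp (hσ.continuous a.1.2)
  convert h using 1
  funext s
  exact (beta_fiber (σ s a.1.2) a.1.1).symm

/-- The map to the total space of the universal family. -/
def toUniversal (x : P.total) : (universalSpace I).total :=
  mkPoint (hσ.alpha hP (P.proj x)) (beta σ x) (hσ.beta_mem hP x)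

theorem proj_toUniversal (x : P.total) :
    (universalSpace I).proj (hσ.toUniversal hP x) = hσ.alpha hP (P.proj x) := rfl

theorem coord_toUniversal (x : P.total) (i : I) :
    coord (hσ.toUniversal hP x) i = beta σ x i := rfl

theorem continuous_toUniversal : Continuous (hσ.toUniversal hP) := by
  refine isInducing_proj_coord.continuous_iff.2 (Continuous.prodMk ?_ (continuous_pi fun i => ?_))
  · exact (hσ.continuous_alpha hP).comp P.proj.hom.continuous
  · exact hσ.continuous_beta hP i

theorem toUniversal_vadd (g : ℤ × ℝ) (x : P.total) :
    hσ.toUniversal hP (g +ᵥ x) = g +ᵥ hσ.toUniversal hP x := by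
  refine total_ext ?_ fun i => ?_
  · refine Eq.trans ?_ ((universalSpace I).proj_vadd g (hσ.toUniversal hP x)).symm
    rw [proj_toUniversal, proj_toUniversal, P.proj_vadd]
  · rw [coord_vadd]
    exact hσ.beta_vadd hP g x i

theorem toUniversal_ext {x y : P.total} (h : P.proj x = P.proj y)
    (h' : hσ.toUniversal hP x = hσ.toUniversal hP y) : x = y := by
  have key : ∀ {s : P.base} (x y : P.Fiber s), (∀ i, beta σ x.1 i = beta σ y.1 i) → x = y := by
    intro s x y hxy
    refine (hP.fibers s).eq_of_transDist_eq (σ s) (hσ.not_fixed s) (hσ.surjective s) fun i => ?_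
    rw [← beta_fiber, ← beta_fiber, hxy]
  have := key (P.toFiber x h) (P.toFiber y rfl) fun i => congrArg (fun z => coord z i) h'
  exact congrArg Subtype.val this

theorem exists_toUniversal_eq (s : P.base) (y : (universalSpace I).total)
    (h : (universalSpace I).proj y = hσ.alpha hP s) :
    ∃ x, hσ.toUniversal hP x = y ∧ P.proj x = s := by
  obtain ⟨x, hx⟩ := (hP.fibers s).exists_transDist_eq (σ s) (hσ.not_fixed s) (coord y)
    (fun i j => by
      have := rel_coord y i j
      rwa [show basePt ((universalSpace I).proj y) = hσ.alpha hP s from h, dst_alpha] at this)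
    (exists_coord_bot y) (exists_coord_top y)
  refine ⟨x.1, total_ext ?_ fun i => ?_, x.2⟩
  · rw [h, proj_toUniversal, show P.proj x.1 = s from x.2]
  · rw [coord_toUniversal, beta_fiber, hx]

theorem toUniversal_sec (s : P.base) (i : I) :
    hσ.toUniversal hP (σ s i).1 = (secPoint (hσ.alpha hP s) i).1 := by
  refine total_ext ?_ fun j => ?_
  · rw [proj_toUniversal, show P.proj (σ s i).1 = s from (σ s i).2]
    rfl
  · rw [coord_toUniversal, beta_fiber]
    exact (hσ.dst_alpha hP s j i).symm

end IsISection

/-- The region where `β_i` is positive and `β_j` is negative. -/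
def region {I : PreordPara.{u}} (i j : I) : Set (universalSpace I).total :=
  {y | 0 < coord y i} ∩ {y | coord y j < 0}

section Region

variable {I : PreordPara.{u}}

theorem isOpen_region (i j : I) : IsOpen (region i j) :=
  (isOpen_lt continuous_const (continuous_coord i)).inter
    (isOpen_lt (continuous_coord j) continuous_const)

theorem mem_region {y : (universalSpace I).total} {i j : I} (hi : coord y i = ⊤)
    (hj : coord y j = ⊥) : y ∈ region i j := by
  refine ⟨?_, ?_⟩
  · change 0 < coord y i
    rw [hi]; exact EReal.zero_lt_top
  · change coord y j < 0
    rw [hj]; exact EReal.bot_lt_zero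

/-- Only finitely many translates of one region meet another region. -/
theorem finite_translates_region (i j a b : I) :
    {n : ℤ | ∃ y ∈ region i j, (-n, (0 : ℝ)) +ᵥ y ∈ region a b}.Finite := by
  refine (I.finite_vadd_between ((1 : ℤ) +ᵥ b) a i ((1 : ℤ) +ᵥ j)).subset ?_
  rintro n ⟨y, ⟨h₁, h₂⟩, h₃, h₄⟩
  change 0 < coord y i at h₁
  change coord y j < 0 at h₂
  change 0 < coord ((-n, (0 : ℝ)) +ᵥ y) a at h₃
  change coord ((-n, (0 : ℝ)) +ᵥ y) b < 0 at h₄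
  rw [coord_int_vadd, neg_neg] at h₃ h₄
  refine ⟨(I.total _ _).resolve_right fun h => ?_, (I.total _ _).resolve_right fun h => ?_⟩
  · rw [vadd_vadd, add_comm, ← vadd_vadd] at h
    rcases coord_eq_of_dst_top y (dst_eq_top_of_one_vadd_le h) with h' | h'
    · rw [h'] at h₄; exact not_top_lt h₄
    · rw [h'] at h₁; exact not_lt_bot h₁
  · rcases coord_eq_of_dst_top y (dst_eq_top_of_one_vadd_le h) with h' | h'
    · rw [h'] at h₂; exact not_top_lt h₂
    · rw [h'] at h₃; exact not_lt_bot h₃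

end Region

instance (I : PreordPara.{u}) : T2Space (universalSpace I).total :=
  inferInstanceAs (T2Space (totalSet I))

/-! ### Properness and the pullback square to the universal family -/

namespace IsISection

open Filter Topology

variable {I : PreordPara.{u}} {P : ZRSpaceOver.{u}} {σ : (s : P.base) → I → P.Fiber s}
  (hσ : IsISection I P σ) (hP : P.IsFamily)

/-- The part of the total space which lies over a region is proper over the base. -/
theorem exists_le_nhds_of_region (U : Ultrafilter P.total) {s : P.base}
    (hs : Tendsto P.proj U (𝓝 s)) {i j : I}
    (hU : hσ.toUniversal hP ⁻¹' region i j ∈ U) : ∃ x, P.proj x = s ∧ (U : Filter P.total) ≤ 𝓝 x := by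
  have := hP.continuous_action
  let q : P.total → ZQuot P.total := Quotient.mk (zSetoid P.total)
  -- Properness gives a limit z of the ultrafilter in `L_S/ℤ`. It remains to find which translate of
  -- the representative x is a limit in the total space.
  have hproper := isProperMap_iff_ultrafilter.1 (ZRSpaceOver.isProperMap_quotProj hP)
  obtain ⟨z, hz, hUz⟩ := hproper.2 (𝒰 := U.map q) (y := s) hs
  induction z using Quotient.inductionOn with | _ x => ?_
  change P.proj x = s at hz
  obtain ⟨a, ha⟩ := exists_coord_top (hσ.toUniversal hP x)
  obtain ⟨b, hb⟩ := exists_coord_bot (hσ.toUniversal hP x)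
  have hV : hσ.toUniversal hP ⁻¹' region a b ∈ 𝓝 x :=
    ((isOpen_region a b).preimage (hσ.continuous_toUniversal hP)).mem_nhds (mem_region ha hb)
  have hfin := finite_translates_region i j a b
  set N := {n : ℤ | ∃ y ∈ region i j, (-n, (0 : ℝ)) +ᵥ y ∈ region a b}
  -- The translates of a neighbourhood of x carry the ultrafilter, and those indexed by the finite
  -- set `N` suffice, because both the points and their translates lie in prescribed regions.
  have hcover : ∀ W ∈ 𝓝 x, (⋃ n ∈ N, {y : P.total | (-n, (0 : ℝ)) +ᵥ y ∈ W}) ∈ U := by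
    intro W hW
    have h₁ : q '' (W ∩ hσ.toUniversal hP ⁻¹' region a b) ∈ 𝓝 (q x) :=
      isOpenMap_mk.image_mem_nhds (inter_mem hW hV)
    have h₂ : q ⁻¹' (q '' (W ∩ hσ.toUniversal hP ⁻¹' region a b)) ∈ U := hUz h₁
    filter_upwards [h₂, hU] with y hy₁ hy₂
    obtain ⟨w, ⟨hw₁, hw₂⟩, hwy⟩ := hy₁
    obtain ⟨n, rfl⟩ := mk_eq_mk_iff.1 hwy
    have e : (-n, (0 : ℝ)) +ᵥ ((n, (0 : ℝ)) +ᵥ w) = w := by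
      rw [int_vadd_vadd, neg_add_cancel, real_zero_vadd]
    refine Set.mem_biUnion (x := n) ⟨_, hy₂, ?_⟩ ?_
    · rw [← toUniversal_vadd, e]
      exact hw₂
    · change _ ∈ W
      rwa [e]
  by_contra hcon
  push Not at hcon
  -- If no translate of x is a limit, each n has a neighbourhood of x whose n-th translate is not in
  -- the ultrafilter. Intersecting these over `N` contradicts `hcover`, as an ultrafilter containing
  -- a finite union contains one of its members.
  have hnot : ∀ n : ℤ, ∃ W ∈ 𝓝 x, {y : P.total | (-n, (0 : ℝ)) +ᵥ y ∈ W} ∉ U := by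
    intro n
    by_contra! hn
    refine hcon ((n, (0 : ℝ)) +ᵥ x) ((P.proj_vadd _ _).trans hz) ?_
    intro O hO
    have hO' : (fun y : P.total => ((n, (0 : ℝ)) : ℤ × ℝ) +ᵥ y) ⁻¹' O ∈ 𝓝 x :=
      (continuous_const_vadd _).continuousAt.preimage_mem_nhds hO
    refine mem_of_superset (hn _ hO') fun y hy => ?_
    change ((n, (0 : ℝ)) : ℤ × ℝ) +ᵥ ((-n, (0 : ℝ)) +ᵥ y) ∈ O at hy
    rwa [int_vadd_vadd, add_neg_cancel, real_zero_vadd] at hy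
  choose W hW hWU using hnot
  have hinter : (⋂ n ∈ N, W n) ∈ 𝓝 x := (biInter_mem hfin).2 fun n _ => hW n
  have hmem := hcover _ hinter
  rw [Ultrafilter.finite_biUnion_mem_iff hfin] at hmem
  obtain ⟨n, hn, hmem⟩ := hmem
  refine hWU n (mem_of_superset hmem fun y hy => ?_)
  exact Set.mem_iInter₂.1 hy n hn

/-- An ultrafilter whose image converges to the image of x has a limit y over the same base point.
Uniqueness of limits in the universal total space and injectivity on fibres give y = x. -/
theorem isInducing_toUniversal :
    IsInducing fun x : P.total => (hσ.toUniversal hP x, P.proj x) := by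
  have hcont : Continuous fun x : P.total => (hσ.toUniversal hP x, P.proj x) :=
    (hσ.continuous_toUniversal hP).prodMk P.proj.hom.continuous
  refine isInducing_iff_nhds.2 fun x => le_antisymm (map_le_iff_le_comap.1 hcont.continuousAt) ?_
  rw [le_iff_ultrafilter]
  intro U hU
  have hU' : Tendsto (fun x : P.total => (hσ.toUniversal hP x, P.proj x)) U
      (𝓝 (hσ.toUniversal hP x, P.proj x)) := tendsto_iff_comap.2 hU
  rw [nhds_prod_eq, tendsto_prod_iff'] at hU'
  obtain ⟨h₁, h₂⟩ := hU'
  obtain ⟨i, hi⟩ := exists_coord_top (hσ.toUniversal hP x)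
  obtain ⟨j, hj⟩ := exists_coord_bot (hσ.toUniversal hP x)
  obtain ⟨y, hy, hUy⟩ := hσ.exists_le_nhds_of_region hP U h₂
    (h₁ ((isOpen_region i j).mem_nhds (mem_region hi hj)))
  have h₃ : Tendsto (hσ.toUniversal hP) U (𝓝 (hσ.toUniversal hP y)) :=
    ((hσ.continuous_toUniversal hP).tendsto y).mono_left hUy
  rw [hσ.toUniversal_ext hP hy.symm (tendsto_nhds_unique h₁ h₃)]
  exact hUy

/-- A family with an `I`-section is the pullback of the universal family. -/
def classifyingHom : P ⟶ universalSpace I :=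
  ({ base := TopCat.ofHom ⟨hσ.alpha hP, hσ.continuous_alpha hP⟩
     total := TopCat.ofHom ⟨hσ.toUniversal hP, hσ.continuous_toUniversal hP⟩
     isPullback := isPullback_of_isInducing rfl (hσ.isInducing_toUniversal hP)
       (fun _ _ h₁ h₂ => hσ.toUniversal_ext hP h₂ h₁)
       (fun y s h => hσ.exists_toUniversal_eq hP s y h)
     equivariant := hσ.toUniversal_vadd hP } : ZRSpaceOver.Hom P (universalSpace I))

end IsISection

/-! ### Fibrations in groupoids -/

theorem isStronglyCartesian_of_existsUnique {X : Type w} [Category.{v} X] (p : X ⥤ TopCat.{u})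
    {a b : X} (φ : a ⟶ b)
    (h : ∀ (c : X) (ψ : c ⟶ b) (g : p.obj c ⟶ p.obj a), g ≫ p.map φ = p.map ψ →
      ∃! χ : c ⟶ a, p.map χ = g ∧ χ ≫ φ = ψ) : p.IsStronglyCartesian (p.map φ) φ where
  universal_property' {c} g ψ hψ := by
    obtain ⟨χ, ⟨h₁, h₂⟩, h₃⟩ := h c ψ g (IsHomLift.eq_of_isHomLift p _ ψ)
    refine ⟨χ, ⟨by rw [← h₁]; infer_instance, h₂⟩, ?_⟩
    rintro χ' ⟨h₄, h₅⟩
    exact h₃ χ' ⟨(IsHomLift.eq_of_isHomLift p g χ').symm, h₅⟩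

theorem IsFiberedInGroupoids.of_existsUnique {X : Type w} [Category.{v} X] {p : X ⥤ TopCat.{u}}
    (h : ∀ (a b c : X) (φ : a ⟶ b) (ψ : c ⟶ b) (g : p.obj c ⟶ p.obj a), g ≫ p.map φ = p.map ψ →
      ∃! χ : c ⟶ a, p.map χ = g ∧ χ ≫ φ = ψ)
    (hl : ∀ (a : X) (R : TopCat.{u}) (f : R ⟶ p.obj a), ∃ (b : X) (φ : b ⟶ a), p.IsHomLift f φ) :
    IsFiberedInGroupoids p := by
  have hc : ∀ ⦃a b : X⦄ (φ : a ⟶ b), p.IsStronglyCartesian (p.map φ) φ := fun a b φ =>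
    isStronglyCartesian_of_existsUnique p φ fun c => h a b c φ
  refine ⟨Functor.IsFibered.of_exists_isStronglyCartesian fun a R f => ?_, hc⟩
  obtain ⟨b, φ, hφ⟩ := hl a R f
  refine ⟨b, φ, ?_⟩
  obtain rfl := IsHomLift.domain_eq p f φ
  rw [IsHomLift.eq_of_isHomLift p f φ]
  exact hc φ

/-! ### Equivalences in the (2,1)-category of categories over a category -/

namespace CatOver

open Bicategory

variable {B : Type w} [Category.{v} B]

/-- If `Y → B` is faithful, there is at most one 2-cell between morphisms to `Y`. -/
instance subsingleton_hom₂ {X Y : CatOver B} [Y.p.Faithful] (f g : X ⟶ Y) :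
    Subsingleton (f ⟶ g) where
  allEq a b := by
    apply hom₂_ext
    ext x
    apply Y.p.map_injective
    have h := (Hom₂.compat a).trans (Hom₂.compat b).symm
    simpa using congrArg (fun e => e.hom.app x) h

/-- An inverse of a morphism over `B` whose functor is an equivalence. -/
def inverse {X Y : CatOver B} (f : X ⟶ Y) [(Hom.functor f).IsEquivalence] : Y ⟶ X :=
  (⟨(Hom.functor f).inv, (Functor.leftUnitor _).symm ≪≫
      Functor.isoWhiskerRight (Hom.functor f).asEquivalence.counitIso.symm Y.p ≪≫
      Functor.associator _ _ _ ≪≫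
      Functor.isoWhiskerLeft (Hom.functor f).inv (Hom.tri f).symm⟩ : Hom Y X)

/-- The unit of the inverse. -/
def inverseUnit {X Y : CatOver B} (f : X ⟶ Y) [(Hom.functor f).IsEquivalence] :
    𝟙 X ≅ f ≫ inverse f :=
  isoMk (f := 𝟙 X) (g := f ≫ inverse f) (Hom.functor f).asEquivalence.unitIso (by
    ext x
    let e := (Hom.functor f).asEquivalence
    have key : ∀ {a b c d : B} (p : a ⟶ d) (q : a ⟶ b) (r : b ⟶ c) (t : d ≅ c),
        p ≫ t.hom = q ≫ r → 𝟙 _ ≫ p = q ≫ (𝟙 _ ≫ r ≫ 𝟙 _ ≫ t.inv) ≫ 𝟙 _ := by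
      intro a b c d p q r t h
      rw [← Iso.eq_comp_inv, Category.assoc] at h
      simp [h]
    refine key (X.p.map (e.unit.app x)) ((Hom.tri f).hom.app x)
      (Y.p.map (e.counitInv.app (e.functor.obj x)))
      ((Hom.tri f).app (e.inverse.obj (e.functor.obj x))) ?_
    exact ((Hom.tri f).hom.naturality (e.unit.app x)).trans
      (congrArg (fun z => (Hom.tri f).hom.app x ≫ Y.p.map z) (e.counitInv_app_functor x).symm))

/-- The counit of the inverse. -/
def inverseCounit {X Y : CatOver B} (f : X ⟶ Y) [(Hom.functor f).IsEquivalence] :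
    inverse f ≫ f ≅ 𝟙 Y :=
  isoMk (f := inverse f ≫ f) (g := 𝟙 Y) (Hom.functor f).asEquivalence.counitIso (by
    ext y
    let e := (Hom.functor f).asEquivalence
    have key : ∀ {a b c : B} (p : a ⟶ b) (q : b ⟶ a) (t : c ≅ b),
        p ≫ q = 𝟙 _ → ((𝟙 _ ≫ p ≫ 𝟙 _ ≫ t.inv) ≫ t.hom ≫ 𝟙 _) ≫ q = 𝟙 _ := by
      intro a b c p q t h
      simp [h]
    refine key (Y.p.map (e.counitInv.app y)) (Y.p.map (e.counit.app y))
      ((Hom.tri f).app (e.inverse.obj y)) ?_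
    exact (Y.p.map_comp _ _).symm.trans ((congrArg Y.p.map (e.counitIso.inv_hom_id_app y)).trans
      (Y.p.map_id _)))

variable {C : Type*} [Bicategory C] {F G : Pseudofunctor C (CatOver B)}

/-- A strong transformation between functors to categories over `B`, all of whose values on objects
are faithful over `B`. -/
def strongTransMk (hG : ∀ a, (G.obj a).p.Faithful) (app : ∀ a, F.obj a ⟶ G.obj a)
    (naturality : ∀ {a b : C} (r : a ⟶ b), F.map r ≫ app b ≅ app a ≫ G.map r) :
    Pseudofunctor.StrongTrans F G where
  app := app
  naturality := naturality
  -- Each coherence condition compares two parallel 2-cells into a category faithful over the base,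
  -- and there is at most one.
  naturality_naturality _ := Subsingleton.elim _ _
  naturality_id _ := Subsingleton.elim _ _
  naturality_comp _ _ := Subsingleton.elim _ _

open scoped Pseudofunctor.StrongTrans in
/-- A strong transformation which is pointwise an equivalence is an equivalence, for functors to
categories faithful over `B`. -/
def equivalenceOfStrongTrans (hF : ∀ a, (F.obj a).p.Faithful) (hG : ∀ a, (G.obj a).p.Faithful)
    (η : F ⟶ G) (h : ∀ a, (Hom.functor (η.app a)).IsEquivalence) : Bicategory.Equivalence F G :=
  -- The naturality isomorphism of the inverse is the mate of that of `η`, built from the pointwise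
  -- units and counits.
  let θ : G ⟶ F := strongTransMk hF (fun a => inverse (η.app a)) fun {a b} r =>
    (λ_ _).symm ≪≫ whiskerRightIso (inverseCounit (η.app a)).symm _ ≪≫ α_ _ _ _ ≪≫
      whiskerLeftIso (inverse (η.app a)) ((α_ _ _ _).symm ≪≫
        whiskerRightIso (η.naturality r).symm _ ≪≫ α_ _ _ _ ≪≫
        whiskerLeftIso (F.map r) (inverseUnit (η.app b)).symm ≪≫ ρ_ _)
  Bicategory.Equivalence.mkOfAdjointifyCounit (f := η) (g := θ)
    (Pseudofunctor.StrongTrans.isoMk (fun a => inverseUnit (η.app a))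
      fun _ => Subsingleton.elim _ _)
    (Pseudofunctor.StrongTrans.isoMk (fun a => inverseCounit (η.app a))
      fun _ => Subsingleton.elim _ _)

end CatOver

/-! ### Maps of families with given base -/

namespace ZRSpaceOver

variable {P Q R : ZRSpaceOver.{u}}

/-- The unique map `P ⟶ Q` over `b` whose composite with `φ : Q ⟶ R` is `ψ`. -/
def Hom.lift (φ : Q ⟶ R) (ψ : P ⟶ R) (b : P.base ⟶ Q.base) (hb : b ≫ φ.base = ψ.base) :
    P ⟶ Q :=
  have w : ψ.total ≫ R.proj = (P.proj ≫ b) ≫ φ.base := by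
    rw [Category.assoc, hb, ψ.isPullback.w]
  ({ base := b
     total := φ.isPullback.lift ψ.total (P.proj ≫ b) w
     isPullback := by
      refine IsPullback.of_right ?_ (φ.isPullback.lift_snd _ _ w) φ.isPullback
      rw [φ.isPullback.lift_fst, hb]
      exact ψ.isPullback
     equivariant := fun g x => by
      have h₁ := fun y => ConcreteCategory.congr_hom (φ.isPullback.lift_fst _ _ w) y
      have h₂ := fun y => ConcreteCategory.congr_hom (φ.isPullback.lift_snd _ _ w) y
      simp only [ConcreteCategory.comp_apply] at h₁ h₂
      refine ext_of_isPullback φ.isPullback ?_ ?_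
      · rw [h₁, φ.equivariant, h₁, ψ.equivariant]
      · rw [h₂, Q.proj_vadd, h₂, P.proj_vadd] } : ZRSpaceOver.Hom P Q)

theorem Hom.lift_comp (φ : Q ⟶ R) (ψ : P ⟶ R) (b : P.base ⟶ Q.base)
    (hb : b ≫ φ.base = ψ.base) : Hom.lift φ ψ b hb ≫ φ = ψ :=
  hom_ext hb (φ.isPullback.lift_fst _ _ _)

theorem Hom.eq_of_comp_eq (φ : Q ⟶ R) {χ χ' : P ⟶ Q} (hb : χ.base = χ'.base)
    (h : χ ≫ φ = χ' ≫ φ) : χ = χ' := by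
  refine hom_ext hb (φ.isPullback.hom_ext (congrArg ZRSpaceOver.Hom.total h) ?_)
  rw [χ.isPullback.w, χ'.isPullback.w, hb]

end ZRSpaceOver

theorem Family.toTop_isFiberedInGroupoids : IsFiberedInGroupoids Family.toTop.{u} := by
  refine .of_existsUnique (fun L M N φ ψ g hg => ?_) fun L R f => ?_
  · refine ⟨ZRSpaceOver.Hom.lift (Family.Hom.sq φ) (Family.Hom.sq ψ) g hg,
      ⟨rfl, ZRSpaceOver.Hom.lift_comp _ _ _ _⟩, ?_⟩
    rintro χ ⟨h₁, h₂⟩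
    exact ZRSpaceOver.Hom.eq_of_comp_eq (Family.Hom.sq φ) h₁
      (h₂.trans (ZRSpaceOver.Hom.lift_comp _ _ _ _).symm)
  · let M : Family.{u} := ⟨L.space.pullback f, universalFamilies.pullbackStable _ L.isFamily _ f⟩
    let φ : M ⟶ L := L.space.pullbackHom f
    exact ⟨M, φ, inferInstanceAs (Family.toTop.IsHomLift (Family.toTop.map φ) φ)⟩

/-! ### Maps and pullbacks of families with an `I`-section -/

namespace SecFamily

variable {I : PreordPara.{u}}

/-- The map of families from `X` to the universal family. -/
def classifyingMap (X : SecFamily I) : X.family.space ⟶ universalSpace I :=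
  X.isSection.classifyingHom X.family.isFamily

/-- The underlying equivariant pullback square. -/
def Hom.sq {X Y : SecFamily I} (f : X ⟶ Y) : X.family.space ⟶ Y.family.space :=
  Family.Hom.sq (Hom.map f)

theorem fiberHomeo_sec {X Y : SecFamily I} (f : X ⟶ Y) (s : X.family.space.base) (i : I) :
    ZRSpaceOver.Hom.fiberHomeo (Hom.sq f) s (X.sec s i) = Y.sec ((Hom.sq f).base s) i :=
  Subtype.ext (Hom.compat f s i).symm

/-- Maps of families with `I`-section preserve distances. -/
theorem sq_comp_classifyingMap {X Y : SecFamily I} (f : X ⟶ Y) :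
    Hom.sq f ≫ Y.classifyingMap = X.classifyingMap := by
  have hb : ∀ s, Y.classifyingMap.base ((Hom.sq f).base s) = X.classifyingMap.base s := by
    intro s
    refine Subtype.ext (funext fun a => Subtype.ext ?_)
    change transDist (Y.sec ((Hom.sq f).base s) a.1.1) (Y.sec ((Hom.sq f).base s) a.1.2) =
      transDist (X.sec s a.1.1) (X.sec s a.1.2)
    rw [← fiberHomeo_sec, ← fiberHomeo_sec]
    exact transDist_of_equivariant _ (ZRSpaceOver.Hom.fiberHomeo_vadd _ s) _ _
  refine ZRSpaceOver.hom_ext (TopCat.hom_ext (ContinuousMap.ext hb))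
    (TopCat.hom_ext (ContinuousMap.ext fun x => total_ext ?_ fun i => ?_))
  · refine Eq.trans ?_ (hb (X.family.space.proj x))
    exact congrArg Y.classifyingMap.base (ZRSpaceOver.Hom.proj_total (Hom.sq f) x)
  · refine (IsISection.beta_fiber (ZRSpaceOver.Hom.fiberHomeo (Hom.sq f) _
      (X.family.space.toFiber x rfl)) i).trans ?_
    rw [← fiberHomeo_sec]
    exact transDist_of_equivariant _ (ZRSpaceOver.Hom.fiberHomeo_vadd _ _) _ _

/-- Both maps become the classifying map of the source after composition with the classifying
pullback square of the target. -/
theorem hom_ext_of_base {X Y : SecFamily I} {f g : X ⟶ Y}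
    (h : (Hom.sq f).base = (Hom.sq g).base) : f = g :=
  SecFamily.hom_ext (ZRSpaceOver.Hom.eq_of_comp_eq Y.classifyingMap h
    ((sq_comp_classifyingMap f).trans (sq_comp_classifyingMap g).symm))

/-- The map of families with `I`-section over a map of bases compatible with distances. -/
def homOfBase {X Y : SecFamily I} (b : X.family.space.base ⟶ Y.family.space.base)
    (hb : b ≫ Y.classifyingMap.base = X.classifyingMap.base) : X ⟶ Y :=
  let l := ZRSpaceOver.Hom.lift Y.classifyingMap X.classifyingMap b hb
  (⟨l, fun s i => by
    -- Compatibility with sections can be checked in the universal family, where both sections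
    -- become the universal one.
    refine Y.isSection.toUniversal_ext Y.family.isFamily ?_ ?_
    · refine (Y.sec (b s) i).2.trans ?_
      exact ((ZRSpaceOver.Hom.proj_total l _).trans (congrArg b (X.sec s i).2)).symm
    · refine (Y.isSection.toUniversal_sec Y.family.isFamily (b s) i).trans ?_
      have h₁ := ConcreteCategory.congr_hom (congrArg ZRSpaceOver.Hom.total
        (ZRSpaceOver.Hom.lift_comp Y.classifyingMap X.classifyingMap b hb)) (X.sec s i).1
      refine Eq.trans ?_ h₁.symm
      refine Eq.trans ?_ (X.isSection.toUniversal_sec X.family.isFamily s i).symm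
      exact congrArg (fun α : FSpace I => (secPoint α i).1) (ConcreteCategory.congr_hom hb s)⟩ :
    SecFamily.Hom X Y)

/-- The pullback of a family with `I`-section. -/
def pullback (X : SecFamily I) {T : TopCat.{u}} (f : T ⟶ X.family.space.base) : SecFamily I :=
  let m := X.family.space.pullbackHom f
  let e := fun t : T => ZRSpaceOver.Hom.fiberHomeo m t
  have he : ∀ t g x, e t (g +ᵥ x) = g +ᵥ e t x := fun t => ZRSpaceOver.Hom.fiberHomeo_vadd m t
  { family := ⟨X.family.space.pullback f,
      universalFamilies.pullbackStable _ X.family.isFamily _ f⟩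
    sec := fun t i => (X.family.space.pullback f).toFiber ⟨(t, (X.sec (f t) i).1),
      (X.sec (f t) i).2.symm⟩ rfl
    isSection :=
      { not_fixed := fun t i h => X.isSection.not_fixed (f t) i
          ((fixedPts_iff_of_equivariant (e t).injective (he t) _).2 h)
        continuous := fun i => by
          refine Continuous.subtype_mk (Continuous.prodMk continuous_id ?_) _
          exact (X.isSection.continuous i).comp f.hom.continuous
        surjective := fun t x hx => by
          obtain ⟨i, a, h⟩ := X.isSection.surjective (f t) (e t x)
            fun h => hx ((fixedPts_iff_of_equivariant (e t).injective (he t) _).1 h)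
          exact ⟨i, a, (e t).injective ((he t _ _).trans h)⟩
        dist_gt := fun t i j hij => by
          rw [← transDist_of_equivariant (e t) (he t)]
          exact X.isSection.dist_gt (f t) hij
        equivariant := fun t n i => Subtype.ext (Subtype.ext (Prod.ext rfl
          (congrArg Subtype.val (X.isSection.equivariant (f t) n i)))) } }

/-- The canonical map from the pullback. -/
def pullbackHom (X : SecFamily I) {T : TopCat.{u}} (f : T ⟶ X.family.space.base) :
    X.pullback f ⟶ X :=
  (⟨X.family.space.pullbackHom f, fun _ _ => rfl⟩ : SecFamily.Hom (X.pullback f) X)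

end SecFamily

theorem brokenSecObj_isFiberedInGroupoids (I : PreordPara.{u}) :
    IsFiberedInGroupoids (brokenSecObj I).toTop := by
  refine .of_existsUnique (fun (X Y Z : SecFamily I) φ ψ g hg => ?_)
    fun (X : SecFamily I) R f => ?_
  · refine ⟨SecFamily.homOfBase (X := Z) (Y := X) g ?_, ⟨rfl, SecFamily.hom_ext_of_base hg⟩, ?_⟩
    · have h₁ := congrArg ZRSpaceOver.Hom.base (SecFamily.sq_comp_classifyingMap (I := I) φ)
      have h₂ := congrArg ZRSpaceOver.Hom.base (SecFamily.sq_comp_classifyingMap (I := I) ψ)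
      rw [← h₁, ← h₂]
      exact (Category.assoc _ _ _).symm.trans (congrArg (· ≫ Y.classifyingMap.base) hg)
    · rintro χ ⟨h₁, -⟩
      exact SecFamily.hom_ext_of_base h₁
  · exact ⟨X.pullback f, X.pullbackHom f,
      IsHomLift.map (brokenSecObj I).toTop (a := X.pullback f) (b := X) (X.pullbackHom f)⟩

/-! ### The equivalence between `Broken^I` and `F^(I)` -/

variable {I J : PreordPara.{u}}

theorem classifyingMap_secFamily_base (h : UniversalFamilies.{u}) :
    (h.secFamily I).classifyingMap.base = 𝟙 (FSpace I) := by
  refine TopCat.hom_ext (ContinuousMap.ext fun α => Subtype.ext (funext fun a => Subtype.ext ?_))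
  have h₁ : transDist (secPoint (I := I) α a.1.1) (secPoint α a.1.2) = _ :=
    transDist_secPoint a.1.1 (secPoint α a.1.2)
  refine h₁.trans ((coord_secPoint _ _ _).trans (dst_of_le a.2))

/-- The universal family with its `I`-section is terminal. -/
def secFamilyIsTerminal (h : UniversalFamilies.{u}) (I : PreordPara.{u}) :
    Limits.IsTerminal (h.secFamily I) :=
  Limits.IsTerminal.ofUniqueHom
    (fun X => SecFamily.homOfBase (Y := h.secFamily I) X.classifyingMap.base (by
      rw [classifyingMap_secFamily_base]
      exact Category.comp_id _))
    (fun X m => SecFamily.hom_ext_of_base (by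
      have h₁ := congrArg ZRSpaceOver.Hom.base (SecFamily.sq_comp_classifyingMap m)
      refine Eq.trans ?_ h₁
      rw [ZRSpaceOver.comp_base, classifyingMap_secFamily_base]
      exact (Category.comp_id _).symm))

/-- The functor `Pt(Broken^I) → Pt(F^(I))` given by distances. -/
def distFunctor (I : PreordPara.{u}) : SecFamily I ⥤ Over (FSpace I) where
  obj X := Over.mk (Y := X.family.space.base) X.classifyingMap.base
  map f := Over.homMk (SecFamily.Hom.sq f).base
    (congrArg ZRSpaceOver.Hom.base (SecFamily.sq_comp_classifyingMap f))

instance distFunctor_faithful : (distFunctor I).Faithful where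
  map_injective h := SecFamily.hom_ext_of_base (congrArg CommaMorphism.left h)

instance distFunctor_full : (distFunctor I).Full where
  map_surjective f := ⟨SecFamily.homOfBase f.left (Over.w f), Over.OverMorphism.ext rfl⟩

/-- A map to `F^(I)` is recovered as the classifying map of the pulled back universal family, since
the universal family classifies itself by the identity. -/
instance distFunctor_essSurj : (distFunctor I).EssSurj where
  mem_essImage f := by
    let X := (universalFamilies.secFamily I).pullback (T := f.left) f.hom
    refine ⟨X, ⟨Over.isoMk (Iso.refl _) ?_⟩⟩
    have h₁ := congrArg ZRSpaceOver.Hom.base (SecFamily.sq_comp_classifyingMap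
      ((universalFamilies.secFamily I).pullbackHom (T := f.left) f.hom))
    rw [ZRSpaceOver.comp_base, classifyingMap_secFamily_base] at h₁
    exact (Category.id_comp _).trans ((Category.comp_id _).symm.trans h₁)

instance distFunctor_isEquivalence : (distFunctor I).IsEquivalence where

theorem pullbackMap_comp_pullbackHom {P Q : ZRSpaceOver.{u}} (m : P ⟶ Q) {T T' : TopCat.{u}}
    (f : T ⟶ P.base) (g : T' ⟶ Q.base) (b : T ⟶ T') (h : b ≫ g = f ≫ m.base) :
    ZRSpaceOver.pullbackMap m f g b h ≫ Q.pullbackHom g = P.pullbackHom f ≫ m :=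
  ZRSpaceOver.hom_ext h rfl

/-- A family with an `I`-section is isomorphic to the pullback of the universal family along the
map given by distances. -/
def distFunctorTri (h : UniversalFamilies.{u}) (I : PreordPara.{u}) :
    SecFamily.forget I ≅ distFunctor I ⋙ h.toBroken I :=
  NatIso.ofComponents
    (fun X =>
      let φ : (SecFamily.forget I).obj X ⟶ (distFunctor I ⋙ h.toBroken I).obj X :=
        ZRSpaceOver.Hom.lift ((universalSpace I).pullbackHom X.classifyingMap.base)
          X.classifyingMap (𝟙 X.family.space.base) (Category.id_comp _)
      have : IsIso φ := Family.isIso_of_base φ (inferInstanceAs (IsIso (𝟙 X.family.space.base)))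
      asIso φ)
    (fun {X Y} f => by
      refine ZRSpaceOver.Hom.eq_of_comp_eq
        ((universalSpace I).pullbackHom Y.classifyingMap.base) rfl ?_
      have h₁ := ZRSpaceOver.Hom.lift_comp
        ((universalSpace I).pullbackHom Y.classifyingMap.base) Y.classifyingMap (𝟙 _)
        (Category.id_comp _)
      have h₂ := ZRSpaceOver.Hom.lift_comp
        ((universalSpace I).pullbackHom X.classifyingMap.base) X.classifyingMap (𝟙 _)
        (Category.id_comp _)
      exact ((congrArg (SecFamily.Hom.sq f ≫ ·) h₁).trans
        (SecFamily.sq_comp_classifyingMap f)).trans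
        (h₂.symm.trans (congrArg (ZRSpaceOver.Hom.lift _ _ _ _ ≫ ·)
          (pullbackMap_comp_pullbackHom (𝟙 (universalSpace I)) X.classifyingMap.base
            Y.classifyingMap.base (SecFamily.Hom.sq f).base
            (congrArg ZRSpaceOver.Hom.base (SecFamily.sq_comp_classifyingMap f))).symm)))

/-- The morphism `Broken^I → F^(I)` over `Broken` given by distances. -/
def distHom (h : UniversalFamilies.{u}) (I : PreordPara.{u}) : brokenSecObj I ⟶ h.repObj I :=
  (⟨distFunctor I, distFunctorTri h I⟩ : CatOver.Hom (brokenSecObj I) (h.repObj I))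

/-- The morphisms given by distances are natural in `I`. -/
def distHomNaturality (h : UniversalFamilies.{u}) (r : I ⟶ J) :
    brokenSecMap r ≫ distHom h I ≅ distHom h J ≫ h.repMap r :=
  CatOver.isoMk (f := brokenSecMap r ≫ distHom h I) (g := distHom h J ≫ h.repMap r)
    (NatIso.ofComponents (fun X : SecFamily J => Over.isoMk (Iso.refl _) rfl)
      (fun _ => Over.OverMorphism.ext rfl))
    (by
      refine Iso.ext (NatTrans.ext (funext fun X : SecFamily J => ?_))
      -- Two maps into a pulled back family with the same base component agree once they agree after
      -- projection to the universal family over `F^(I)`.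
      refine ZRSpaceOver.Hom.eq_of_comp_eq
        ((universalSpace I).pullbackHom (X.classifyingMap.base ≫ FSpace.map r)) rfl ?_
      have h₁ := ZRSpaceOver.Hom.lift_comp
        ((universalSpace I).pullbackHom ((SecFamily.restrict r).obj X).classifyingMap.base)
        ((SecFamily.restrict r).obj X).classifyingMap (𝟙 _) (Category.id_comp _)
      have h₂ := ZRSpaceOver.Hom.lift_comp
        ((universalSpace J).pullbackHom X.classifyingMap.base) X.classifyingMap (𝟙 _)
        (Category.id_comp _)
      exact Eq.trans h₁ (congrArg (· ≫ Family.Hom.sq (h.familyMap r)) h₂).symm)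

/-- A morphism over `F^(I)` is the base component of the induced map of families. This faithfulness
is what makes the 2-cells into `F^(I)` unique. -/
instance toBroken_faithful (h : UniversalFamilies.{u}) : (h.toBroken I).Faithful where
  map_injective e := Over.OverMorphism.ext (congrArg ZRSpaceOver.Hom.base e)

instance forget_faithful : (SecFamily.forget I).Faithful where
  map_injective e := SecFamily.hom_ext e

/-- The strong transformation given by distances. -/
def distTrans (h : UniversalFamilies.{u}) : Pseudofunctor.StrongTrans brokenSec h.rep :=
  CatOver.strongTransMk (fun I => toBroken_faithful (I := I.as.unop) h)
    (fun I => distHom h I.as.unop) fun r => distHomNaturality h r.as.unop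

open scoped Pseudofunctor.StrongTrans in
/-- The equivalence `Broken^• ≃ F^(•)` given by distances. -/
def distEquivalence (h : UniversalFamilies.{u}) : FunctorEquivalence brokenSec h.rep :=
  CatOver.equivalenceOfStrongTrans (fun I => forget_faithful (I := I.as.unop))
    (fun I => toBroken_faithful (I := I.as.unop) h) (distTrans h)
    (fun I => distFunctor_isEquivalence (I := I.as.unop))

theorem repObj_isFiberedInGroupoids (h : UniversalFamilies.{u}) (I : PreordPara.{u}) :
    IsFiberedInGroupoids (h.repObj I).toTop := by
  refine .of_existsUnique (fun (X Y Z : Over (FSpace I)) φ ψ g hg => ?_)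
    fun (X : Over (FSpace I)) R f => ?_
  · let φ' : X ⟶ Y := φ
    let ψ' : Z ⟶ Y := ψ
    let g' : Z.left ⟶ X.left := g
    have hg' : g' ≫ φ'.left = ψ'.left := hg
    refine ⟨Over.homMk (U := Z) (V := X) g' ?_, ⟨rfl, Over.OverMorphism.ext hg⟩, ?_⟩
    · rw [← Over.w φ', ← Over.w ψ', ← hg', Category.assoc]
    · rintro χ ⟨h₁, -⟩
      exact Over.OverMorphism.ext h₁
  · let f' : R ⟶ X.left := f
    let φ : Over.mk (f' ≫ X.hom) ⟶ X := Over.homMk f' rfl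
    exact ⟨_, φ, IsHomLift.map (h.repObj I).toTop (a := Over.mk (f' ≫ X.hom)) (b := X) φ⟩

end

end BrokenPara

/-- `Broken^I` is represented by `F^(I)`, over `Broken` and functorially in `I`. -/
theorem mainTheorem5 :
    ∃ h : BrokenPara.UniversalFamilies.{u},
      BrokenPara.IsFiberedInGroupoids BrokenPara.Family.toTop.{u} ∧
      ∃ e : BrokenPara.FunctorEquivalence BrokenPara.brokenSec h.rep,
        ∀ I : BrokenPara.PreordPara.{u},
          BrokenPara.IsFiberedInGroupoids (BrokenPara.brokenSecObj I).toTop ∧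
          BrokenPara.IsFiberedInGroupoids (h.repObj I).toTop ∧
          (BrokenPara.CatOver.Hom.functor (e.at I)).IsEquivalence ∧
          BrokenPara.CatOver.RespectsCartesian (e.at I) ∧
          h.GivenByDistances I (e.at I) ∧
          Nonempty (CategoryTheory.Limits.IsTerminal (h.secFamily I)) := by
  let h := BrokenPara.universalFamilies.{u}
  refine ⟨h, BrokenPara.Family.toTop_isFiberedInGroupoids, BrokenPara.distEquivalence h,
    fun I => ⟨BrokenPara.brokenSecObj_isFiberedInGroupoids I,
      BrokenPara.repObj_isFiberedInGroupoids h I, BrokenPara.distFunctor_isEquivalence,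
      -- In a category fibered in groupoids every edge is Cartesian, so nothing is required of the
      -- functor.
      fun _ _ _ _ => (BrokenPara.repObj_isFiberedInGroupoids h I).2 _, ?_,
      ⟨BrokenPara.secFamilyIsTerminal h I⟩⟩⟩
  intro X s i j hij
  -- The triangle over `Broken` has the identity as base component, and the classifying map is
  -- defined by distances.
  rfl
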